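/- Let $n\ge 1$ and let $b\in C^\infty([0,\infty);\mathbb R)$ satisfy (H1) $b(t)\ge 0$; (H2) $b$ is monotone; (H3) for every integer $k\ge 1$ there is a constant $C_k$ with $|b^{(k)}(t)|\le C_k\, b(t)\,(1+t)^{-k}$ for all $t\ge 0$; (NE) (non-effective dissipation) $\limsup_{t\to\infty} t\,b(t)<1$. Put $\lambda(t)=\exp\{\tfrac12\int_0^t b(\tau)\,d\tau\}$, $D_t=-i\partial_t$, and let $|D|$ and $\langle D\rangle$ be the Fourier multipliers with symbols $|\xi|$ and $\langle\xi\rangle=(1+|\xi|^2)^{1/2}$. For $u_1\in H^1(\mathbb R^n)$ and $u_2\in L^2(\mathbb R^n)$ (complex valued) let $u\in C([0,\infty);H^1)\cap C^1([0,\infty);L^2)$ be the finite energy solution of $$u_{tt}-\Delta u+b(t)u_t=0,\qquad u(0,\cdot)=u_1,\quad D_tu(0,\cdot)=u_2,$$ and let $\mathbb E(t)$, $t\ge0$, be the energy operator $$\mathbb E(t):(\langle D\rangle u_1,u_2)\mapsto(|D|u(t,\cdot),D_tu(t,\cdot)),$$ a well-defined bounded operator on $L^2(\mathbb R^n;\mathbb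 C^2)$. Let $\mathbb E_0(t)$ be the unitary propagator of free waves on $L^2(\mathbb R^n;\mathbb C^2)$, i.e. the unique unitary operator with $$\mathbb E_0(t):(|D|\tilde u(0,\cdot),D_t\tilde u(0,\cdot))\mapsto(|D|\tilde u(t,\cdot),D_t\tilde u(t,\cdot))$$ for all finite energy solutions $\tilde u$ of $\tilde u_{tt}-\Delta\tilde u=0$. Then the strong limit $$W_+=\operatorname*{s-lim}_{t\to\infty}\ \lambda(t)\,\mathbb E_0(t)^{-1}\,\mathbb E(t)$$ exists on $L^2(\mathbb R^n;\mathbb C^2)$, and $W_+$ is a bounded, injective, translation-invariant operator with dense range. -/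

import Mathlib

open scoped ENNReal NNReal ContDiff FourierTransform SchwartzMap Laplacian

noncomputable section

namespace DampedWave

/-- The complex Hilbert space `L²(ℝⁿ; ℂ)`. -/
abbrev L2 (n : ℕ) : Type :=
  MeasureTheory.Lp (α := EuclideanSpace ℝ (Fin n)) ℂ 2 MeasureTheory.volume

/-- The complex Hilbert space `L²(ℝⁿ; ℂ²)`, as the Hilbert sum `L² ⊕ L²`. -/
abbrev L2Pair (n : ℕ) : Type := WithLp 2 (L2 n × L2 n)

/-- `IsMultiplier m f g`: the function `f ∈ L²` lies in the (maximal) domain of the Fourier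
multiplier `m(D)` and `m(D) f = g`. Mathlib's Fourier transform on `L²` is the one with kernel
`exp (-2 π i x · η)`; the usual frequency is therefore `ξ = 2 π η`, and `m` is a function of `ξ`. -/
def IsMultiplier {n : ℕ} (m : EuclideanSpace ℝ (Fin n) → ℂ) (f g : L2 n) : Prop :=
  ∀ᵐ η : EuclideanSpace ℝ (Fin n) ∂MeasureTheory.volume,
    (𝓕 g : L2 n) η = m ((2 * Real.pi) • η) * (𝓕 f : L2 n) η

/-- The symbol `|ξ|` of `|D|`. -/
def absSymbol {n : ℕ} (ξ : EuclideanSpace ℝ (Fin n)) : ℂ := (‖ξ‖ : ℂ)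

/-- The symbol `⟨ξ⟩ = (1 + |ξ|²)^{1/2}` of `⟨D⟩`. The domain of `⟨D⟩` in `L²` is `H¹`. -/
def bracketSymbol {n : ℕ} (ξ : EuclideanSpace ℝ (Fin n)) : ℂ := (Real.sqrt (1 + ‖ξ‖ ^ 2) : ℂ)

/-- The time derivative `∂ₜ u (t) ∈ L²` (one-sided at `t = 0`) of a curve `u : [0, ∞) → L²`. -/
def timeDeriv {n : ℕ} (u : ℝ → L2 n) (t : ℝ) : L2 n := derivWithin u (Set.Ici 0) t

/-- `Dₜ u = -i ∂ₜ u`. -/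
def Dt {n : ℕ} (u : ℝ → L2 n) (t : ℝ) : L2 n := (-Complex.I) • timeDeriv u t

/-- `u` is a finite energy solution, `u ∈ C([0, ∞); H¹) ∩ C¹([0, ∞); L²)`, of the Cauchy problem
`u_tt - Δ u + b(t) u_t = 0`, `u(0) = u₁`, `Dₜ u(0) = u₂`; the equation is understood in the sense
of tempered distributions on `ℝⁿ` for every `t ≥ 0`. -/
structure IsSolution {n : ℕ} (b : ℝ → ℝ) (u₁ u₂ : L2 n) (u : ℝ → L2 n) : Prop where
  contDiffOn : ContDiffOn ℝ 1 u (Set.Ici 0)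
  continuousOn_H1 : ∃ w : ℝ → L2 n, ContinuousOn w (Set.Ici 0) ∧
    ∀ t : ℝ, 0 ≤ t → IsMultiplier bracketSymbol (u t) (w t)
  equation : ∀ φ : 𝓢(EuclideanSpace ℝ (Fin n), ℂ), ∀ t : ℝ, 0 ≤ t →
    HasDerivWithinAt
      (fun s : ℝ => (timeDeriv u s : 𝓢'(EuclideanSpace ℝ (Fin n), ℂ)) φ)
      ((Δ (u t : 𝓢'(EuclideanSpace ℝ (Fin n), ℂ))) φ
        - (b t : ℂ) * (timeDeriv u t : 𝓢'(EuclideanSpace ℝ (Fin n), ℂ)) φ)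
      (Set.Ici 0) t
  initial_value : u 0 = u₁
  initial_velocity : Dt u 0 = u₂

/-- `e = (|D| u(t), Dₜ u(t))`. -/
def IsEnergyState {n : ℕ} (u : ℝ → L2 n) (t : ℝ) (e : L2Pair n) : Prop :=
  IsMultiplier absSymbol (u t) e.fst ∧ Dt u t = e.snd

/-- `E(t)`, `t ≥ 0`, is the energy operator `(⟨D⟩ u₁, u₂) ↦ (|D| u(t), Dₜ u(t))` on `L²(ℝⁿ; ℂ²)`
of the Cauchy problem with dissipation `b`. It is included that for all data `u₁ ∈ H¹`, `u₂ ∈ L²`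
the Cauchy problem has a solution. Since `⟨D⟩ : H¹ → L²` is onto, this determines every `E(t)`. -/
def IsEnergyOperator {n : ℕ} (b : ℝ → ℝ) (E : ℝ≥0 → (L2Pair n →L[ℂ] L2Pair n)) : Prop :=
  ∀ (u₁ u₂ : L2 n) (d : L2Pair n), IsMultiplier bracketSymbol u₁ d.fst → d.snd = u₂ →
    (∃ u : ℝ → L2 n, IsSolution b u₁ u₂ u) ∧
    ∀ u : ℝ → L2 n, IsSolution b u₁ u₂ u → ∀ t : ℝ≥0, IsEnergyState u t (E t d)

/-- `E₀(t)`, `t ≥ 0`, is the unitary propagator `(|D| u(0), Dₜ u(0)) ↦ (|D| u(t), Dₜ u(t))` of the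
free wave equation `u_tt - Δ u = 0` in the energy space, realised on `L²(ℝⁿ; ℂ²)`: it acts in this
way on all finite energy solutions, which exist for all data in `H¹ × L²`. The pairs
`(|D| u₁, u₂)` with such data are dense in `L²(ℝⁿ; ℂ²)` for `n ≥ 1`, so that this determines every
`E₀(t)`. -/
def IsFreePropagator {n : ℕ} (E₀ : ℝ≥0 → (L2Pair n ≃ₗᵢ[ℂ] L2Pair n)) : Prop :=
  ∀ (u₁ u₂ h : L2 n), IsMultiplier bracketSymbol u₁ h →
    (∃ u : ℝ → L2 n, IsSolution (fun _ => 0) u₁ u₂ u) ∧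
    ∀ u : ℝ → L2 n, IsSolution (fun _ => 0) u₁ u₂ u → ∀ (t : ℝ≥0) (d e : L2Pair n),
      IsEnergyState u 0 d → IsEnergyState u t e → E₀ t d = e

/-- `λ(t) = exp (½ ∫₀ᵗ b(τ) dτ)`. -/
def dampingFactor (b : ℝ → ℝ) (t : ℝ) : ℝ := Real.exp (1 / 2 * ∫ τ in (0 : ℝ)..t, b τ)

/-- The translate `x ↦ f (x - a)` of `f ∈ L²`. -/
def translate {n : ℕ} (a : EuclideanSpace ℝ (Fin n)) (f : L2 n) : L2 n :=
  MeasureTheory.Lp.compMeasurePreserving (fun x : EuclideanSpace ℝ (Fin n) => x - a)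
    (MeasureTheory.measurePreserving_sub_right MeasureTheory.volume a) f

/-- The translation acts on `L²(ℝⁿ; ℂ²)` componentwise. -/
def translatePair {n : ℕ} (a : EuclideanSpace ℝ (Fin n)) (f : L2Pair n) : L2Pair n :=
  WithLp.toLp 2 (translate a f.fst, translate a f.snd)

end DampedWave

end

/-! The Fourier transform turns the problem into the ordinary differential equations `y'' + b y' +
r² y = 0` with `r = |ξ|`, and `λ(t) E₀(t)⁻¹ E(t)` into a Fourier multiplier with a 2×2 matrix
symbol. A family of multipliers converges strongly as soon as its symbols are bounded uniformly in
time and frequency and converge almost everywhere (`tendsto_fMul`: Plancherel and dominated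
convergence). So two facts about a single mode are needed.

Pointwise convergence, for fixed `r > 0` (`exists_tendsto`): by Liouville's transformation `v = λ y`
solves `v'' + r² v = q v` with `q = b²/4 + b'/2 = O((1+t)⁻²)`. The free evolution rotates `(r v,
v')` by the angle `r t`; undoing this rotation leaves a bounded curve with integrable derivative.

Uniform bound (`mode_le`): the perturbation `q` costs only a factor `exp Q` once `r (1+t) ≥ 1`, but
no uniform factor as `r → 0`. While `r (1+t) ≤ 1`, the solution is compared with a zero frequency
solution, through the weight `h` with `h' = 1 + b h`. This works because `h = O(1+t)`, which is
where `limsup t b(t) < 1` enters (`exists_dampingBounds`). The two estimates are glued at the time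
where `r (1+t) = 1`.

Injectivity and dense range come from the determinant. By Abel's identity and since free waves have
determinant 1, the determinant of the symbol is `|ξ| / ⟨ξ⟩` at every time (`row_det`), hence also in
the limit, and it is nonzero almost everywhere; multiplying by the adjugate matrix finishes the
argument. Translations are multipliers themselves and commute with the entries of the symbol.

To identify `E(t)` and `E₀(t)` with explicit multipliers, finite energy solutions must be unique.
This is an energy estimate after applying the smoothing `(1 + |η|²)⁻¹`, which makes the equation an
identity in `L²` with bounded operators (`IsSolution.unique`). -/

noncomputable section

namespace DampedWave

open MeasureTheory Filter Topology

/-! ### Bounded Fourier multipliers on `L²`. -/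

section

variable {n : ℕ}

/-- Pointwise multiplication by an essentially bounded function on `L²` (zero if `m ∉ L^∞`). -/
def symMul (m : EuclideanSpace ℝ (Fin n) → ℂ) : L2 n →L[ℂ] L2 n :=
  open Classical in
  if h : MemLp m ∞ (volume : Measure (EuclideanSpace ℝ (Fin n))) then
    (ContinuousLinearMap.lsmul ℂ ℂ : ℂ →L[ℂ] ℂ →L[ℂ] ℂ).holderL volume ∞ 2 2 h.toLp
  else 0

theorem coeFn_symMul {m : EuclideanSpace ℝ (Fin n) → ℂ} (h : MemLp m ∞ volume) (f : L2 n) :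
    (symMul m f : L2 n) =ᵐ[volume] fun η => m η * f η := by
  rw [symMul, dif_pos h, ContinuousLinearMap.holderL_apply_apply]
  refine ((ContinuousLinearMap.lsmul ℂ ℂ : ℂ →L[ℂ] ℂ →L[ℂ] ℂ).coeFn_holder _ _).trans ?_
  filter_upwards [h.coeFn_toLp] with x hx
  simp [hx]

/-- The Fourier multiplier whose symbol, as a function of the variable `η` of Mathlib's Fourier
transform, is the essentially bounded function `m`. -/
def fMul (m : EuclideanSpace ℝ (Fin n) → ℂ) : L2 n →L[ℂ] L2 n :=
  ((Lp.fourierTransformₗᵢ (EuclideanSpace ℝ (Fin n)) ℂ).symm.toContinuousLinearEquiv :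
    L2 n →L[ℂ] L2 n) ∘L symMul m ∘L
  ((Lp.fourierTransformₗᵢ (EuclideanSpace ℝ (Fin n)) ℂ).toContinuousLinearEquiv :
    L2 n →L[ℂ] L2 n)

theorem fourier_fMul_eq (m : EuclideanSpace ℝ (Fin n) → ℂ) (f : L2 n) :
    𝓕 (fMul m f) = symMul m (𝓕 f) :=
  (Lp.fourierTransformₗᵢ (EuclideanSpace ℝ (Fin n)) ℂ).apply_symm_apply _

theorem fourier_fMul {m : EuclideanSpace ℝ (Fin n) → ℂ} (h : MemLp m ∞ volume) (f : L2 n) :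
    (𝓕 (fMul m f) : L2 n) =ᵐ[volume] fun η => m η * (𝓕 f : L2 n) η := by
  rw [fourier_fMul_eq]
  exact coeFn_symMul h _

theorem fourier_sub (f g : L2 n) : 𝓕 (f - g) = (𝓕 f - 𝓕 g : L2 n) :=
  map_sub (Lp.fourierTransformₗᵢ (EuclideanSpace ℝ (Fin n)) ℂ) f g

theorem fourier_zero : 𝓕 (0 : L2 n) = (0 : L2 n) :=
  map_zero (Lp.fourierTransformₗᵢ (EuclideanSpace ℝ (Fin n)) ℂ)

theorem L2.ext_fourier {f g : L2 n} (h : (𝓕 f : L2 n) =ᵐ[volume] (𝓕 g : L2 n)) : f = g :=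
  (Lp.fourierTransformₗᵢ (EuclideanSpace ℝ (Fin n)) ℂ).injective (Lp.ext h)

theorem eq_fMul_of_fourier {m : EuclideanSpace ℝ (Fin n) → ℂ} (h : MemLp m ∞ volume) {f g : L2 n}
    (hg : (𝓕 g : L2 n) =ᵐ[volume] fun η => m η * (𝓕 f : L2 n) η) : g = fMul m f :=
  L2.ext_fourier (hg.trans (fourier_fMul h f).symm)

theorem memLp_top_mul {m₁ m₂ : EuclideanSpace ℝ (Fin n) → ℂ} (h₁ : MemLp m₁ ∞ volume)
    (h₂ : MemLp m₂ ∞ volume) : MemLp (fun η => m₁ η * m₂ η) ∞ volume :=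
  MemLp.mul' h₂ h₁

theorem fMul_fMul {m₁ m₂ : EuclideanSpace ℝ (Fin n) → ℂ} (h₁ : MemLp m₁ ∞ volume)
    (h₂ : MemLp m₂ ∞ volume) (f : L2 n) :
    fMul m₁ (fMul m₂ f) = fMul (fun η => m₁ η * m₂ η) f := by
  refine eq_fMul_of_fourier (memLp_top_mul h₁ h₂) ?_
  filter_upwards [fourier_fMul h₁ (fMul m₂ f), fourier_fMul h₂ f] with η h h'
  rw [h, h', mul_assoc]

theorem fMul_congr {m₁ m₂ : EuclideanSpace ℝ (Fin n) → ℂ} (h : m₁ =ᵐ[volume] m₂) (f : L2 n) :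
    fMul m₁ f = fMul m₂ f := by
  by_cases h₁ : MemLp m₁ ∞ (volume : Measure (EuclideanSpace ℝ (Fin n)))
  · refine eq_fMul_of_fourier ((memLp_congr_ae h).1 h₁) ?_
    filter_upwards [fourier_fMul h₁ f, h] with η h h'
    rw [h, h']
  · have h₂ : ¬ MemLp m₂ ∞ (volume : Measure (EuclideanSpace ℝ (Fin n))) := fun h₂ =>
      h₁ ((memLp_congr_ae h).2 h₂)
    simp [fMul, symMul, h₁, h₂]

theorem fMul_add {m₁ m₂ : EuclideanSpace ℝ (Fin n) → ℂ} (h₁ : MemLp m₁ ∞ volume)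
    (h₂ : MemLp m₂ ∞ volume) (f : L2 n) :
    fMul m₁ f + fMul m₂ f = fMul (fun η => m₁ η + m₂ η) f := by
  refine eq_fMul_of_fourier (h₁.add h₂) ?_
  rw [FourierTransform.fourier_add]
  filter_upwards [fourier_fMul h₁ f, fourier_fMul h₂ f,
    Lp.coeFn_add (𝓕 (fMul m₁ f) : L2 n) (𝓕 (fMul m₂ f) : L2 n)] with η h h' h''
  rw [h'', Pi.add_apply, h, h', Pi.add_apply, add_mul]

theorem fMul_smul {m : EuclideanSpace ℝ (Fin n) → ℂ} (h : MemLp m ∞ volume) (c : ℂ) (f : L2 n) :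
    c • fMul m f = fMul (fun η => c * m η) f := by
  refine eq_fMul_of_fourier (h.const_mul c) ?_
  rw [FourierTransform.fourier_smul]
  filter_upwards [fourier_fMul h f, Lp.coeFn_smul c (𝓕 (fMul m f) : L2 n)] with η h h'
  rw [h', Pi.smul_apply, h, smul_eq_mul, mul_assoc]

theorem fMul_one (f : L2 n) : fMul (fun _ => 1) f = f := by
  refine (eq_fMul_of_fourier (memLp_top_const 1) ?_).symm
  simp

theorem fMul_zero (f : L2 n) : fMul (fun _ => 0) f = 0 := by
  have := fMul_smul (memLp_top_const (1 : ℂ) (μ := (volume : Measure (EuclideanSpace ℝ (Fin n)))))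
    0 f
  simpa using this.symm

/-- By Plancherel the squared distance is the integral of `|m i - m₀|² |𝓕 f|²`, which tends to zero
by dominated convergence. No uniform convergence of the symbols is required, so the limit is a
strong one. -/
theorem tendsto_fMul {ι : Type*} {l : Filter ι} [l.IsCountablyGenerated]
    {m : ι → EuclideanSpace ℝ (Fin n) → ℂ} {m₀ : EuclideanSpace ℝ (Fin n) → ℂ}
    (h : ∀ᶠ i in l, MemLp (m i) ∞ volume) (h₀ : MemLp m₀ ∞ volume) (C : ℝ)
    (hC : ∀ᶠ i in l, ∀ᵐ η, ‖m i η‖ ≤ C)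
    (hm : ∀ᵐ η, Tendsto (fun i => m i η) l (𝓝 (m₀ η))) (f : L2 n) :
    Tendsto (fun i => fMul (m i) f) l (𝓝 (fMul m₀ f)) := by
  rw [tendsto_iff_norm_sub_tendsto_zero]
  have hmem : ∃ C₀, ∀ᵐ η, ‖m₀ η‖ ≤ C₀ := by
    refine ⟨(eLpNormEssSup m₀ (volume : Measure (EuclideanSpace ℝ (Fin n)))).toReal, ?_⟩
    have hfin := h₀.2
    rw [eLpNorm_exponent_top] at hfin
    filter_upwards [ae_le_eLpNormEssSup (f := m₀)
      (μ := (volume : Measure (EuclideanSpace ℝ (Fin n))))] with η hη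
    have := ENNReal.toReal_mono hfin.ne hη
    simpa using this
  obtain ⟨C₀, hC₀⟩ := hmem
  have hsq : Tendsto (fun i => ‖fMul (m i) f - fMul m₀ f‖ ^ 2) l (𝓝 0) := by
    have key : ∀ᶠ i in l, ∫ η, ‖(m i η - m₀ η) * (𝓕 f : L2 n) η‖ ^ 2
        = ‖fMul (m i) f - fMul m₀ f‖ ^ 2 := by
      filter_upwards [h] with i hi
      rw [← Lp.norm_fourier_eq, ← inner_self_eq_norm_sq (𝕜 := ℂ), L2.inner_def,
        ← integral_re (L2.integrable_inner _ _), fourier_sub]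
      refine integral_congr_ae ?_
      filter_upwards [fourier_fMul hi f, fourier_fMul h₀ f,
        Lp.coeFn_sub (𝓕 (fMul (m i) f) : L2 n) (𝓕 (fMul m₀ f) : L2 n)] with η h h' h''
      rw [h'', Pi.sub_apply, h, h', inner_self_eq_norm_sq, sub_mul]
    refine Tendsto.congr' key ?_
    have hz : (0 : ℝ) = ∫ η : EuclideanSpace ℝ (Fin n), (0 : ℝ) := by simp
    rw [hz]
    refine tendsto_integral_filter_of_dominated_convergence
      (fun η => (C + C₀) ^ 2 * ‖(𝓕 f : L2 n) η‖ ^ 2) ?_ ?_ ?_ ?_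
    · filter_upwards [h] with i hi
      exact (((hi.1.sub h₀.1).mul (Lp.aestronglyMeasurable _)).norm.pow 2)
    · filter_upwards [hC] with i hi
      filter_upwards [hi, hC₀] with η h1 h2
      rw [Real.norm_of_nonneg (by positivity), norm_mul, mul_pow]
      gcongr
      exact (norm_sub_le _ _).trans (add_le_add h1 h2)
    · exact ((memLp_two_iff_integrable_sq_norm (Lp.aestronglyMeasurable _)).1
        (Lp.memLp (𝓕 f : L2 n))).const_mul _
    · filter_upwards [hm] with η hη
      have h1 : Tendsto (fun i => (m i η - m₀ η) * (𝓕 f : L2 n) η) l (𝓝 0) := by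
        simpa using (hη.sub_const (m₀ η)).mul_const ((𝓕 f : L2 n) η)
      simpa using h1.norm.pow 2
  have := hsq.sqrt
  simpa using this

theorem fMul_injective {m : EuclideanSpace ℝ (Fin n) → ℂ} (h : MemLp m ∞ volume)
    (hm : ∀ᵐ η, m η ≠ 0) : Function.Injective (fMul m : L2 n → L2 n) := by
  rw [injective_iff_map_eq_zero]
  intro f hf
  have h1 := fourier_fMul h f
  rw [hf] at h1
  refine L2.ext_fourier ?_
  rw [fourier_zero] at h1 ⊢
  filter_upwards [h1, hm, Lp.coeFn_zero (E := ℂ) (p := 2)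
    (μ := (volume : Measure (EuclideanSpace ℝ (Fin n))))] with η h1 h2 h3
  rw [h3] at h1 ⊢
  simpa [h2, eq_comm] using h1

theorem inner_fMul {m : EuclideanSpace ℝ (Fin n) → ℂ} (h : MemLp m ∞ volume) (f g : L2 n) :
    inner ℂ (fMul m f) g = inner ℂ f (fMul (fun η => star (m η)) g) := by
  rw [← Lp.inner_fourier_eq, ← Lp.inner_fourier_eq f, L2.inner_def, L2.inner_def]
  refine integral_congr_ae ?_
  filter_upwards [fourier_fMul h f, fourier_fMul h.star g] with η h1 h2
  have h3 : (𝓕 (fMul (fun η => star (m η)) g) : L2 n) η = star (m η) * (𝓕 g : L2 n) η := h2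
  rw [h1, h3]
  simp only [RCLike.inner_apply, map_mul, RCLike.star_def]
  ring

/-- The orthogonal complement of the range is the kernel of the adjoint, and the adjoint is the
multiplier with the conjugate symbol, which also vanishes almost nowhere. -/
theorem fMul_denseRange {m : EuclideanSpace ℝ (Fin n) → ℂ} (h : MemLp m ∞ volume)
    (hm : ∀ᵐ η, m η ≠ 0) : DenseRange (fMul m : L2 n → L2 n) := by
  have h1 : (LinearMap.range (fMul m : L2 n →ₗ[ℂ] L2 n)).topologicalClosure = ⊤ := by
    rw [Submodule.topologicalClosure_eq_top_iff, Submodule.eq_bot_iff]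
    intro g hg
    rw [Submodule.mem_orthogonal] at hg
    have h2 : fMul (fun η => star (m η)) g = 0 := by
      refine ext_inner_left ℂ fun f => ?_
      rw [← inner_fMul h, inner_zero_right]
      exact hg _ ⟨f, rfl⟩
    refine fMul_injective h.star ?_ (h2.trans (map_zero _).symm)
    filter_upwards [hm] with η hη
    simpa using hη
  have h2 := Submodule.dense_iff_topologicalClosure_eq_top.2 h1
  simpa [DenseRange, LinearMap.coe_range] using h2

/-! ### Translations -/

theorem translate_toLp (a : EuclideanSpace ℝ (Fin n)) (φ : 𝓢(EuclideanSpace ℝ (Fin n), ℂ)) :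
    translate a (φ.toLp 2) = (SchwartzMap.compSubConstCLM ℂ a φ).toLp 2 := by
  refine Lp.ext ?_
  have hmp := measurePreserving_sub_right (volume : Measure (EuclideanSpace ℝ (Fin n))) a
  filter_upwards [Lp.coeFn_compMeasurePreserving (φ.toLp 2) hmp,
    hmp.quasiMeasurePreserving.ae_eq_comp (φ.coeFn_toLp 2),
    (SchwartzMap.compSubConstCLM ℂ a φ).coeFn_toLp 2] with x h1 h2 h3
  rw [h3, SchwartzMap.compSubConstCLM_apply]
  exact h1.trans h2

/-- The symbol `exp (-2 π i a · η)` of the translation by `a`. -/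
def shiftSymbol (a η : EuclideanSpace ℝ (Fin n)) : ℂ := (Real.fourierChar (-inner ℝ a η) : ℂ)

theorem memLp_shiftSymbol (a : EuclideanSpace ℝ (Fin n)) : MemLp (shiftSymbol a) ∞ volume := by
  refine memLp_top_of_bound (C := 1) (Continuous.aestronglyMeasurable ?_)
    (Eventually.of_forall fun η => ?_)
  · unfold shiftSymbol
    fun_prop
  · exact (Circle.norm_coe _).le

theorem continuous_translate (a : EuclideanSpace ℝ (Fin n)) :
    Continuous (translate a : L2 n → L2 n) :=
  (Lp.isometry_compMeasurePreserving
    (measurePreserving_sub_right (volume : Measure (EuclideanSpace ℝ (Fin n))) a)).continuous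

/-- Both sides are continuous in `f`, so Schwartz functions suffice, where this is the shift rule of
the Fourier integral. Translation invariance thereby becomes commutativity of multiplication of
symbols. -/
theorem translate_eq_fMul (a : EuclideanSpace ℝ (Fin n)) (f : L2 n) :
    translate a f = fMul (shiftSymbol a) f := by
  refine DenseRange.induction_on (p := fun f : L2 n => translate a f = fMul (shiftSymbol a) f)
    (SchwartzMap.denseRange_toLpCLM (p := 2) ENNReal.ofNat_ne_top) f
    (isClosed_eq (continuous_translate a) (fMul _).continuous) fun φ => ?_
  refine eq_fMul_of_fourier (memLp_shiftSymbol a) ?_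
  rw [SchwartzMap.toLpCLM_apply, translate_toLp, SchwartzMap.toLp_fourier_eq,
    SchwartzMap.toLp_fourier_eq]
  filter_upwards [(𝓕 (SchwartzMap.compSubConstCLM ℂ a φ)).coeFn_toLp 2,
    (𝓕 φ).coeFn_toLp 2] with η h1 h2
  rw [h1, h2, SchwartzMap.fourier_coe, SchwartzMap.fourier_coe]
  have h3 := congrFun (VectorFourier.fourierIntegral_comp_add_right Real.fourierChar
    (volume : Measure (EuclideanSpace ℝ (Fin n))) (innerₗ (EuclideanSpace ℝ (Fin n)))
    (φ : EuclideanSpace ℝ (Fin n) → ℂ) (-a)) η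
  have h4 : (⇑(SchwartzMap.compSubConstCLM ℂ a φ) : EuclideanSpace ℝ (Fin n) → ℂ)
      = φ ∘ fun x => x + -a := by
    ext x
    simp [sub_eq_add_neg]
  rw [h4]
  simp only [map_neg, innerₗ_apply_apply, LinearMap.neg_apply, Circle.smul_def, smul_eq_mul] at h3
  exact h3

theorem translate_fMul {m : EuclideanSpace ℝ (Fin n) → ℂ} (h : MemLp m ∞ volume)
    (a : EuclideanSpace ℝ (Fin n)) (f : L2 n) :
    translate a (fMul m f) = fMul m (translate a f) := by
  rw [translate_eq_fMul, translate_eq_fMul, fMul_fMul (memLp_shiftSymbol a) h,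
    fMul_fMul h (memLp_shiftSymbol a)]
  simp only [mul_comm]

theorem translate_add (a : EuclideanSpace ℝ (Fin n)) (f g : L2 n) :
    translate a (f + g) = translate a f + translate a g := by
  simp only [translate_eq_fMul, map_add]

/-! ### Multipliers in the sense of `IsMultiplier` -/

theorem isMultiplier_unique {m : EuclideanSpace ℝ (Fin n) → ℂ} {f g₁ g₂ : L2 n}
    (h₁ : IsMultiplier m f g₁) (h₂ : IsMultiplier m f g₂) : g₁ = g₂ := by
  refine L2.ext_fourier ?_
  filter_upwards [h₁, h₂] with η h₁ h₂
  rw [h₁, h₂]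

theorem isMultiplier_fMul {m a : EuclideanSpace ℝ (Fin n) → ℂ} (ha : MemLp a ∞ volume)
    (hma : MemLp (fun η => m ((2 * Real.pi) • η) * a η) ∞ volume) (h : L2 n) :
    IsMultiplier m (fMul a h) (fMul (fun η => m ((2 * Real.pi) • η) * a η) h) := by
  unfold IsMultiplier
  filter_upwards [fourier_fMul ha h, fourier_fMul hma h] with η h1 h2
  rw [h1, h2, mul_assoc]

theorem IsMultiplier.add {m : EuclideanSpace ℝ (Fin n) → ℂ} {f₁ f₂ g₁ g₂ : L2 n}
    (h₁ : IsMultiplier m f₁ g₁) (h₂ : IsMultiplier m f₂ g₂) :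
    IsMultiplier m (f₁ + f₂) (g₁ + g₂) := by
  unfold IsMultiplier at *
  rw [FourierTransform.fourier_add, FourierTransform.fourier_add]
  filter_upwards [h₁, h₂, Lp.coeFn_add (𝓕 f₁ : L2 n) (𝓕 f₂ : L2 n),
    Lp.coeFn_add (𝓕 g₁ : L2 n) (𝓕 g₂ : L2 n)] with η h1 h2 h3 h4
  rw [h3, h4, Pi.add_apply, Pi.add_apply, h1, h2, mul_add]

end

section

/-! ### The ordinary differential equation of a single frequency -/

/-- `y` solves `y'' + b y' + r² y = 0` on `[0, ∞)` and `y'` is its derivative. -/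
structure IsModeSolution (b : ℝ → ℝ) (r : ℝ) (y y' : ℝ → ℝ) : Prop where
  hasDeriv : ∀ t, 0 ≤ t → HasDerivWithinAt y (y' t) (Set.Ici 0) t
  hasDeriv' : ∀ t, 0 ≤ t → HasDerivWithinAt y' (-(r ^ 2 * y t) - b t * y' t) (Set.Ici 0) t

/-- The fundamental solutions `y₁ r`, `y₂ r` with data `(1, 0)` and `(0, 1)`. -/
structure IsFundamental (b : ℝ → ℝ) (y₁ y₁' y₂ y₂' : ℝ → ℝ → ℝ) : Prop where
  sol₁ : ∀ r, IsModeSolution b r (y₁ r) (y₁' r)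
  sol₂ : ∀ r, IsModeSolution b r (y₂ r) (y₂' r)
  init₁ : ∀ r, y₁ r 0 = 1
  init₁' : ∀ r, y₁' r 0 = 0
  init₂ : ∀ r, y₂ r 0 = 0
  init₂' : ∀ r, y₂' r 0 = 1
  meas₁ : ∀ t, 0 ≤ t → Measurable fun r => y₁ r t
  meas₁' : ∀ t, 0 ≤ t → Measurable fun r => y₁' r t
  meas₂ : ∀ t, 0 ≤ t → Measurable fun r => y₂ r t
  meas₂' : ∀ t, 0 ≤ t → Measurable fun r => y₂' r t

theorem isFundamental_free : IsFundamental (fun _ => 0) (fun r t => Real.cos (r * t))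
    (fun r t => -(r * Real.sin (r * t)))
    (fun r t => if r = 0 then t else Real.sin (r * t) / r) (fun r t => Real.cos (r * t)) where
  sol₁ r := by
    have hid : ∀ t : ℝ, HasDerivAt (fun t => r * t) r t := fun t => by
      simpa using (hasDerivAt_id t).const_mul r
    refine ⟨fun t _ => ?_, fun t _ => ?_⟩
    · convert! ((hid t).cos).hasDerivWithinAt using 1
      ring
    · convert! (((hid t).sin.const_mul r).neg).hasDerivWithinAt using 1
      ring
  sol₂ r := by
    have hid : ∀ t : ℝ, HasDerivAt (fun t => r * t) r t := fun t => by
      simpa using (hasDerivAt_id t).const_mul r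
    -- At `r = 0` the value `t` is the limit of `sin (r t) / r`.
    rcases eq_or_ne r 0 with rfl | hr
    · refine ⟨fun t _ => ?_, fun t _ => ?_⟩
      · simpa using (hasDerivAt_id' t).hasDerivWithinAt
      · simpa using hasDerivWithinAt_const t (Set.Ici (0 : ℝ)) (1 : ℝ)
    · refine ⟨fun t _ => ?_, fun t _ => ?_⟩
      · simp only [if_neg hr]
        convert! (((hid t).sin.div_const r)).hasDerivWithinAt using 1
        field_simp
      · simp only [if_neg hr]
        convert! ((hid t).cos).hasDerivWithinAt using 1
        field_simp
        ring
  init₁ r := by simp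
  init₁' r := by simp
  init₂ r := by simp
  init₂' r := by simp
  meas₁ t _ := by fun_prop
  meas₁' t _ := by fun_prop
  meas₂ t _ := by
    refine Measurable.ite (measurableSet_singleton (0 : ℝ)) measurable_const ?_
    fun_prop
  meas₂' t _ := by fun_prop

/-- The terms of the power series in `-r²` of a solution of `y'' + b y' + r² y = 0`, where
`μ = exp ∫ b`. -/
def modeTerm (μ φ₀ : ℝ → ℝ) : ℕ → ℝ → ℝ
  | 0 => φ₀
  | k + 1 => fun t => ∫ s in (0 : ℝ)..t, (μ s)⁻¹ * ∫ τ in (0 : ℝ)..s, μ τ * modeTerm μ φ₀ k τ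

/-- The derivatives of the functions `modeTerm μ φ₀ k`. -/
def modeTermDeriv (μ φ₀ ψ₀ : ℝ → ℝ) : ℕ → ℝ → ℝ
  | 0 => ψ₀
  | k + 1 => fun s => (μ s)⁻¹ * ∫ τ in (0 : ℝ)..s, μ τ * modeTerm μ φ₀ k τ

/-! ### Construction of the fundamental solutions by power series in `-r²`. -/

section Series

variable {b μ φ₀ ψ₀ : ℝ → ℝ}

theorem continuous_inv_mul_integral (hμ : Continuous μ) (hpos : ∀ t, 0 < μ t) {f : ℝ → ℝ}
    (hf : Continuous f) : Continuous fun s => (μ s)⁻¹ * ∫ τ in (0 : ℝ)..s, μ τ * f τ :=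
  (hμ.inv₀ fun t => (hpos t).ne').mul
    (intervalIntegral.continuous_primitive (fun a c => (hμ.mul hf).intervalIntegrable a c) 0)

theorem continuous_modeTerm (hμ : Continuous μ) (hpos : ∀ t, 0 < μ t) (hφ : Continuous φ₀)
    (k : ℕ) : Continuous (modeTerm μ φ₀ k) := by
  induction k with
  | zero => exact hφ
  | succ k ih =>
    exact intervalIntegral.continuous_primitive
      (fun a c => (continuous_inv_mul_integral hμ hpos ih).intervalIntegrable a c) 0

theorem continuous_modeTermDeriv (hμ : Continuous μ) (hpos : ∀ t, 0 < μ t) (hφ : Continuous φ₀)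
    (hψ : Continuous ψ₀) (k : ℕ) : Continuous (modeTermDeriv μ φ₀ ψ₀ k) := by
  cases k with
  | zero => exact hψ
  | succ k => exact continuous_inv_mul_integral hμ hpos (continuous_modeTerm hμ hpos hφ k)

theorem hasDerivAt_modeTerm (hμ : Continuous μ) (hpos : ∀ t, 0 < μ t)
    (h : ∀ t, HasDerivAt φ₀ (ψ₀ t) t) (k : ℕ) (t : ℝ) :
    HasDerivAt (modeTerm μ φ₀ k) (modeTermDeriv μ φ₀ ψ₀ k t) t := by
  cases k with
  | zero => exact h t
  | succ k =>
    have hφ : Continuous φ₀ := continuous_iff_continuousAt.2 fun t => (h t).continuousAt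
    have hc := continuous_inv_mul_integral hμ hpos (continuous_modeTerm hμ hpos hφ k)
    exact intervalIntegral.integral_hasDerivAt_right (hc.intervalIntegrable _ _)
      (hc.stronglyMeasurableAtFilter _ _) hc.continuousAt

/-- Since `μ' = b μ`, one has `f'' + b f' = μ⁻¹ (μ f')'`, and the recursion inverts this operator.
With `φ₀'' + b φ₀' = 0` the series `∑ (-r²)ᵏ f_k` therefore formally solves the mode equation. -/
theorem hasDerivAt_modeTermDeriv (hμ : ∀ t, HasDerivAt μ (b t * μ t) t) (hpos : ∀ t, 0 < μ t)
    (hφ : Continuous φ₀) (k : ℕ) (t : ℝ) :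
    HasDerivAt (modeTermDeriv μ φ₀ ψ₀ (k + 1))
      (modeTerm μ φ₀ k t - b t * modeTermDeriv μ φ₀ ψ₀ (k + 1) t) t := by
  have hμc : Continuous μ := continuous_iff_continuousAt.2 fun t => (hμ t).continuousAt
  have hc := hμc.mul (continuous_modeTerm hμc hpos hφ k)
  have h1 : HasDerivAt (fun s => ∫ τ in (0 : ℝ)..s, μ τ * modeTerm μ φ₀ k τ)
      (μ t * modeTerm μ φ₀ k t) t :=
    intervalIntegral.integral_hasDerivAt_right (hc.intervalIntegrable _ _)
      (hc.stronglyMeasurableAtFilter _ _) hc.continuousAt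
  have h2 := ((hμ t).inv (hpos t).ne').mul h1
  refine h2.congr_deriv ?_
  have := (hpos t).ne'
  simp only [modeTermDeriv, Pi.inv_apply]
  field_simp
  ring

theorem abs_integral_le_pow_div_factorial {f : ℝ → ℝ} {T C : ℝ} {j : ℕ}
    (hf : ∀ t ∈ Set.Icc 0 T, |f t| ≤ C * (t ^ j / j.factorial)) {t : ℝ} (ht : t ∈ Set.Icc 0 T) :
    |∫ s in (0 : ℝ)..t, f s| ≤ C * (t ^ (j + 1) / (j + 1).factorial) := by
  have h1 : ‖∫ s in (0 : ℝ)..t, f s‖ ≤ ∫ s in (0 : ℝ)..t, C * (s ^ j / j.factorial) := by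
    refine intervalIntegral.norm_integral_le_of_norm_le ht.1 (Eventually.of_forall fun s hs => ?_)
      (Continuous.intervalIntegrable (by fun_prop) _ _)
    exact hf s ⟨hs.1.le, hs.2.trans ht.2⟩
  refine h1.trans_eq ?_
  rw [intervalIntegral.integral_const_mul, intervalIntegral.integral_div, integral_pow,
    Nat.factorial_succ]
  have : (j.factorial : ℝ) ≠ 0 := by positivity
  push_cast
  rw [zero_pow j.succ_ne_zero, sub_zero]
  field_simp

/-- Monotonicity gives `μ s / μ t ≤ 1` for `s ≤ t`, so the weights drop out and the bound is that of
plain integration. Two integrations per step produce the factorials of `2 k`. -/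
theorem abs_modeTermDeriv_succ_le (hmono : Monotone μ) (hpos : ∀ t, 0 < μ t) {T C : ℝ}
    {k j : ℕ}
    (hk : ∀ t ∈ Set.Icc 0 T, |modeTerm μ φ₀ k t| ≤ C * (t ^ j / j.factorial)) :
    ∀ t ∈ Set.Icc 0 T, |modeTermDeriv μ φ₀ ψ₀ (k + 1) t| ≤ C * (t ^ (j + 1) / (j + 1).factorial) := by
  intro t ht
  have h1 : ∀ s ∈ Set.Icc 0 t, |μ s * modeTerm μ φ₀ k s| ≤ (μ t * C) * (s ^ j / j.factorial) := by
    intro s hs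
    rw [abs_mul, abs_of_pos (hpos s), mul_assoc]
    have := hk s ⟨hs.1, hs.2.trans ht.2⟩
    have h0 : 0 ≤ C * (s ^ j / j.factorial) := (abs_nonneg _).trans this
    exact mul_le_mul (hmono hs.2) this (abs_nonneg _) (hpos t).le
  have h2 := abs_integral_le_pow_div_factorial h1 (t := t) ⟨ht.1, le_rfl⟩
  simp only [modeTermDeriv]
  rw [abs_mul, abs_of_pos (inv_pos.2 (hpos t)), inv_mul_le_iff₀ (hpos t)]
  linarith

theorem abs_modeTerm_le (hmono : Monotone μ) (hpos : ∀ t, 0 < μ t) {T C : ℝ}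
    (h : ∀ t ∈ Set.Icc 0 T, |φ₀ t| ≤ C) (k : ℕ) :
    ∀ t ∈ Set.Icc 0 T, |modeTerm μ φ₀ k t| ≤ C * (t ^ (2 * k) / (2 * k).factorial) := by
  induction k with
  | zero => simpa [modeTerm] using h
  | succ k ih =>
    intro t ht
    exact abs_integral_le_pow_div_factorial
      (abs_modeTermDeriv_succ_le (ψ₀ := φ₀) hmono hpos ih) ht

/-- Termwise differentiation of the series is available on open intervals only; the one-sided
derivative at `0` is recovered as the limit of the derivatives. -/
theorem continuousOn_mode_hasDerivWithinAt {f f' : ℝ → ℝ} (hf : ContinuousOn f (Set.Ici 0))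
    (hf' : ContinuousOn f' (Set.Ici 0)) (h : ∀ t, 0 < t → HasDerivAt f (f' t) t) :
    ∀ t, 0 ≤ t → HasDerivWithinAt f (f' t) (Set.Ici 0) t := by
  intro t ht
  rcases ht.eq_or_lt with rfl | ht
  · refine hasDerivWithinAt_Ici_of_tendsto_deriv (s := Set.Ioi 0)
      (fun s hs => (h s hs).differentiableAt.differentiableWithinAt)
      ((hf 0 Set.self_mem_Ici).mono Set.Ioi_subset_Ici_self) self_mem_nhdsWithin ?_
    refine Tendsto.congr' ?_ ((hf' 0 Set.self_mem_Ici).mono Set.Ioi_subset_Ici_self)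
    filter_upwards [self_mem_nhdsWithin] with s hs
    exact (h s hs).deriv.symm
  · exact (h t ht).hasDerivWithinAt

/-- The series is dominated on `[0, T]` by `∑ (|r| T)^(2k) / (2k)!`, hence may be differentiated
term by term. Its partial sums are polynomials in `r`, which yields the measurability in `r` that
the symbols need. -/
theorem exists_modeSolution (hb : Continuous b) (hμ : ∀ t, HasDerivAt μ (b t * μ t) t)
    (hpos : ∀ t, 0 < μ t) (hmono : Monotone μ) (hφ : ∀ t, HasDerivAt φ₀ (ψ₀ t) t)
    (hψ : ∀ t, HasDerivAt ψ₀ (-(b t * ψ₀ t)) t) :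
    ∃ y y' : ℝ → ℝ → ℝ, (∀ r, IsModeSolution b r (y r) (y' r)) ∧ (∀ r, y r 0 = φ₀ 0) ∧
      (∀ r, y' r 0 = ψ₀ 0) ∧ (∀ t, 0 ≤ t → Measurable fun r => y r t) ∧
      (∀ t, 0 ≤ t → Measurable fun r => y' r t) := by
  have hμc : Continuous μ := continuous_iff_continuousAt.2 fun t => (hμ t).continuousAt
  have hφc : Continuous φ₀ := continuous_iff_continuousAt.2 fun t => (hφ t).continuousAt
  have hψc : Continuous ψ₀ := continuous_iff_continuousAt.2 fun t => (hψ t).continuousAt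
  have hsum : ∀ x : ℝ, Summable fun k : ℕ => x ^ (2 * k) / ((2 * k).factorial : ℝ) := fun x =>
    (Real.summable_pow_div_factorial x).comp_injective
      (i := fun k : ℕ => 2 * k) (fun a c h => by simpa using h)
  have hsum' : ∀ x : ℝ, Summable fun k : ℕ => x ^ (2 * k + 1) / ((2 * k + 1).factorial : ℝ) :=
    fun x => (Real.summable_pow_div_factorial x).comp_injective
      (i := fun k : ℕ => 2 * k + 1) (fun a c h => by simpa using h)
  set u : ℝ → ℕ → ℝ → ℝ := fun r k t => (-r ^ 2) ^ k * modeTerm μ φ₀ k t with hu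
  set v : ℝ → ℕ → ℝ → ℝ := fun r k t => (-r ^ 2) ^ k * modeTermDeriv μ φ₀ ψ₀ k t with hv
  -- bounds on compact intervals
  have hbound : ∀ T, 0 ≤ T → ∀ r, ∃ U V : ℕ → ℝ, Summable U ∧ Summable V ∧
      (∀ k, ∀ t ∈ Set.Icc 0 T, ‖u r k t‖ ≤ U k) ∧ (∀ k, ∀ t ∈ Set.Icc 0 T, ‖v r k t‖ ≤ V k) := by
    intro T hT r
    obtain ⟨C, hC⟩ := isCompact_Icc.exists_bound_of_continuousOn (s := Set.Icc 0 T) hφc.continuousOn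
    obtain ⟨C', hC'⟩ :=
      isCompact_Icc.exists_bound_of_continuousOn (s := Set.Icc 0 T) hψc.continuousOn
    have hC0 : 0 ≤ C := (norm_nonneg _).trans (hC 0 ⟨le_rfl, hT⟩)
    have h1 := abs_modeTerm_le (φ₀ := φ₀) hmono hpos hC
    have h2 := fun k => abs_modeTermDeriv_succ_le (ψ₀ := ψ₀) hmono hpos (h1 k)
    -- The derivative series has one integration fewer per term, hence odd factorials; its zeroth
    -- term `ψ₀` is not an integral and gets its own bound `C'`.
    refine ⟨fun k => C * ((|r| * T) ^ (2 * k) / (2 * k).factorial),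
      fun k => Nat.rec C' (fun k _ =>
        |r| * (C * ((|r| * T) ^ (2 * k + 1) / (2 * k + 1).factorial))) k,
      (hsum _).mul_left C, ?_, ?_, ?_⟩
    · rw [← summable_nat_add_iff 1]
      exact ((hsum' _).mul_left C).mul_left |r|
    · intro k t ht
      have hp : |(-r ^ 2) ^ k| = |r| ^ (2 * k) := by
        rw [abs_pow, abs_neg, abs_pow, pow_mul]
      simp only [hu, Real.norm_eq_abs, abs_mul, hp]
      calc |r| ^ (2 * k) * |modeTerm μ φ₀ k t|
          ≤ |r| ^ (2 * k) * (C * (T ^ (2 * k) / (2 * k).factorial)) := by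
            refine mul_le_mul_of_nonneg_left ((h1 k t ht).trans ?_) (by positivity)
            have := ht.1
            have := ht.2
            gcongr
        _ = _ := by rw [mul_pow]; ring
    · intro k t ht
      cases k with
      | zero => simpa [hv, modeTermDeriv] using hC' t ht
      | succ k =>
        have hp : |(-r ^ 2) ^ (k + 1)| = |r| * |r| ^ (2 * k + 1) := by
          rw [abs_pow, abs_neg, abs_pow, ← pow_mul]; ring
        simp only [hv, Real.norm_eq_abs, abs_mul, hp]
        calc |r| * |r| ^ (2 * k + 1) * |modeTermDeriv μ φ₀ ψ₀ (k + 1) t|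
            ≤ |r| * |r| ^ (2 * k + 1) * (C * (T ^ (2 * k + 1) / (2 * k + 1).factorial)) := by
              refine mul_le_mul_of_nonneg_left ((h2 k t ht).trans ?_) (by positivity)
              have := ht.1
              have := ht.2
              gcongr
          _ = _ := by rw [mul_pow]; ring
  have hus : ∀ r t, 0 ≤ t → Summable fun k => u r k t := fun r t ht => by
    obtain ⟨U, V, hU, hV, h1, h2⟩ := hbound t ht r
    exact hU.of_norm_bounded fun k => h1 k t ⟨ht, le_rfl⟩
  have hvs : ∀ r t, 0 ≤ t → Summable fun k => v r k t := fun r t ht => by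
    obtain ⟨U, V, hU, hV, h1, h2⟩ := hbound t ht r
    exact hV.of_norm_bounded fun k => h2 k t ⟨ht, le_rfl⟩
  have huc : ∀ r, ContinuousOn (fun t => ∑' k, u r k t) (Set.Ici 0) := by
    intro r t ht
    have ht0 : (0 : ℝ) ≤ t := ht
    obtain ⟨U, V, hU, hV, h1, h2⟩ := hbound (t + 1) (by linarith) r
    have : ContinuousOn (fun t => ∑' k, u r k t) (Set.Icc 0 (t + 1)) :=
      continuousOn_tsum (fun k => (((continuous_modeTerm hμc hpos hφc k).const_mul _).continuousOn))
        hU fun k s hs => h1 k s hs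
    refine (this t ⟨ht0, by linarith⟩).mono_of_mem_nhdsWithin ?_
    filter_upwards [self_mem_nhdsWithin, mem_nhdsWithin_of_mem_nhds (Iio_mem_nhds (lt_add_one t))]
      with s hs hs'
    exact ⟨hs, le_of_lt hs'⟩
  have hvc : ∀ r, ContinuousOn (fun t => ∑' k, v r k t) (Set.Ici 0) := by
    intro r t ht
    have ht0 : (0 : ℝ) ≤ t := ht
    obtain ⟨U, V, hU, hV, h1, h2⟩ := hbound (t + 1) (by linarith) r
    have : ContinuousOn (fun t => ∑' k, v r k t) (Set.Icc 0 (t + 1)) :=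
      continuousOn_tsum
        (fun k => (((continuous_modeTermDeriv hμc hpos hφc hψc k).const_mul _).continuousOn))
        hV fun k s hs => h2 k s hs
    refine (this t ⟨ht0, by linarith⟩).mono_of_mem_nhdsWithin ?_
    filter_upwards [self_mem_nhdsWithin, mem_nhdsWithin_of_mem_nhds (Iio_mem_nhds (lt_add_one t))]
      with s hs hs'
    exact ⟨hs, le_of_lt hs'⟩
  have hder : ∀ r t, 0 < t → HasDerivAt (fun t => ∑' k, u r k t) (∑' k, v r k t) t := by
    intro r t ht
    obtain ⟨U, V, hU, hV, h1, h2⟩ := hbound (t + 1) (by linarith) r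
    have hmem : t ∈ Set.Ioo 0 (t + 1) := ⟨ht, by linarith⟩
    exact hasDerivAt_tsum_of_isPreconnected hV isOpen_Ioo isPreconnected_Ioo
      (fun k s _ => (hasDerivAt_modeTerm hμc hpos hφ k s).const_mul _)
      (fun k s hs => h2 k s ⟨hs.1.le, hs.2.le⟩) hmem (hus r t ht.le) hmem
  have hder' : ∀ r t, 0 < t → HasDerivAt (fun t => ∑' k, v r k t)
      (-(r ^ 2 * ∑' k, u r k t) - b t * ∑' k, v r k t) t := by
    intro r t ht
    obtain ⟨U, V, hU, hV, h1, h2⟩ := hbound (t + 1) (by linarith) r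
    obtain ⟨B, hB⟩ :=
      isCompact_Icc.exists_bound_of_continuousOn (s := Set.Icc 0 (t + 1)) hb.continuousOn
    have hmem : t ∈ Set.Ioo 0 (t + 1) := ⟨ht, by linarith⟩
    -- The index is shifted: the derivative of `v r (k + 1)` contains `u r k`. The remaining term `v
    -- r 0 = ψ₀` is differentiated by `hψ`.
    set w : ℕ → ℝ → ℝ := fun k s => -(r ^ 2) * u r k s - b s * v r (k + 1) s with hw
    have hwd : ∀ k s, HasDerivAt (v r (k + 1)) (w k s) s := fun k s => by
      refine ((hasDerivAt_modeTermDeriv (ψ₀ := ψ₀) hμ hpos hφc k s).const_mul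
        ((-r ^ 2) ^ (k + 1))).congr_deriv ?_
      simp only [hw, hu, hv]
      ring
    have hwb : ∀ k, ∀ s ∈ Set.Ioo 0 (t + 1), ‖w k s‖ ≤ r ^ 2 * U k + B * V (k + 1) := by
      intro k s hs
      have hs' : s ∈ Set.Icc 0 (t + 1) := ⟨hs.1.le, hs.2.le⟩
      refine (norm_sub_le _ _).trans (add_le_add ?_ ?_)
      · rw [norm_mul, norm_neg, Real.norm_of_nonneg (sq_nonneg r)]
        exact mul_le_mul_of_nonneg_left (h1 k s hs') (sq_nonneg r)
      · rw [norm_mul]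
        exact mul_le_mul (hB s hs') (h2 _ s hs') (norm_nonneg _) ((norm_nonneg _).trans (hB s hs'))
    have hvs1 : ∀ s, 0 ≤ s → Summable fun k => v r (k + 1) s := fun s hs =>
      (summable_nat_add_iff 1).2 (hvs r s hs)
    have h3 : HasDerivAt (fun s => ∑' k, v r (k + 1) s) (∑' k, w k t) t :=
      hasDerivAt_tsum_of_isPreconnected
        ((hU.mul_left _).add (((summable_nat_add_iff 1).2 hV).mul_left B)) isOpen_Ioo
        isPreconnected_Ioo (fun k s _ => hwd k s) hwb hmem (hvs1 t ht.le) hmem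
    have h4 := (hψ t).add h3
    refine (h4.congr_of_eventuallyEq ?_).congr_deriv ?_
    · filter_upwards [Ioi_mem_nhds ht] with s hs
      rw [Pi.add_apply, (hvs r s (le_of_lt hs)).tsum_eq_zero_add]
      simp [hv, modeTermDeriv]
    · rw [(hvs r t ht.le).tsum_eq_zero_add, Summable.tsum_sub ((hus r t ht.le).mul_left _)
        ((hvs1 t ht.le).mul_left _), tsum_mul_left, tsum_mul_left]
      simp only [hv, modeTermDeriv, pow_zero, one_mul]
      ring
  refine ⟨fun r t => ∑' k, u r k t, fun r t => ∑' k, v r k t, fun r => ⟨?_, ?_⟩, fun r => ?_,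
    fun r => ?_, fun t ht => ?_, fun t ht => ?_⟩
  · exact continuousOn_mode_hasDerivWithinAt (huc r) (hvc r) (hder r)
  · exact continuousOn_mode_hasDerivWithinAt (hvc r)
      (((continuousOn_const.mul (huc r)).neg).sub (hb.continuousOn.mul (hvc r))) (hder' r)
  · dsimp only
    rw [tsum_eq_single 0]
    · simp [hu, modeTerm]
    · intro k hk
      obtain ⟨k, rfl⟩ := Nat.exists_eq_succ_of_ne_zero hk
      simp [hu, modeTerm]
  · dsimp only
    rw [tsum_eq_single 0]
    · simp [hv, modeTermDeriv]
    · intro k hk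
      obtain ⟨k, rfl⟩ := Nat.exists_eq_succ_of_ne_zero hk
      simp [hv, modeTermDeriv]
  · refine measurable_of_tendsto_metrizable (f := fun N r => ∑ k ∈ Finset.range N, u r k t)
      (fun N => Finset.measurable_fun_sum _ fun k _ => by fun_prop) ?_
    exact tendsto_pi_nhds.2 fun r => (hus r t ht).hasSum.tendsto_sum_nat
  · refine measurable_of_tendsto_metrizable (f := fun N r => ∑ k ∈ Finset.range N, v r k t)
      (fun N => Finset.measurable_fun_sum _ fun k _ => by fun_prop) ?_
    exact tendsto_pi_nhds.2 fun r => (hvs r t ht).hasSum.tendsto_sum_nat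

end Series

/-- The extension of `b` to the real line by the constant `b 0`. -/
def extendLeft (b : ℝ → ℝ) (t : ℝ) : ℝ := b (max t 0)

theorem extendLeft_of_nonneg (b : ℝ → ℝ) {t : ℝ} (ht : 0 ≤ t) : extendLeft b t = b t := by
  rw [extendLeft, max_eq_left ht]

theorem continuous_extendLeft {b : ℝ → ℝ} (hb : ContinuousOn b (Set.Ici 0)) :
    Continuous (extendLeft b) :=
  hb.comp_continuous (by fun_prop) fun t => le_max_right t 0

/-- `λ² = exp ∫ b`, extended to the real line. -/
def dampingWeight (b : ℝ → ℝ) (t : ℝ) : ℝ := Real.exp (∫ τ in (0 : ℝ)..t, extendLeft b τ)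

theorem dampingWeight_pos (b : ℝ → ℝ) (t : ℝ) : 0 < dampingWeight b t := Real.exp_pos _

theorem dampingWeight_zero (b : ℝ → ℝ) : dampingWeight b 0 = 1 := by simp [dampingWeight]

theorem hasDerivAt_dampingWeight {b : ℝ → ℝ} (hb : ContinuousOn b (Set.Ici 0)) (t : ℝ) :
    HasDerivAt (dampingWeight b) (extendLeft b t * dampingWeight b t) t := by
  have hc := continuous_extendLeft hb
  have h1 : HasDerivAt (fun s => ∫ τ in (0 : ℝ)..s, extendLeft b τ) (extendLeft b t) t :=
    intervalIntegral.integral_hasDerivAt_right (hc.intervalIntegrable _ _)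
      (hc.stronglyMeasurableAtFilter _ _) hc.continuousAt
  exact h1.exp.congr_deriv (mul_comm _ _)

theorem continuous_dampingWeight {b : ℝ → ℝ} (hb : ContinuousOn b (Set.Ici 0)) :
    Continuous (dampingWeight b) :=
  continuous_iff_continuousAt.2 fun t => (hasDerivAt_dampingWeight hb t).continuousAt

theorem monotone_dampingWeight {b : ℝ → ℝ} (hb : ContinuousOn b (Set.Ici 0))
    (h0 : ∀ t, 0 ≤ t → 0 ≤ b t) : Monotone (dampingWeight b) :=
  monotone_of_hasDerivAt_nonneg (hasDerivAt_dampingWeight hb) fun t =>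
    mul_nonneg (h0 _ (le_max_right t 0)) (dampingWeight_pos b t).le

theorem IsModeSolution.congr {b b' y y' : ℝ → ℝ} {r : ℝ} (h : IsModeSolution b r y y')
    (hb : ∀ t, 0 ≤ t → b t = b' t) : IsModeSolution b' r y y' :=
  ⟨h.hasDeriv, fun t ht => hb t ht ▸ h.hasDeriv' t ht⟩

/-- The series start from the two solutions at zero frequency, `1` and `∫ μ⁻¹`, whose data are `(1,
0)` and `(0, 1)`. All higher terms and their derivatives vanish at `0`, so the data persist for
every `r`. -/
theorem exists_isFundamental {b : ℝ → ℝ} (hb : ContinuousOn b (Set.Ici 0))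
    (h0 : ∀ t, 0 ≤ t → 0 ≤ b t) : ∃ y₁ y₁' y₂ y₂', IsFundamental b y₁ y₁' y₂ y₂' := by
  have hc := continuous_extendLeft hb
  have hd := hasDerivAt_dampingWeight hb
  have hp := dampingWeight_pos b
  have hinv : Continuous fun t => (dampingWeight b t)⁻¹ :=
    (continuous_dampingWeight hb).inv₀ fun t => (hp t).ne'
  obtain ⟨y₁, y₁', h1, h2, h3, h4, h5⟩ := exists_modeSolution hc hd hp
    (monotone_dampingWeight hb h0) (φ₀ := fun _ => 1) (ψ₀ := fun _ => 0)
    (fun t => hasDerivAt_const t 1) (fun t => by simpa using hasDerivAt_const t (0 : ℝ))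
  obtain ⟨y₂, y₂', k1, k2, k3, k4, k5⟩ := exists_modeSolution hc hd hp
    (monotone_dampingWeight hb h0) (φ₀ := fun t => ∫ s in (0 : ℝ)..t, (dampingWeight b s)⁻¹)
    (ψ₀ := fun t => (dampingWeight b t)⁻¹)
    (fun t => intervalIntegral.integral_hasDerivAt_right (hinv.intervalIntegrable _ _)
      (hinv.stronglyMeasurableAtFilter _ _) hinv.continuousAt)
    (fun t => by
      refine ((hd t).inv (hp t).ne').congr_deriv ?_
      have := (hp t).ne'
      field_simp)
  have he : ∀ t, 0 ≤ t → extendLeft b t = b t := fun t ht => extendLeft_of_nonneg b ht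
  exact ⟨y₁, y₁', y₂, y₂', ⟨fun r => (h1 r).congr he, fun r => (k1 r).congr he, h2, h3,
    fun r => by simpa using k2 r, fun r => by simpa [dampingWeight_zero] using k3 r, h4, h5, k4, k5⟩⟩

end

/-! ### Energy estimates for a single mode, uniform in the frequency. -/

section

theorem antitoneOn_Ici_of_hasDerivWithinAt {f f' : ℝ → ℝ}
    (h : ∀ t, 0 ≤ t → HasDerivWithinAt f (f' t) (Set.Ici 0) t) (h' : ∀ t, 0 ≤ t → f' t ≤ 0) :
    AntitoneOn f (Set.Ici 0) := by
  have hd : ∀ t ∈ interior (Set.Ici (0 : ℝ)), HasDerivAt f (f' t) t := fun t ht => by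
    rw [interior_Ici] at ht
    exact (h t (le_of_lt ht)).hasDerivAt (Ici_mem_nhds ht)
  refine antitoneOn_of_deriv_nonpos (convex_Ici 0)
    (fun t ht => (h t ht).continuousWithinAt)
    (fun t ht => (hd t ht).differentiableAt.differentiableWithinAt) fun t ht => ?_
  rw [(hd t ht).deriv]
  rw [interior_Ici] at ht
  exact h' t (le_of_lt ht)

theorem hasDerivWithinAt_dampingFactor {b : ℝ → ℝ} (hb : ContinuousOn b (Set.Ici 0)) {t : ℝ}
    (ht : 0 ≤ t) :
    HasDerivWithinAt (dampingFactor b) (b t / 2 * dampingFactor b t) (Set.Ici 0) t := by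
  have hc := continuous_extendLeft hb
  have h1 : HasDerivAt (fun s => ∫ τ in (0 : ℝ)..s, extendLeft b τ) (extendLeft b t) t :=
    intervalIntegral.integral_hasDerivAt_right (hc.intervalIntegrable _ _)
      (hc.stronglyMeasurableAtFilter _ _) hc.continuousAt
  have h2 := ((h1.const_mul (1 / 2)).exp).hasDerivWithinAt (s := Set.Ici 0)
  have h3 : ∀ s ∈ Set.Ici (0 : ℝ),
      dampingFactor b s = Real.exp (1 / 2 * ∫ τ in (0 : ℝ)..s, extendLeft b τ) := by
    intro s hs
    rw [dampingFactor]
    congr 2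
    refine intervalIntegral.integral_congr fun τ hτ => ?_
    rw [Set.uIcc_of_le hs] at hτ
    exact (extendLeft_of_nonneg b hτ.1).symm
  refine (h2.congr h3 (h3 t ht)).congr_deriv ?_
  rw [h3 t ht, extendLeft_of_nonneg b ht]
  ring

theorem dampingFactor_zero (b : ℝ → ℝ) : dampingFactor b 0 = 1 := by simp [dampingFactor]

namespace IsModeSolution

variable {b y y' : ℝ → ℝ} {r : ℝ}

/-- The derivative of the energy is `-2 b y'²`. This estimate lacks the factor `λ²`, but it suffices
to make the solution operators at a fixed time bounded. -/
theorem antitoneOn_energy (h : IsModeSolution b r y y') (hb : ∀ t, 0 ≤ t → 0 ≤ b t) :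
    AntitoneOn (fun t => r ^ 2 * y t ^ 2 + y' t ^ 2) (Set.Ici 0) := by
  refine antitoneOn_Ici_of_hasDerivWithinAt (f' := fun t => -(2 * b t * y' t ^ 2)) (fun t ht => ?_)
    fun t ht => ?_
  · refine ((((h.hasDeriv t ht).pow 2).const_mul (r ^ 2)).add
      ((h.hasDeriv' t ht).pow 2)).congr_deriv ?_
    push_cast
    ring
  · have := mul_nonneg (hb t ht) (sq_nonneg (y' t))
    linarith

theorem energy_le (h : IsModeSolution b r y y') (hb : ∀ t, 0 ≤ t → 0 ≤ b t) {t : ℝ}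
    (ht : 0 ≤ t) : r ^ 2 * y t ^ 2 + y' t ^ 2 ≤ r ^ 2 * y 0 ^ 2 + y' 0 ^ 2 :=
  h.antitoneOn_energy hb Set.self_mem_Ici ht ht

end IsModeSolution

/-- Quantitative consequences of the assumptions on a non-effective dissipation `b`: `b₁` is its
derivative, and `h` is the solution of `h' = 1 + b h`, `h 0 = 1`. -/
structure DampingBounds (b b₁ h : ℝ → ℝ) (B Q K : ℝ) : Prop where
  hasDeriv : ∀ t, 0 ≤ t → HasDerivWithinAt b (b₁ t) (Set.Ici 0) t
  nonneg : ∀ t, 0 ≤ t → 0 ≤ b t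
  le : ∀ t, 0 ≤ t → b t ≤ B / (1 + t)
  potential_le : ∀ t, 0 ≤ t → |b t ^ 2 / 4 + b₁ t / 2| ≤ Q / (1 + t) ^ 2
  weight_deriv : ∀ t, 0 ≤ t → HasDerivWithinAt h (1 + b t * h t) (Set.Ici 0) t
  weight_zero : h 0 = 1
  weight_pos : ∀ t, 0 ≤ t → 0 < h t
  weight_le : ∀ t, 0 ≤ t → h t ≤ K * (1 + t)

namespace DampingBounds

variable {b b₁ h : ℝ → ℝ} {B Q K : ℝ}

theorem continuousOn (H : DampingBounds b b₁ h B Q K) : ContinuousOn b (Set.Ici 0) :=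
  fun t ht => (H.hasDeriv t ht).continuousWithinAt

theorem B_nonneg (H : DampingBounds b b₁ h B Q K) : 0 ≤ B := by
  have h1 := (H.nonneg 0 le_rfl).trans (H.le 0 le_rfl)
  simpa using h1

theorem Q_nonneg (H : DampingBounds b b₁ h B Q K) : 0 ≤ Q := by
  have h1 := (abs_nonneg _).trans (H.potential_le 0 le_rfl)
  simpa using h1

theorem one_le_K (H : DampingBounds b b₁ h B Q K) : 1 ≤ K := by
  have h1 := H.weight_le 0 le_rfl
  rw [H.weight_zero] at h1
  linarith

variable {r : ℝ} {y y' : ℝ → ℝ}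

/-- With `Z = λ (y / h - y')` and `P = λ y'`, the equation `h' = 1 + b h` is exactly what leaves
`r²` as the only coupling: `Z' = -(1/h + b/2) Z + r² h (Z + P)` and `P' = -(b/2) P - r² h (Z + P)`.
Hence `G = Z² + P²` satisfies `G' ≤ 2 r² h G ≤ 2 K r² (1 + t) G`, and the integral of this rate is
at most `K` while `r (1 + t) ≤ 1`. The quantity `y / h - y'` vanishes for the zero frequency
solution with data `(1, 1)`. -/
theorem low_frequency_le (H : DampingBounds b b₁ h B Q K) (hy : IsModeSolution b r y y') {t : ℝ}
    (ht : 0 ≤ t) (hr : 0 ≤ r) (hrt : r * (1 + t) ≤ 1) :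
    dampingFactor b t ^ 2 * (r ^ 2 * y t ^ 2 + y' t ^ 2)
      ≤ (2 * K ^ 2 + 1) * Real.exp K * ((y 0 - y' 0) ^ 2 + y' 0 ^ 2) := by
  set l := dampingFactor b with hl
  set G : ℝ → ℝ := fun t => (l t * (y t / h t - y' t)) ^ 2 + (l t * y' t) ^ 2 with hG
  have hanti : AntitoneOn (fun t => G t * Real.exp (-(K * r ^ 2) * (1 + t) ^ 2)) (Set.Ici 0) := by
    refine antitoneOn_Ici_of_hasDerivWithinAt (f' := fun t =>
      (2 * r ^ 2 * h t * ((l t * (y t / h t - y' t)) ^ 2 - (l t * y' t) ^ 2) - b t * G t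
        - 2 / h t * (l t * (y t / h t - y' t)) ^ 2 - 2 * K * r ^ 2 * (1 + t) * G t)
        * Real.exp (-(K * r ^ 2) * (1 + t) ^ 2)) (fun t ht => ?_) fun t ht => ?_
    · have hh := (H.weight_pos t ht).ne'
      have d1 := hasDerivWithinAt_dampingFactor H.continuousOn ht
      have d2 := ((hy.hasDeriv t ht).div (H.weight_deriv t ht) hh).sub (hy.hasDeriv' t ht)
      have d3 := ((d1.mul d2).pow 2).add ((d1.mul (hy.hasDeriv' t ht)).pow 2)
      have d4 : HasDerivWithinAt (fun t => Real.exp (-(K * r ^ 2) * (1 + t) ^ 2))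
          (Real.exp (-(K * r ^ 2) * (1 + t) ^ 2) * (-(K * r ^ 2) * (2 * (1 + t)))) (Set.Ici 0) t := by
        refine ((((((hasDerivAt_id' t).const_add 1).pow 2).const_mul
          (-(K * r ^ 2))).exp).hasDerivWithinAt).congr_deriv ?_
        simp only [Pi.pow_apply]
        push_cast
        ring
      refine (d3.mul d4).congr_deriv ?_
      simp only [hG, Pi.add_apply, Pi.mul_apply, Pi.sub_apply, Pi.div_apply, Pi.pow_apply, ← hl]
      push_cast
      field_simp
      ring
    · refine mul_nonpos_of_nonpos_of_nonneg ?_ (Real.exp_pos _).le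
      have hh := H.weight_pos t ht
      have hG0 : 0 ≤ G t := by positivity
      have e1 := mul_nonneg (H.nonneg t ht) hG0
      have e2 : 0 ≤ 2 / h t * (l t * (y t / h t - y' t)) ^ 2 := by positivity
      have e3 : r ^ 2 * h t * G t ≤ r ^ 2 * (K * (1 + t)) * G t := by
        have := H.weight_le t ht
        gcongr
      have e4 : r ^ 2 * h t * ((l t * (y t / h t - y' t)) ^ 2 - (l t * y' t) ^ 2)
          ≤ r ^ 2 * h t * G t := by
        refine mul_le_mul_of_nonneg_left ?_ (by positivity)
        have := sq_nonneg (l t * y' t)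
        simp only [hG]
        linarith
      linarith
  have h1 : G t * Real.exp (-(K * r ^ 2) * (1 + t) ^ 2)
      ≤ G 0 * Real.exp (-(K * r ^ 2) * (1 + 0) ^ 2) := hanti Set.self_mem_Ici ht ht
  have hK := H.one_le_K
  have hh := H.weight_pos t ht
  have hG0 : 0 ≤ G t := by positivity
  have hG1 : 0 ≤ G 0 := by positivity
  have h2 : G t ≤ Real.exp K * G 0 := by
    have e1 : Real.exp (-(K * r ^ 2) * (1 + 0) ^ 2) ≤ 1 := by
      rw [Real.exp_le_one_iff]
      have : 0 ≤ K * r ^ 2 := by positivity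
      linarith
    have e2 : Real.exp (-K) ≤ Real.exp (-(K * r ^ 2) * (1 + t) ^ 2) := by
      rw [Real.exp_le_exp]
      have e3 : (r * (1 + t)) ^ 2 ≤ 1 := pow_le_one₀ (by positivity) hrt
      nlinarith
    have e4 : G t * Real.exp (-K) ≤ G 0 :=
      (mul_le_mul_of_nonneg_left e2 hG0).trans (h1.trans (mul_le_of_le_one_right hG1 e1))
    rw [Real.exp_neg, ← div_eq_mul_inv, div_le_iff₀ (Real.exp_pos _)] at e4
    linarith
  have h3 : G 0 = (y 0 - y' 0) ^ 2 + y' 0 ^ 2 := by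
    simp [hG, hl, dampingFactor_zero, H.weight_zero]
  rw [← h3, mul_assoc]
  refine le_trans ?_ (mul_le_mul_of_nonneg_left h2 (by positivity))
  set Z := l t * (y t / h t - y' t) with hZ
  set P := l t * y' t with hP
  -- The energy is recovered from `Z` and `P`; the factor `r h` is at most `K` in this zone.
  have e5 : l t * y t = h t * (Z + P) := by
    rw [hZ, hP]
    field_simp
    ring
  have e6 : l t ^ 2 * (r ^ 2 * y t ^ 2 + y' t ^ 2) = (r * h t) ^ 2 * (Z + P) ^ 2 + P ^ 2 := by
    calc _ = r ^ 2 * (l t * y t) ^ 2 + P ^ 2 := by rw [hP]; ring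
      _ = _ := by rw [e5]; ring
  have e7 : r * h t ≤ K := by
    calc r * h t ≤ r * (K * (1 + t)) := mul_le_mul_of_nonneg_left (H.weight_le t ht) hr
      _ = K * (r * (1 + t)) := by ring
      _ ≤ K * 1 := by gcongr
      _ = K := mul_one K
  have e8 : (r * h t) ^ 2 ≤ K ^ 2 := pow_le_pow_left₀ (by positivity) e7 2
  have e9 : (Z + P) ^ 2 ≤ 2 * (Z ^ 2 + P ^ 2) := by nlinarith [sq_nonneg (Z - P)]
  have hGt : G t = Z ^ 2 + P ^ 2 := rfl
  rw [e6, hGt]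
  have e10 : (r * h t) ^ 2 * (Z + P) ^ 2 ≤ K ^ 2 * (2 * (Z ^ 2 + P ^ 2)) :=
    mul_le_mul e8 e9 (sq_nonneg _) (sq_nonneg _)
  nlinarith [sq_nonneg Z]

/-- The derivative of `λ y`. -/
def liouvilleDeriv (b y y' : ℝ → ℝ) (t : ℝ) : ℝ := dampingFactor b t * (y' t + b t / 2 * y t)

theorem hasDerivWithinAt_liouville (H : DampingBounds b b₁ h B Q K)
    (hy : IsModeSolution b r y y') {t : ℝ} (ht : 0 ≤ t) :
    HasDerivWithinAt (fun t => dampingFactor b t * y t) (liouvilleDeriv b y y' t) (Set.Ici 0) t := by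
  refine ((hasDerivWithinAt_dampingFactor H.continuousOn ht).mul (hy.hasDeriv t ht)).congr_deriv ?_
  simp only [liouvilleDeriv]
  ring

/-- The factor `λ` removes the first order term of the equation; what is left of the dissipation is
a potential of size `O((1+t)⁻²)`, integrable in time. -/
theorem hasDerivWithinAt_liouvilleDeriv (H : DampingBounds b b₁ h B Q K)
    (hy : IsModeSolution b r y y') {t : ℝ} (ht : 0 ≤ t) :
    HasDerivWithinAt (liouvilleDeriv b y y')
      ((b t ^ 2 / 4 + b₁ t / 2 - r ^ 2) * (dampingFactor b t * y t)) (Set.Ici 0) t := by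
  refine ((hasDerivWithinAt_dampingFactor H.continuousOn ht).mul ((hy.hasDeriv' t ht).add
    (((H.hasDeriv t ht).div_const 2).mul (hy.hasDeriv t ht)))).congr_deriv ?_
  simp only [Pi.add_apply, Pi.mul_apply]
  ring

/-- For `v = λ y` and `F = r² v² + v'²` one has `F' = 2 q v v'` and `2 |v v'| ≤ F / r`. Gronwall's
inequality applies with the rate `Q / (r (1 + t)²)`, whose integral over `[s, ∞)` is the exponent `Q
/ (r (1 + s))`. -/
theorem liouville_energy_le (H : DampingBounds b b₁ h B Q K) (hy : IsModeSolution b r y y')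
    (hr : 0 < r) {s t : ℝ} (hs : 0 ≤ s) (hst : s ≤ t) :
    r ^ 2 * (dampingFactor b t * y t) ^ 2 + liouvilleDeriv b y y' t ^ 2
      ≤ Real.exp (Q / (r * (1 + s)))
        * (r ^ 2 * (dampingFactor b s * y s) ^ 2 + liouvilleDeriv b y y' s ^ 2) := by
  set v := fun t => dampingFactor b t * y t with hv
  set w := liouvilleDeriv b y y' with hw
  have hanti : AntitoneOn (fun t => (r ^ 2 * v t ^ 2 + w t ^ 2) * Real.exp (Q / r * (1 + t)⁻¹))
      (Set.Ici 0) := by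
    refine antitoneOn_Ici_of_hasDerivWithinAt (f' := fun t =>
      (2 * (b t ^ 2 / 4 + b₁ t / 2) * v t * w t
        - Q / (1 + t) ^ 2 * ((r ^ 2 * v t ^ 2 + w t ^ 2) / r))
        * Real.exp (Q / r * (1 + t)⁻¹)) (fun t ht => ?_) fun t ht => ?_
    · have ht1 : 1 + t ≠ 0 := by positivity
      have d1 := ((((H.hasDerivWithinAt_liouville hy ht).pow 2).const_mul (r ^ 2)).add
        ((H.hasDerivWithinAt_liouvilleDeriv hy ht).pow 2))
      have d2 := (((((hasDerivAt_id' t).const_add 1).inv ht1).const_mul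
          (Q / r)).exp).hasDerivWithinAt (s := Set.Ici 0)
      refine (d1.mul d2).congr_deriv ?_
      simp only [Pi.add_apply, Pi.pow_apply, Pi.inv_apply, ← hw, hv]
      push_cast
      field_simp
      ring
    · refine mul_nonpos_of_nonpos_of_nonneg ?_ (Real.exp_pos _).le
      have hq := H.potential_le t ht
      set q := b t ^ 2 / 4 + b₁ t / 2
      have e1 : 2 * |v t * w t| ≤ (r ^ 2 * v t ^ 2 + w t ^ 2) / r := by
        rw [le_div_iff₀ hr, abs_mul]
        nlinarith [sq_nonneg (r * |v t| - |w t|), sq_abs (v t), sq_abs (w t)]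
      have e2 : 2 * q * v t * w t ≤ |q| * (2 * |v t * w t|) := by
        calc 2 * q * v t * w t = 2 * (q * (v t * w t)) := by ring
          _ ≤ 2 * |q * (v t * w t)| := by gcongr; exact le_abs_self _
          _ = _ := by rw [abs_mul]; ring
      have e3 : |q| * (2 * |v t * w t|) ≤ Q / (1 + t) ^ 2 * ((r ^ 2 * v t ^ 2 + w t ^ 2) / r) :=
        mul_le_mul hq e1 (by positivity) ((abs_nonneg _).trans hq)
      linarith
  have h1 := hanti (Set.mem_Ici.2 hs) (Set.mem_Ici.2 (hs.trans hst)) hst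
  dsimp only at h1
  have hQ := H.Q_nonneg
  have ht : 0 ≤ t := hs.trans hst
  have h2 : 1 ≤ Real.exp (Q / r * (1 + t)⁻¹) := Real.one_le_exp (by positivity)
  have h3 : Q / (r * (1 + s)) = Q / r * (1 + s)⁻¹ := by rw [div_mul_eq_div_div, div_eq_mul_inv (Q / r)]
  rw [h3, mul_comm (Real.exp _)]
  exact (le_mul_of_one_le_right (by positivity) h2).trans h1

/-- From time `s` on, `b ≤ B r`, so the energies formed with `λ y'` and with `(λ y)'` are
comparable. Each of the two passages between them costs `2 + B²`, and the Gronwall exponent is at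
most `Q`. -/
theorem high_frequency_le (H : DampingBounds b b₁ h B Q K) (hy : IsModeSolution b r y y')
    (hr : 0 < r) {s t : ℝ} (hs : 0 ≤ s) (hst : s ≤ t) (hrs : 1 ≤ r * (1 + s)) :
    dampingFactor b t ^ 2 * (r ^ 2 * y t ^ 2 + y' t ^ 2) ≤ (2 + B ^ 2) ^ 2 * Real.exp Q
      * (dampingFactor b s ^ 2 * (r ^ 2 * y s ^ 2 + y' s ^ 2)) := by
  have hB := H.B_nonneg
  have hbr : ∀ t, s ≤ t → |b t| ≤ B * r := by
    intro t hst
    have ht := hs.trans hst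
    rw [abs_of_nonneg (H.nonneg t ht)]
    refine (H.le t ht).trans ?_
    rw [div_le_iff₀ (by positivity), mul_assoc]
    refine le_mul_of_one_le_right hB (hrs.trans ?_)
    gcongr
  have h1 := H.liouville_energy_le hy hr hs hst
  have h2 : Real.exp (Q / (r * (1 + s))) ≤ Real.exp Q := by
    rw [Real.exp_le_exp]
    exact div_le_self H.Q_nonneg hrs
  have key : ∀ t, s ≤ t → ∀ x z : ℝ, (x + b t / 2 * z) ^ 2 ≤ 2 * x ^ 2 + B ^ 2 * (r ^ 2 * z ^ 2) := by
    intro t hst x z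
    have e1 : b t ^ 2 ≤ (B * r) ^ 2 := sq_le_sq.2 ((hbr t hst).trans (le_abs_self _))
    have e2 : b t ^ 2 * z ^ 2 ≤ (B * r) ^ 2 * z ^ 2 := mul_le_mul_of_nonneg_right e1 (sq_nonneg z)
    nlinarith [sq_nonneg (x - b t / 2 * z), sq_nonneg (b t * z)]
  have h3 : r ^ 2 * (dampingFactor b s * y s) ^ 2 + liouvilleDeriv b y y' s ^ 2
      ≤ (2 + B ^ 2) * (dampingFactor b s ^ 2 * (r ^ 2 * y s ^ 2 + y' s ^ 2)) := by
    have e := mul_le_mul_of_nonneg_left (key s le_rfl (y' s) (y s))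
      (sq_nonneg (dampingFactor b s))
    simp only [liouvilleDeriv, mul_pow]
    nlinarith [mul_nonneg (sq_nonneg (dampingFactor b s)) (mul_nonneg (sq_nonneg r) (sq_nonneg (y s))),
      mul_nonneg (sq_nonneg (dampingFactor b s)) (mul_nonneg (sq_nonneg B) (sq_nonneg (y' s)))]
  have h4 : dampingFactor b t ^ 2 * (r ^ 2 * y t ^ 2 + y' t ^ 2) ≤ (2 + B ^ 2) *
      (r ^ 2 * (dampingFactor b t * y t) ^ 2 + liouvilleDeriv b y y' t ^ 2) := by
    -- The negated second argument turns `(λ y)'` back into `λ y'`.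
    have e := key t hst (liouvilleDeriv b y y' t) (-(dampingFactor b t * y t))
    have e1 : liouvilleDeriv b y y' t + b t / 2 * -(dampingFactor b t * y t)
        = dampingFactor b t * y' t := by
      simp only [liouvilleDeriv]
      ring
    rw [e1] at e
    nlinarith [mul_nonneg (sq_nonneg r) (sq_nonneg (dampingFactor b t * y t)),
      mul_nonneg (sq_nonneg B) (sq_nonneg (liouvilleDeriv b y y' t))]
  calc _ ≤ _ := h4
    _ ≤ (2 + B ^ 2) * (Real.exp Q * ((2 + B ^ 2)
          * (dampingFactor b s ^ 2 * (r ^ 2 * y s ^ 2 + y' s ^ 2)))) := by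
        refine mul_le_mul_of_nonneg_left (h1.trans ?_) (by positivity)
        exact mul_le_mul h2 h3 (by positivity) (by positivity)
    _ = _ := by ring

/-- The bound of the energy of a mode, uniform in time and frequency. -/
theorem mode_le (H : DampingBounds b b₁ h B Q K) (hy : IsModeSolution b r y y') (hr : 0 ≤ r)
    {t : ℝ} (ht : 0 ≤ t) :
    dampingFactor b t ^ 2 * (r ^ 2 * y t ^ 2 + y' t ^ 2) ≤
      (2 + B ^ 2) ^ 2 * Real.exp Q * ((2 * K ^ 2 + 1) * Real.exp K) * 3
        * ((1 + r ^ 2) * y 0 ^ 2 + y' 0 ^ 2) := by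
  have hQ : 1 ≤ Real.exp Q := Real.one_le_exp H.Q_nonneg
  have hK : 1 ≤ Real.exp K := Real.one_le_exp (zero_le_one.trans H.one_le_K)
  have hB2 : 1 ≤ (2 + B ^ 2) ^ 2 := one_le_pow₀ (by nlinarith [sq_nonneg B])
  have hM : 1 ≤ (2 + B ^ 2) ^ 2 * Real.exp Q := one_le_mul_of_one_le_of_one_le hB2 hQ
  have hN : 1 ≤ (2 * K ^ 2 + 1) * Real.exp K :=
    one_le_mul_of_one_le_of_one_le (by nlinarith [sq_nonneg K]) hK
  set M := (2 + B ^ 2) ^ 2 * Real.exp Q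
  set N := (2 * K ^ 2 + 1) * Real.exp K
  set D := (1 + r ^ 2) * y 0 ^ 2 + y' 0 ^ 2 with hD
  have hD0 : 0 ≤ D := by positivity
  have hlow : (y 0 - y' 0) ^ 2 + y' 0 ^ 2 ≤ 3 * D := by
    nlinarith [sq_nonneg (y 0 + y' 0), mul_nonneg (sq_nonneg r) (sq_nonneg (y 0)),
      sq_nonneg (y 0), sq_nonneg (y' 0)]
  have hND : N * ((y 0 - y' 0) ^ 2 + y' 0 ^ 2) ≤ N * (3 * D) :=
    mul_le_mul_of_nonneg_left hlow (by linarith)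
  rcases le_or_gt (r * (1 + t)) 1 with hrt | hrt
  · calc _ ≤ _ := H.low_frequency_le hy ht hr hrt
      _ ≤ N * (3 * D) := hND
      _ ≤ M * (N * (3 * D)) := le_mul_of_one_le_left (by positivity) hM
      _ = _ := by ring
  · have hr0 : 0 < r := by
      rcases hr.eq_or_lt with rfl | hr
      · norm_num at hrt
      · exact hr
    rcases le_or_gt 1 r with hr1 | hr1
    · have h1 := H.high_frequency_le hy hr0 le_rfl ht (by simpa using hr1)
      rw [dampingFactor_zero, one_pow, one_mul] at h1
      have h2 : r ^ 2 * y 0 ^ 2 + y' 0 ^ 2 ≤ N * (3 * D) := by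
        have : r ^ 2 * y 0 ^ 2 + y' 0 ^ 2 ≤ 3 * D := by
          nlinarith [sq_nonneg (y 0), sq_nonneg (y' 0), mul_nonneg (sq_nonneg r) (sq_nonneg (y 0))]
        exact this.trans (le_mul_of_one_le_left (by positivity) hN)
      calc _ ≤ _ := h1
        _ ≤ M * (N * (3 * D)) := mul_le_mul_of_nonneg_left h2 (by linarith)
        _ = _ := by ring
    -- For `r < 1` the zones meet at `s = r⁻¹ - 1`, where `r (1 + s) = 1`: the low frequency bound
    -- holds up to `s`, the high frequency bound from `s` on.
    · have hs : 0 ≤ r⁻¹ - 1 := sub_nonneg.2 ((one_le_inv₀ hr0).2 hr1.le)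
      have hrs : r * (1 + (r⁻¹ - 1)) = 1 := by
        field_simp
        ring
      have hst : r⁻¹ - 1 ≤ t := by
        have : r * (1 + (r⁻¹ - 1)) < r * (1 + t) := by linarith
        have := lt_of_mul_lt_mul_left this hr
        linarith
      calc _ ≤ _ := H.high_frequency_le hy hr0 hs hst hrs.ge
        _ ≤ M * (N * (3 * D)) := mul_le_mul_of_nonneg_left
            ((H.low_frequency_le hy hs hr hrs.le).trans hND) (by linarith)
        _ = _ := by ring

end DampingBounds

end

/-! ### Asymptotics of a mode, the Wronskian, and the constants of the dissipation. -/

section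

/-- A bounded function on `[0, ∞)` with derivative `O((1 + t)⁻²)` converges. -/
theorem exists_tendsto_of_abs_deriv_le {f f' : ℝ → ℝ} {M C : ℝ}
    (h : ∀ t, 0 ≤ t → HasDerivWithinAt f (f' t) (Set.Ici 0) t)
    (h' : ∀ t, 0 ≤ t → |f' t| ≤ M / (1 + t) ^ 2) (hC : ∀ t, 0 ≤ t → |f t| ≤ C) :
    ∃ a, Tendsto f atTop (𝓝 a) := by
  have hM : 0 ≤ M := by simpa using (abs_nonneg _).trans (h' 0 le_rfl)
  -- The term `M / (1 + t)` has derivative `-M / (1 + t)²`, which absorbs `f'`: `g` is antitone and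
  -- bounded below, and differs from `-f` by a null function.
  set g : ℝ → ℝ := fun t => M * (1 + t)⁻¹ - f t with hg
  have hanti : AntitoneOn g (Set.Ici 0) := by
    refine antitoneOn_Ici_of_hasDerivWithinAt (f' := fun t => -(M / (1 + t) ^ 2) - f' t)
      (fun t ht => ?_) fun t ht => ?_
    · have ht1 : 1 + t ≠ 0 := by positivity
      refine (((((hasDerivAt_id' t).const_add 1).inv ht1).const_mul M).hasDerivWithinAt.sub
        (h t ht)).congr_deriv ?_
      ring
    · have := neg_abs_le (f' t)
      have := h' t ht
      linarith
  have hanti' : Antitone fun t => g (max t 0) := fun s t hst =>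
    hanti (le_max_right s 0) (le_max_right t 0) (max_le_max_right 0 hst)
  have hbdd : BddBelow (Set.range fun t => g (max t 0)) := by
    refine ⟨-C, ?_⟩
    rintro _ ⟨t, rfl⟩
    have h1 := hC (max t 0) (le_max_right t 0)
    have h2 := le_abs_self (f (max t 0))
    have h3 : (0 : ℝ) ≤ max t 0 := le_max_right t 0
    have h4 : 0 ≤ M * (1 + max t 0)⁻¹ := by positivity
    simp only [hg]
    linarith
  have h1 := tendsto_atTop_ciInf hanti' hbdd
  have h2 : Tendsto (fun t : ℝ => M * (1 + t)⁻¹) atTop (𝓝 0) := by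
    simpa using (tendsto_inv_atTop_zero.comp (tendsto_atTop_add_const_left atTop (1 : ℝ)
      tendsto_id)).const_mul M
  refine ⟨_, (h2.sub h1).congr' ?_⟩
  filter_upwards [eventually_ge_atTop 0] with t ht
  simp [hg, max_eq_left ht]

namespace DampingBounds

variable {b b₁ h : ℝ → ℝ} {B Q K : ℝ} {r : ℝ} {y y' : ℝ → ℝ}

theorem tendsto_zero (H : DampingBounds b b₁ h B Q K) : Tendsto b atTop (𝓝 0) := by
  have h2 : Tendsto (fun t : ℝ => B / (1 + t)) atTop (𝓝 0) :=
    tendsto_const_nhds.div_atTop (tendsto_atTop_add_const_left atTop (1 : ℝ) tendsto_id)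
  refine tendsto_of_tendsto_of_tendsto_of_le_of_le' tendsto_const_nhds h2 ?_ ?_
  · filter_upwards [eventually_ge_atTop 0] with t ht using H.nonneg t ht
  · filter_upwards [eventually_ge_atTop 0] with t ht using H.le t ht

/-- Rotating `(r v, v')`, `v = λ y`, back by the angle `r t` cancels the free motion. The remaining
derivative is `q v` times a sine or cosine, integrable because `v` is bounded for fixed `r > 0`.
Replacing `v'` by `λ y'` costs `b v / 2`, which tends to zero. -/
theorem exists_tendsto (H : DampingBounds b b₁ h B Q K) (hy : IsModeSolution b r y y')
    (hr : 0 < r) :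
    (∃ a, Tendsto (fun t => dampingFactor b t *
      (Real.cos (r * t) * (r * y t) - Real.sin (r * t) * y' t)) atTop (𝓝 a)) ∧
    ∃ c, Tendsto (fun t => dampingFactor b t *
      (Real.sin (r * t) * (r * y t) + Real.cos (r * t) * y' t)) atTop (𝓝 c) := by
  set v := fun t => dampingFactor b t * y t with hv
  set w := liouvilleDeriv b y y' with hw
  set F := Real.exp (Q / (r * (1 + 0))) * (r ^ 2 * v 0 ^ 2 + w 0 ^ 2) with hF
  have hf : ∀ t, 0 ≤ t → r ^ 2 * v t ^ 2 + w t ^ 2 ≤ F := fun t ht =>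
    H.liouville_energy_le hy hr le_rfl ht
  have hF0 : 0 ≤ F := by positivity
  have hrv : ∀ t, 0 ≤ t → |r * v t| ≤ √F := fun t ht =>
    Real.abs_le_sqrt (by nlinarith [hf t ht, sq_nonneg (w t)])
  have hwb : ∀ t, 0 ≤ t → |w t| ≤ √F := fun t ht =>
    Real.abs_le_sqrt (by nlinarith [hf t ht, mul_nonneg (sq_nonneg r) (sq_nonneg (v t))])
  have hvb : ∀ t, 0 ≤ t → |v t| ≤ √F / r := fun t ht => by
    rw [le_div_iff₀ hr, mul_comm]
    simpa [abs_mul, abs_of_pos hr] using hrv t ht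
  have hid : ∀ t : ℝ, HasDerivAt (fun t => r * t) r t := fun t => by
    simpa using (hasDerivAt_id t).const_mul r
  have hb : ∀ x y t : ℝ, 0 ≤ t → |x| ≤ 1 → |y| ≤ 1 → ∀ p q : ℝ, |p| ≤ √F → |q| ≤ √F →
      |x * p| + |y * q| ≤ 2 * √F := by
    intro x y t _ hx hy p q hp hq
    rw [abs_mul, abs_mul]
    have h1 : |x| * |p| ≤ 1 * √F := mul_le_mul hx hp (abs_nonneg _) zero_le_one
    have h2 : |y| * |q| ≤ 1 * √F := mul_le_mul hy hq (abs_nonneg _) zero_le_one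
    linarith
  have hq : ∀ x t : ℝ, 0 ≤ t → |x| ≤ 1 →
      |x * ((b t ^ 2 / 4 + b₁ t / 2) * v t)| ≤ (Q * (√F / r)) / (1 + t) ^ 2 := by
    intro x t ht hx
    rw [abs_mul, abs_mul]
    have hQ := (abs_nonneg _).trans (H.potential_le t ht)
    have h1 : |b t ^ 2 / 4 + b₁ t / 2| * |v t| ≤ Q / (1 + t) ^ 2 * (√F / r) :=
      mul_le_mul (H.potential_le t ht) (hvb t ht) (abs_nonneg _) hQ
    calc _ ≤ 1 * (Q / (1 + t) ^ 2 * (√F / r)) := mul_le_mul hx h1 (by positivity) zero_le_one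
      _ = _ := by ring
  -- the error of replacing `λ y'` by `(λ y)'`
  have herr : ∀ s : ℝ → ℝ, (∀ t, |s t| ≤ 1) →
      Tendsto (fun t => s t * (b t / 2 * v t)) atTop (𝓝 0) := by
    intro s hs
    have h1 : Tendsto (fun t => |b t| / 2 * (√F / r)) atTop (𝓝 0) := by
      simpa using (H.tendsto_zero.abs.div_const 2).mul_const (√F / r)
    refine squeeze_zero_norm' ?_ h1
    filter_upwards [eventually_ge_atTop 0] with t ht
    rw [Real.norm_eq_abs, abs_mul, abs_mul, abs_div, abs_two]
    have h2 : |b t| / 2 * |v t| ≤ |b t| / 2 * (√F / r) := by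
      have := hvb t ht
      gcongr
    calc _ ≤ 1 * (|b t| / 2 * (√F / r)) := mul_le_mul (hs t) h2 (by positivity) zero_le_one
      _ = _ := one_mul _
  constructor
  · obtain ⟨a, ha⟩ := exists_tendsto_of_abs_deriv_le
      (f := fun t => Real.cos (r * t) * (r * v t) - Real.sin (r * t) * w t)
      (f' := fun t => -Real.sin (r * t) * ((b t ^ 2 / 4 + b₁ t / 2) * v t))
      (M := Q * (√F / r)) (C := 2 * √F) (fun t ht => by
        refine (((hid t).cos.hasDerivWithinAt.mul ((H.hasDerivWithinAt_liouville hy ht).const_mul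
          r)).sub ((hid t).sin.hasDerivWithinAt.mul
          (H.hasDerivWithinAt_liouvilleDeriv hy ht))).congr_deriv ?_
        simp only [hv]
        ring)
      (fun t ht => hq _ t ht (by rw [abs_neg]; exact Real.abs_sin_le_one _))
      (fun t ht => (abs_sub _ _).trans (hb _ _ t ht (Real.abs_cos_le_one _)
        (Real.abs_sin_le_one _) _ _ (hrv t ht) (hwb t ht)))
    refine ⟨a + 0, (ha.add (herr (fun t => Real.sin (r * t))
      fun t => Real.abs_sin_le_one _)).congr fun t => ?_⟩
    simp only [hv, hw, liouvilleDeriv]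
    ring
  · obtain ⟨a, ha⟩ := exists_tendsto_of_abs_deriv_le
      (f := fun t => Real.sin (r * t) * (r * v t) + Real.cos (r * t) * w t)
      (f' := fun t => Real.cos (r * t) * ((b t ^ 2 / 4 + b₁ t / 2) * v t))
      (M := Q * (√F / r)) (C := 2 * √F) (fun t ht => by
        refine (((hid t).sin.hasDerivWithinAt.mul ((H.hasDerivWithinAt_liouville hy ht).const_mul
          r)).add ((hid t).cos.hasDerivWithinAt.mul
          (H.hasDerivWithinAt_liouvilleDeriv hy ht))).congr_deriv ?_
        simp only [hv]
        ring)
      (fun t ht => hq _ t ht (Real.abs_cos_le_one _))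
      (fun t ht => (abs_add_le _ _).trans (hb _ _ t ht (Real.abs_sin_le_one _)
        (Real.abs_cos_le_one _) _ _ (hrv t ht) (hwb t ht)))
    refine ⟨a - 0, (ha.sub (herr (fun t => Real.cos (r * t))
      fun t => Real.abs_cos_le_one _)).congr fun t => ?_⟩
    simp only [hv, hw, liouvilleDeriv]
    ring

/-- Abel's identity: the Wronskian decays with rate `b`, while `λ²` grows with the same rate. A
vanishing derivative makes both the product and its negative antitone. -/
theorem wronskian_eq (H : DampingBounds b b₁ h B Q K) {y₁ y₁' y₂ y₂' : ℝ → ℝ}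
    (hy₁ : IsModeSolution b r y₁ y₁') (hy₂ : IsModeSolution b r y₂ y₂') {t : ℝ} (ht : 0 ≤ t) :
    dampingFactor b t ^ 2 * (y₁ t * y₂' t - y₁' t * y₂ t) = y₁ 0 * y₂' 0 - y₁' 0 * y₂ 0 := by
  have hd : ∀ t, 0 ≤ t → HasDerivWithinAt
      (fun t => dampingFactor b t ^ 2 * (y₁ t * y₂' t - y₁' t * y₂ t)) 0 (Set.Ici 0) t := by
    intro t ht
    refine (((hasDerivWithinAt_dampingFactor H.continuousOn ht).pow 2).mul
      (((hy₁.hasDeriv t ht).mul (hy₂.hasDeriv' t ht)).sub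
      ((hy₁.hasDeriv' t ht).mul (hy₂.hasDeriv t ht)))).congr_deriv ?_
    simp only [Pi.sub_apply, Pi.mul_apply, Pi.pow_apply]
    push_cast
    ring
  have h1 := antitoneOn_Ici_of_hasDerivWithinAt hd (fun _ _ => le_rfl) Set.self_mem_Ici ht ht
  have h2 := antitoneOn_Ici_of_hasDerivWithinAt (fun t ht => (hd t ht).neg)
    (fun _ _ => neg_zero.le) Set.self_mem_Ici ht ht
  simp only [Pi.neg_apply, dampingFactor_zero] at h1 h2
  linarith

end DampingBounds

/-- The weight is given explicitly by `h = μ (1 + ∫ μ⁻¹)` with `μ = exp ∫ b`. If `(1 + t) b(t) ≤ β <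
1` for `t ≥ T`, then `K (1 + t)` is a supersolution of `h' = 1 + b h` there as soon as `K (1 - β) ≥
1`, so `h` grows at most linearly. The bound of the potential follows from `b = O((1+t)⁻¹)` and
`|b'| ≤ C b / (1+t)`. -/
theorem exists_dampingBounds {b : ℝ → ℝ} (hb_smooth : ContDiffOn ℝ ∞ b (Set.Ici 0))
    (hb_nonneg : ∀ t : ℝ, 0 ≤ t → 0 ≤ b t)
    (hb_deriv : ∃ C : ℝ, ∀ t : ℝ, 0 ≤ t →
      |iteratedDerivWithin 1 b (Set.Ici 0) t| ≤ C * b t * (1 / (1 + t)) ^ 1)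
    (hb_nonEffective : Filter.limsup (fun t : ℝ => ((t * b t : ℝ) : EReal)) Filter.atTop < 1) :
    ∃ b₁ h B Q K, DampingBounds b b₁ h B Q K := by
  have hd : ∀ t, 0 ≤ t → HasDerivWithinAt b (derivWithin b (Set.Ici 0) t) (Set.Ici 0) t :=
    fun t ht => ((hb_smooth.differentiableOn (by simp)) t ht).hasDerivWithinAt
  have hc : ContinuousOn b (Set.Ici 0) := hb_smooth.continuousOn
  -- `(1 + t) b(t) ≤ β < 1` for large `t`
  obtain ⟨x, hx1, hx2⟩ := EReal.lt_iff_exists_real_btwn.1 hb_nonEffective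
  have hx : x < 1 := by exact_mod_cast hx2
  have hev := Filter.eventually_lt_of_limsup_lt hx1
  obtain ⟨β, hβ1, T, hT0, hT⟩ : ∃ β < 1, ∃ T, 0 ≤ T ∧ ∀ t, T ≤ t → (1 + t) * b t ≤ β := by
    obtain ⟨T₀, hT₀⟩ := eventually_atTop.1 hev
    -- With `m = max x 0`, the bound `t b ≤ m` gives `t (1 + t) b ≤ (1 + t) m`, and this is at most
    -- `t (1 + m) / 2` exactly when `2 m ≤ t (1 - m)`; this dictates the second entry of the
    -- threshold.
    refine ⟨(1 + max x 0) / 2, by have := max_lt hx one_pos; linarith,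
      max (max T₀ 1) (2 * max x 0 / (1 - max x 0)), by positivity, fun t ht => ?_⟩
    have hm1 : max x 0 < 1 := max_lt hx one_pos
    have hm0 : 0 ≤ max x 0 := le_max_right _ _
    have ht1 : 1 ≤ t := (le_max_right _ _).trans ((le_max_left _ _).trans ht)
    have h1 : t * b t < x := by
      exact_mod_cast hT₀ t ((le_max_left _ _).trans ((le_max_left _ _).trans ht))
    have h2 : t * b t ≤ max x 0 := h1.le.trans (le_max_left _ _)
    have h3 : 2 * max x 0 ≤ t * (1 - max x 0) := by
      have := (le_max_right _ _).trans ht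
      rwa [div_le_iff₀ (by linarith)] at this
    have h4 : t * ((1 + t) * b t) ≤ t * ((1 + max x 0) / 2) := by
      nlinarith
    exact le_of_mul_le_mul_left h4 (by linarith)
  have hB : ∃ B, 0 ≤ B ∧ ∀ t, 0 ≤ t → b t ≤ B / (1 + t) := by
    obtain ⟨C, hC⟩ := isCompact_Icc.exists_bound_of_continuousOn (s := Set.Icc 0 T)
      (f := fun t => (1 + t) * b t)
      (((continuous_const.add continuous_id).continuousOn).mul (hc.mono Set.Icc_subset_Ici_self))
    refine ⟨max C 1, by positivity, fun t ht => ?_⟩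
    rw [le_div_iff₀ (by positivity), mul_comm]
    rcases le_total t T with htT | htT
    · exact (le_abs_self _).trans ((hC t ⟨ht, htT⟩).trans (le_max_left _ _))
    · exact (hT t htT).trans (hβ1.le.trans (le_max_right _ _))
  obtain ⟨B, hB0, hB⟩ := hB
  obtain ⟨C, hC⟩ := hb_deriv
  have hQ : ∀ t, 0 ≤ t →
      |b t ^ 2 / 4 + derivWithin b (Set.Ici 0) t / 2| ≤ (B ^ 2 + |C| * B) / (1 + t) ^ 2 := by
    intro t ht
    have h1 := hC t ht
    rw [iteratedDerivWithin_one, pow_one] at h1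
    have hbt := hb_nonneg t ht
    have h2 : b t ^ 2 ≤ B ^ 2 / (1 + t) ^ 2 := by
      rw [← div_pow]
      exact pow_le_pow_left₀ hbt (hB t ht) 2
    have h3 : C * b t * (1 / (1 + t)) ≤ |C| * B / (1 + t) ^ 2 := by
      calc C * b t * (1 / (1 + t)) ≤ |C| * (B / (1 + t)) * (1 / (1 + t)) := by
            have := hB t ht
            have := le_abs_self C
            gcongr
        _ = _ := by field_simp
    have h4 : |b t ^ 2 / 4 + derivWithin b (Set.Ici 0) t / 2|
        ≤ b t ^ 2 / 4 + |derivWithin b (Set.Ici 0) t| / 2 := by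
      refine (abs_add_le _ _).trans ?_
      rw [abs_of_nonneg (by positivity : 0 ≤ b t ^ 2 / 4), abs_div, abs_two]
    rw [add_div]
    have := sq_nonneg (b t)
    have := abs_nonneg (derivWithin b (Set.Ici 0) t)
    linarith
  -- the weight
  set μ := dampingWeight b with hμ
  have hμp : ∀ t, 0 < μ t := dampingWeight_pos b
  have hμd := hasDerivAt_dampingWeight hc
  have hinv : Continuous fun t => (μ t)⁻¹ :=
    (continuous_dampingWeight hc).inv₀ fun t => (hμp t).ne'
  set g : ℝ → ℝ := fun t => μ t * (1 + ∫ s in (0 : ℝ)..t, (μ s)⁻¹) with hg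
  have hgd : ∀ t, HasDerivAt g (1 + extendLeft b t * g t) t := by
    intro t
    have h1 : HasDerivAt (fun t => ∫ s in (0 : ℝ)..t, (μ s)⁻¹) (μ t)⁻¹ t :=
      intervalIntegral.integral_hasDerivAt_right (hinv.intervalIntegrable _ _)
        (hinv.stronglyMeasurableAtFilter _ _) hinv.continuousAt
    refine ((hμd t).mul (h1.const_add 1)).congr_deriv ?_
    have := (hμp t).ne'
    simp only [hg]
    field_simp
    ring
  have hgp : ∀ t, 0 ≤ t → 0 < g t := fun t ht => by
    have : 0 ≤ ∫ s in (0 : ℝ)..t, (μ s)⁻¹ :=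
      intervalIntegral.integral_nonneg ht fun s _ => (inv_pos.2 (hμp s)).le
    have := hμp t
    positivity
  -- The entry `g T` controls the monotone weight on `[0, T]` and the start of the comparison at
  -- `T`; `1 / (1 - β)` makes `K (1 + t)` a supersolution afterwards.
  set K := max (g T) (max 1 (1 / (1 - β))) with hK
  have hK1 : 1 ≤ K := (le_max_left _ _).trans (le_max_right _ _)
  have hK2 : 1 ≤ K * (1 - β) := by
    rw [← div_le_iff₀ (by linarith)]
    exact (le_max_right _ _).trans (le_max_right _ _)
  have hgmono : MonotoneOn g (Set.Ici 0) := by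
    have := antitoneOn_Ici_of_hasDerivWithinAt (f := -g)
      (fun t _ => (hgd t).neg.hasDerivWithinAt) fun t ht => by
        rw [extendLeft_of_nonneg b ht]
        have := mul_nonneg (hb_nonneg t ht) (hgp t ht).le
        linarith
    simpa using this.neg
  refine ⟨derivWithin b (Set.Ici 0), g, B, B ^ 2 + |C| * B, K, hd, hb_nonneg, hB, hQ,
    fun t ht => ?_, ?_, hgp, fun t ht => ?_⟩
  · rw [← extendLeft_of_nonneg b ht]
    exact (hgd t).hasDerivWithinAt
  · simp [hg, hμ, dampingWeight_zero]
  · rcases le_total t T with htT | htT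
    · calc g t ≤ g T := hgmono ht hT0 htT
        _ ≤ K := le_max_left _ _
        _ ≤ K * (1 + t) := le_mul_of_one_le_right (by linarith) (by linarith)
    -- The integrating factor `μ⁻¹` cancels the term `b g`, leaving `1 - K + K (1 + t) b ≤ 1 - K (1
    -- - β) ≤ 0`. Time is shifted by `T` so that the monotonicity criterion on `[0, ∞)` applies.
    · have hanti : AntitoneOn (fun s => (μ (T + s))⁻¹ * (g (T + s) - K * (1 + (T + s))))
          (Set.Ici 0) := by
        refine antitoneOn_Ici_of_hasDerivWithinAt (f' := fun s => (μ (T + s))⁻¹ *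
          (1 - K + K * ((1 + (T + s)) * b (T + s)))) (fun s hs => ?_) fun s hs => ?_
        · have h1 := (hμd (T + s)).inv (hμp _).ne'
          have h2 := (hgd (T + s)).sub
            (((hasDerivAt_id' (T + s)).const_add 1).const_mul K)
          have h3 := ((h1.mul h2).comp s ((hasDerivAt_id' s).const_add T)).hasDerivWithinAt
            (s := Set.Ici 0)
          refine h3.congr_deriv ?_
          have := (hμp (T + s)).ne'
          rw [extendLeft_of_nonneg b (by linarith)]
          simp only [Pi.inv_apply, Pi.sub_apply, ← hμ]
          field_simp
          ring
        · refine mul_nonpos_of_nonneg_of_nonpos (inv_pos.2 (hμp _)).le ?_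
          have := mul_le_mul_of_nonneg_left (hT (T + s) (by linarith)) (by linarith : 0 ≤ K)
          linarith
      have h1 := hanti Set.self_mem_Ici (Set.mem_Ici.2 (sub_nonneg.2 htT)) (sub_nonneg.2 htT)
      simp only [add_zero, add_sub_cancel] at h1
      have h2 : (μ T)⁻¹ * (g T - K * (1 + T)) ≤ 0 := by
        refine mul_nonpos_of_nonneg_of_nonpos (inv_pos.2 (hμp _)).le ?_
        have : g T ≤ K := le_max_left _ _
        nlinarith
      have h3 := nonpos_of_mul_nonpos_right (h1.trans h2) (inv_pos.2 (hμp t))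
      linarith

end

/-! ### Time-dependent multipliers and the equation tested against Schwartz functions. -/

section

variable {n : ℕ}

theorem fMul_sub {m₁ m₂ : EuclideanSpace ℝ (Fin n) → ℂ} (h₁ : MemLp m₁ ∞ volume)
    (h₂ : MemLp m₂ ∞ volume) (f : L2 n) :
    fMul m₁ f - fMul m₂ f = fMul (fun η => m₁ η - m₂ η) f := by
  have h : MemLp (fun η => m₁ η - m₂ η) ∞ volume := h₁.sub h₂
  rw [sub_eq_iff_eq_add, fMul_add h h₂]
  refine fMul_congr (Eventually.of_forall fun η => ?_) f
  simp

/-! ### Curves of multipliers -/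

theorem eventually_nonneg_le_nhdsWithin (t : ℝ) :
    ∀ᶠ s in 𝓝[Set.Ici 0] t, s ∈ Set.Icc 0 (t + 1) := by
  filter_upwards [self_mem_nhdsWithin, mem_nhdsWithin_of_mem_nhds (Iio_mem_nhds (lt_add_one t))]
    with s hs hs'
  exact ⟨hs, le_of_lt hs'⟩

theorem continuousOn_fMul {q : ℝ → EuclideanSpace ℝ (Fin n) → ℂ}
    (hq : ∀ t, 0 ≤ t → MemLp (q t) ∞ volume)
    (hc : ∀ η, ContinuousOn (fun t => q t η) (Set.Ici 0))
    (hb : ∀ T, ∃ C, ∀ t ∈ Set.Icc 0 T, ∀ η, ‖q t η‖ ≤ C) (f : L2 n) :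
    ContinuousOn (fun t => fMul (q t) f) (Set.Ici 0) := by
  intro t ht
  obtain ⟨C, hC⟩ := hb (t + 1)
  have hev := eventually_nonneg_le_nhdsWithin t
  exact tendsto_fMul (hev.mono fun s hs => hq s hs.1) (hq t ht) C
    (hev.mono fun s hs => Eventually.of_forall (hC s hs))
    (Eventually.of_forall fun η => hc η t ht) f

/-- The mean value inequality bounds the difference quotients of the symbols by the local bound of
`q'`, so `tendsto_fMul` applies to them. -/
theorem hasDerivWithinAt_fMul {q q' : ℝ → EuclideanSpace ℝ (Fin n) → ℂ}
    (hq : ∀ t, 0 ≤ t → MemLp (q t) ∞ volume) (hq' : ∀ t, 0 ≤ t → MemLp (q' t) ∞ volume)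
    (hd : ∀ η, ∀ t, 0 ≤ t → HasDerivWithinAt (fun t => q t η) (q' t η) (Set.Ici 0) t)
    (hb : ∀ T, ∃ C, ∀ t ∈ Set.Icc 0 T, ∀ η, ‖q' t η‖ ≤ C) (f : L2 n) {t : ℝ} (ht : 0 ≤ t) :
    HasDerivWithinAt (fun t => fMul (q t) f) (fMul (q' t) f) (Set.Ici 0) t := by
  rw [hasDerivWithinAt_iff_tendsto_slope]
  obtain ⟨C, hC⟩ := hb (t + 1)
  have hev : ∀ᶠ s in 𝓝[Set.Ici 0 \ {t}] t, s ∈ Set.Icc 0 (t + 1) ∧ s ≠ t :=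
    ((eventually_nonneg_le_nhdsWithin t).filter_mono
      (nhdsWithin_mono _ Set.sdiff_subset)).and
      (eventually_mem_nhdsWithin.mono fun s hs => hs.2)
  have h : ∀ s, 0 ≤ s → MemLp (fun η => q s η - q t η) ∞ volume := fun s hs =>
    (hq s hs).sub (hq t ht)
  have hslope : ∀ᶠ s in 𝓝[Set.Ici 0 \ {t}] t,
      fMul (fun η => slope (fun t => q t η) t s) f = slope (fun t => fMul (q t) f) t s := by
    filter_upwards [hev] with s hs
    rw [slope_def_module, fMul_sub (hq s hs.1.1) (hq t ht), RCLike.real_smul_eq_coe_smul (K := ℂ),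
      fMul_smul (h s hs.1.1)]
    refine fMul_congr (Eventually.of_forall fun η => ?_) f
    simp [slope_def_module]
  refine Tendsto.congr' hslope (tendsto_fMul ?_ (hq' t ht) C ?_
    (Eventually.of_forall fun η => ?_) f)
  · filter_upwards [hev] with s hs
    simp only [slope_def_module]
    exact ((hq s hs.1.1).sub (hq t ht)).const_smul (s - t)⁻¹
  · filter_upwards [hev] with s hs
    refine Eventually.of_forall fun η => ?_
    have h1 := Convex.norm_image_sub_le_of_norm_hasDerivWithin_le (f := fun t => q t η)
      (f' := fun t => q' t η) (s := Set.Icc 0 (t + 1))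
      (fun x hx => (hd η x hx.1).mono Set.Icc_subset_Ici_self) (fun x hx => hC x hx η)
      (convex_Icc _ _) (x := t) (y := s) ⟨ht, by linarith⟩ hs.1
    rw [slope_def_module, norm_smul, norm_inv]
    have h2 : 0 < ‖s - t‖ := norm_pos_iff.2 (sub_ne_zero.2 hs.2)
    rw [inv_mul_le_iff₀ h2]
    linarith
  · exact hasDerivWithinAt_iff_tendsto_slope.1 (hd η t ht)

/-! ### The equation tested against Schwartz functions -/

/-- The pairing of `f ∈ L²` with a Schwartz function. -/
def pairing (φ : 𝓢(EuclideanSpace ℝ (Fin n), ℂ)) : L2 n →L[ℂ] ℂ :=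
  innerSL ℂ (star (φ.toLp 2) : L2 n)

theorem pairing_apply (φ : 𝓢(EuclideanSpace ℝ (Fin n), ℂ)) (f : L2 n) :
    pairing φ f = (f : 𝓢'(EuclideanSpace ℝ (Fin n), ℂ)) φ := by
  rw [pairing, innerSL_apply_apply, L2.inner_def, Lp.toTemperedDistribution_apply]
  refine integral_congr_ae ?_
  filter_upwards [Lp.coeFn_star (φ.toLp 2 : L2 n), φ.coeFn_toLp 2] with x h1 h2
  rw [h1, Pi.star_apply, h2]
  simp [mul_comm]

theorem eq_zero_of_pairing {f : L2 n} (h : ∀ φ, pairing φ f = 0) : f = 0 := by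
  have h1 : f ∈ (Lp.toTemperedDistributionCLM ℂ
      (volume : Measure (EuclideanSpace ℝ (Fin n))) 2).ker := by
    rw [LinearMap.mem_ker]
    ext φ
    simpa [pairing_apply] using h φ
  rwa [Lp.ker_toTemperedDistributionCLM_eq_bot, Submodule.mem_bot] at h1

/-- The length `|ξ|` of the frequency `ξ = 2 π η`. -/
def freq (η : EuclideanSpace ℝ (Fin n)) : ℝ := ‖(2 * Real.pi) • η‖

theorem freq_eq (η : EuclideanSpace ℝ (Fin n)) : freq η = 2 * Real.pi * ‖η‖ := by
  rw [freq, norm_smul, Real.norm_of_nonneg (by positivity)]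

theorem freq_nonneg (η : EuclideanSpace ℝ (Fin n)) : 0 ≤ freq η := norm_nonneg _

theorem continuous_freq : Continuous (freq : EuclideanSpace ℝ (Fin n) → ℝ) := by
  unfold freq
  fun_prop

/-- The weight `(1 + |η|²)⁻¹`. -/
def smoothing (η : EuclideanSpace ℝ (Fin n)) : ℝ := (1 + ‖η‖ ^ 2)⁻¹

theorem smoothing_pos (η : EuclideanSpace ℝ (Fin n)) : 0 < smoothing η := by
  unfold smoothing
  positivity

theorem continuous_smoothing : Continuous (smoothing : EuclideanSpace ℝ (Fin n) → ℝ) :=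
  Continuous.inv₀ (by fun_prop) fun η => by positivity

theorem smoothing_le_one (η : EuclideanSpace ℝ (Fin n)) : smoothing η ≤ 1 :=
  inv_le_one_of_one_le₀ (by nlinarith [sq_nonneg ‖η‖])

theorem freq_sq_mul_smoothing_le (η : EuclideanSpace ℝ (Fin n)) :
    freq η ^ 2 * smoothing η ≤ (2 * Real.pi) ^ 2 := by
  rw [freq_eq, smoothing, mul_pow, ← div_eq_mul_inv, div_le_iff₀ (by positivity)]
  refine mul_le_mul_of_nonneg_left (by linarith) (by positivity)

theorem memLp_ofReal {q : EuclideanSpace ℝ (Fin n) → ℝ} (hq : Measurable q) {C : ℝ}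
    (hC : ∀ η, |q η| ≤ C) : MemLp (fun η => (q η : ℂ)) ∞ volume :=
  memLp_top_of_bound (by fun_prop) C (Eventually.of_forall fun η => by
    simpa using hC η)

theorem memLp_smoothing : MemLp (fun η : EuclideanSpace ℝ (Fin n) => (smoothing η : ℂ)) ∞ volume :=
  memLp_ofReal continuous_smoothing.measurable (C := 1) fun η => by
    rw [abs_of_pos (smoothing_pos η)]
    exact smoothing_le_one η

theorem memLp_freq_sq_smoothing :
    MemLp (fun η : EuclideanSpace ℝ (Fin n) => ((freq η ^ 2 * smoothing η : ℝ) : ℂ)) ∞ volume :=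
  memLp_ofReal ((continuous_freq.pow 2).mul continuous_smoothing).measurable fun η => by
    rw [abs_of_nonneg (mul_nonneg (sq_nonneg _) (smoothing_pos η).le)]
    exact freq_sq_mul_smoothing_le η

theorem hasTemperateGrowth_smoothing :
    (fun η : EuclideanSpace ℝ (Fin n) => (smoothing η : ℂ)).HasTemperateGrowth := by
  have h := Function.hasTemperateGrowth_one_add_norm_sq_rpow (EuclideanSpace ℝ (Fin n)) (-1)
  simp only [Real.rpow_neg_one] at h
  exact Function.Complex.hasTemperateGrowth_ofReal.comp h

theorem pairing_fourier (θ : 𝓢(EuclideanSpace ℝ (Fin n), ℂ)) (g : L2 n) :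
    (g : 𝓢'(EuclideanSpace ℝ (Fin n), ℂ)) (𝓕 θ) = ∫ η, θ η * (𝓕 g : L2 n) η := by
  have h1 := Lp.fourier_toTemperedDistribution_eq g
  have h2 := congrArg (fun T : 𝓢'(EuclideanSpace ℝ (Fin n), ℂ) => T θ) h1
  simp only [TemperedDistribution.fourier_apply] at h2
  rw [h2, Lp.toTemperedDistribution_apply]
  simp

theorem coe_apply_smoothing (θ : 𝓢(EuclideanSpace ℝ (Fin n), ℂ)) (g : L2 n) :
    (g : 𝓢'(EuclideanSpace ℝ (Fin n), ℂ))
      (𝓕 (SchwartzMap.smulLeftCLM ℂ (fun η => (smoothing η : ℂ)) θ))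
      = pairing (𝓕 θ) (fMul (fun η => (smoothing η : ℂ)) g) := by
  rw [pairing_apply, pairing_fourier, pairing_fourier]
  refine integral_congr_ae ?_
  filter_upwards [fourier_fMul memLp_smoothing g] with η h1
  rw [h1, SchwartzMap.smulLeftCLM_apply_apply hasTemperateGrowth_smoothing, smul_eq_mul]
  ring

/-- Moving the smoothing from the test function to `g` replaces the unbounded Laplacian by a bounded
multiplier on `L²`, so that distributional identities become statements about `L²`-valued curves. -/
theorem laplacian_apply_smoothing (θ : 𝓢(EuclideanSpace ℝ (Fin n), ℂ)) (g : L2 n) :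
    (Δ (g : 𝓢'(EuclideanSpace ℝ (Fin n), ℂ)))
      (𝓕 (SchwartzMap.smulLeftCLM ℂ (fun η => (smoothing η : ℂ)) θ))
      = -pairing (𝓕 θ) (fMul (fun η => ((freq η ^ 2 * smoothing η : ℝ) : ℂ)) g) := by
  have hsq : (fun η : EuclideanSpace ℝ (Fin n) => Complex.ofReal (‖η‖ ^ 2)).HasTemperateGrowth :=
    Function.Complex.hasTemperateGrowth_ofReal.comp
      (Function.hasTemperateGrowth_norm_sq (EuclideanSpace ℝ (Fin n)))
  rw [TemperedDistribution.laplacian_eq_fourierMultiplierCLM, smul_apply,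
    TemperedDistribution.fourierMultiplierCLM_apply_apply, FourierTransform.fourierInv_fourier_eq,
    pairing_apply, pairing_fourier, pairing_fourier, ← integral_smul, ← integral_neg]
  refine integral_congr_ae ?_
  filter_upwards [fourier_fMul memLp_freq_sq_smoothing g] with η h1
  rw [h1, SchwartzMap.smulLeftCLM_apply_apply hsq,
    SchwartzMap.smulLeftCLM_apply_apply hasTemperateGrowth_smoothing, freq_eq]
  simp only [smul_eq_mul, Complex.real_smul]
  push_cast
  ring

/-- Multiplication by `1 + |η|²` preserves the Schwartz space and inverts the smoothing, so
restricting to smoothed test functions loses nothing. -/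
theorem exists_eq_fourier_smoothing (φ : 𝓢(EuclideanSpace ℝ (Fin n), ℂ)) :
    ∃ θ, φ = 𝓕 (SchwartzMap.smulLeftCLM ℂ (fun η => (smoothing η : ℂ)) θ) := by
  have hsq : (fun η : EuclideanSpace ℝ (Fin n) => Complex.ofReal (1 + ‖η‖ ^ 2)).HasTemperateGrowth := by
    have h := Function.hasTemperateGrowth_one_add_norm_sq_rpow (EuclideanSpace ℝ (Fin n)) 1
    simp only [Real.rpow_one] at h
    exact Function.Complex.hasTemperateGrowth_ofReal.comp h
  refine ⟨SchwartzMap.smulLeftCLM ℂ (fun η => Complex.ofReal (1 + ‖η‖ ^ 2)) (𝓕⁻ φ), ?_⟩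
  rw [SchwartzMap.smulLeftCLM_smulLeftCLM_apply hasTemperateGrowth_smoothing hsq]
  have : ((fun η : EuclideanSpace ℝ (Fin n) => (smoothing η : ℂ)) *
      fun η => Complex.ofReal (1 + ‖η‖ ^ 2)) = fun _ => 1 := by
    ext η
    rw [Pi.mul_apply, ← Complex.ofReal_mul, smoothing, inv_mul_cancel₀ (by positivity),
      Complex.ofReal_one]
  rw [this, SchwartzMap.smulLeftCLM_const]
  simp

end

/-! ### Solutions given by symbols, and uniqueness of finite energy solutions. -/

section

variable {n : ℕ}

theorem hasDerivWithinAt_timeDeriv {u : ℝ → L2 n} {u' : L2 n} {t : ℝ} (ht : 0 ≤ t)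
    (h : HasDerivWithinAt u u' (Set.Ici 0) t) : timeDeriv u t = u' :=
  h.derivWithin (uniqueDiffOn_Ici 0 t ht)

/-- The value `⟨ξ⟩` at the frequency `ξ = 2 π η`. -/
def bracket (η : EuclideanSpace ℝ (Fin n)) : ℝ := √(1 + freq η ^ 2)

theorem one_le_bracket (η : EuclideanSpace ℝ (Fin n)) : 1 ≤ bracket η :=
  Real.one_le_sqrt.2 (by nlinarith [sq_nonneg (freq η)])

theorem bracket_pos (η : EuclideanSpace ℝ (Fin n)) : 0 < bracket η :=
  zero_lt_one.trans_le (one_le_bracket η)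

theorem bracket_sq (η : EuclideanSpace ℝ (Fin n)) : bracket η ^ 2 = 1 + freq η ^ 2 :=
  Real.sq_sqrt (by positivity)

theorem continuous_bracket : Continuous (bracket : EuclideanSpace ℝ (Fin n) → ℝ) := by
  have := continuous_freq (n := n)
  unfold bracket
  fun_prop

theorem freq_le_bracket (η : EuclideanSpace ℝ (Fin n)) : freq η ≤ bracket η :=
  Real.le_sqrt_of_sq_le (by linarith)

theorem bracket_le (η : EuclideanSpace ℝ (Fin n)) : bracket η ≤ 1 + freq η :=
  (Real.sqrt_le_left (by have := freq_nonneg η; linarith)).2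
    (by nlinarith [freq_nonneg η])

/-- A family of symbols `p t` of multipliers solving the wave equation with dissipation `b` with
finite energy; `p'` is the derivative in time. -/
structure IsSymbolMode (b : ℝ → ℝ) (p p' : ℝ → EuclideanSpace ℝ (Fin n) → ℂ) (C : ℝ) : Prop where
  meas : ∀ t, 0 ≤ t → AEStronglyMeasurable (p t) volume
  meas' : ∀ t, 0 ≤ t → AEStronglyMeasurable (p' t) volume
  hasDeriv : ∀ η, ∀ t, 0 ≤ t → HasDerivWithinAt (fun t => p t η) (p' t η) (Set.Ici 0) t
  hasDeriv' : ∀ η, ∀ t, 0 ≤ t → HasDerivWithinAt (fun t => p' t η)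
    (-((freq η ^ 2 : ℝ) * p t η) - b t * p' t η) (Set.Ici 0) t
  bound : ∀ t, 0 ≤ t → ∀ η, ‖p t η‖ * bracket η ≤ C * (1 + t)
  bound' : ∀ t, 0 ≤ t → ∀ η, ‖p' t η‖ ≤ C

namespace IsSymbolMode

variable {b : ℝ → ℝ} {p p' : ℝ → EuclideanSpace ℝ (Fin n) → ℂ} {C : ℝ}

theorem norm_le (H : IsSymbolMode b p p' C) {t : ℝ} (ht : 0 ≤ t)
    (η : EuclideanSpace ℝ (Fin n)) : ‖p t η‖ ≤ C * (1 + t) :=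
  (le_mul_of_one_le_right (norm_nonneg _) (one_le_bracket η)).trans (H.bound t ht η)

theorem C_nonneg (H : IsSymbolMode b p p' C) : 0 ≤ C :=
  (norm_nonneg _).trans (H.bound' 0 le_rfl 0)

theorem memLp (H : IsSymbolMode b p p' C) {t : ℝ} (ht : 0 ≤ t) : MemLp (p t) ∞ volume :=
  memLp_top_of_bound (H.meas t ht) _ (Eventually.of_forall (H.norm_le ht))

theorem memLp' (H : IsSymbolMode b p p' C) {t : ℝ} (ht : 0 ≤ t) : MemLp (p' t) ∞ volume :=
  memLp_top_of_bound (H.meas' t ht) _ (Eventually.of_forall (H.bound' t ht))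

theorem norm_bracket_mul_le (H : IsSymbolMode b p p' C) {t : ℝ} (ht : 0 ≤ t)
    (η : EuclideanSpace ℝ (Fin n)) : ‖(bracket η : ℂ) * p t η‖ ≤ C * (1 + t) := by
  rw [norm_mul, Complex.norm_real, Real.norm_of_nonneg (bracket_pos η).le, mul_comm]
  exact H.bound t ht η

theorem memLp_bracket (H : IsSymbolMode b p p' C) {t : ℝ} (ht : 0 ≤ t) :
    MemLp (fun η => (bracket η : ℂ) * p t η) ∞ volume :=
  memLp_top_of_bound
    ((Complex.continuous_ofReal.comp continuous_bracket).aestronglyMeasurable.mul (H.meas t ht)) _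
    (Eventually.of_forall (H.norm_bracket_mul_le ht))

theorem memLp_freq (H : IsSymbolMode b p p' C) {t : ℝ} (ht : 0 ≤ t) :
    MemLp (fun η => (freq η : ℂ) * p t η) ∞ volume := by
  refine memLp_top_of_bound
    ((Complex.continuous_ofReal.comp continuous_freq).aestronglyMeasurable.mul (H.meas t ht))
    (C * (1 + t)) (Eventually.of_forall fun η => ?_)
  rw [norm_mul, Complex.norm_real, Real.norm_of_nonneg (freq_nonneg η), mul_comm]
  exact (mul_le_mul_of_nonneg_left (freq_le_bracket η) (norm_nonneg _)).trans (H.bound t ht η)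

theorem locally_bounded (H : IsSymbolMode b p p' C) {t T : ℝ} (ht : t ∈ Set.Icc 0 T) :
    C * (1 + t) ≤ C * (1 + T) :=
  mul_le_mul_of_nonneg_left (by linarith [ht.2]) H.C_nonneg

theorem hasDerivWithinAt_fMul (H : IsSymbolMode b p p' C) (f : L2 n) {t : ℝ} (ht : 0 ≤ t) :
    HasDerivWithinAt (fun t => fMul (p t) f) (fMul (p' t) f) (Set.Ici 0) t :=
  DampedWave.hasDerivWithinAt_fMul (fun _ h => H.memLp h) (fun _ h => H.memLp' h) H.hasDeriv
    (fun _ => ⟨C, fun t ht η => H.bound' t ht.1 η⟩) f ht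

theorem continuousOn_fMul' (H : IsSymbolMode b p p' C) (f : L2 n) :
    ContinuousOn (fun t => fMul (p' t) f) (Set.Ici 0) :=
  DampedWave.continuousOn_fMul (fun _ h => H.memLp' h)
    (fun η t ht => (H.hasDeriv' η t ht).continuousWithinAt)
    (fun _ => ⟨C, fun t ht η => H.bound' t ht.1 η⟩) f

theorem continuousOn_fMul_bracket (H : IsSymbolMode b p p' C) (f : L2 n) :
    ContinuousOn (fun t => fMul (fun η => (bracket η : ℂ) * p t η) f) (Set.Ici 0) :=
  DampedWave.continuousOn_fMul (fun _ h => H.memLp_bracket h)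
    (fun η t ht => continuousWithinAt_const.mul (H.hasDeriv η t ht).continuousWithinAt)
    (fun T => ⟨C * (1 + T), fun _ ht η => (H.norm_bracket_mul_le ht.1 η).trans
      (H.locally_bounded ht)⟩) f

theorem isMultiplier_bracket (H : IsSymbolMode b p p' C) (f : L2 n) {t : ℝ} (ht : 0 ≤ t) :
    IsMultiplier bracketSymbol (fMul (p t) f) (fMul (fun η => (bracket η : ℂ) * p t η) f) :=
  isMultiplier_fMul (m := bracketSymbol) (H.memLp ht) (H.memLp_bracket ht) f

theorem isMultiplier_abs (H : IsSymbolMode b p p' C) (f : L2 n) {t : ℝ} (ht : 0 ≤ t) :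
    IsMultiplier absSymbol (fMul (p t) f) (fMul (fun η => (freq η : ℂ) * p t η) f) :=
  isMultiplier_fMul (m := absSymbol) (H.memLp ht) (H.memLp_freq ht) f

/-- The second time derivative contains the unbounded `|ξ|² p`; after smoothing all symbols are
locally bounded in time and the curve is differentiable in `L²`. -/
theorem hasDerivWithinAt_smoothing (H : IsSymbolMode b p p' C) (hb : ContinuousOn b (Set.Ici 0))
    (f : L2 n) {t : ℝ} (ht : 0 ≤ t) :
    HasDerivWithinAt (fun t => fMul (fun η => (smoothing η : ℂ)) (fMul (p' t) f))
      (-(fMul (fun η => ((freq η ^ 2 * smoothing η : ℝ) : ℂ)) (fMul (p t) f))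
        - (b t : ℂ) • fMul (fun η => (smoothing η : ℂ)) (fMul (p' t) f)) (Set.Ici 0) t := by
  have hm : ∀ t, 0 ≤ t → MemLp (fun η => (smoothing η : ℂ) * p' t η) ∞ volume := fun t ht =>
    memLp_top_mul memLp_smoothing (H.memLp' ht)
  have hm2 : ∀ t, 0 ≤ t →
      MemLp (fun η => ((freq η ^ 2 * smoothing η : ℝ) : ℂ) * p t η) ∞ volume := fun t ht =>
    memLp_top_mul memLp_freq_sq_smoothing (H.memLp ht)
  have hm3 : ∀ t, 0 ≤ t →
      MemLp (fun η => (-1 : ℂ) * (((freq η ^ 2 * smoothing η : ℝ) : ℂ) * p t η)) ∞ volume :=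
    fun t ht => (hm2 t ht).const_mul _
  have hm4 : ∀ t, 0 ≤ t →
      MemLp (fun η => (b t : ℂ) * ((smoothing η : ℂ) * p' t η)) ∞ volume :=
    fun t ht => (hm t ht).const_mul _
  have hm5 : ∀ t, 0 ≤ t →
      MemLp (fun η => (-1 : ℂ) * (((freq η ^ 2 * smoothing η : ℝ) : ℂ) * p t η)
        - (b t : ℂ) * ((smoothing η : ℂ) * p' t η)) ∞ volume :=
    fun t ht => (hm3 t ht).sub (hm4 t ht)
  have key := DampedWave.hasDerivWithinAt_fMul (q := fun t η => (smoothing η : ℂ) * p' t η)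
    (q' := fun t η => (-1 : ℂ) * (((freq η ^ 2 * smoothing η : ℝ) : ℂ) * p t η)
      - (b t : ℂ) * ((smoothing η : ℂ) * p' t η)) hm hm5 (fun η t ht => by
        refine ((H.hasDeriv' η t ht).const_mul (smoothing η : ℂ)).congr_deriv ?_
        push_cast
        ring) (fun T => by
        obtain ⟨B, hB⟩ := isCompact_Icc.exists_bound_of_continuousOn (s := Set.Icc 0 T)
          (hb.mono Set.Icc_subset_Ici_self)
        refine ⟨(2 * Real.pi) ^ 2 * (C * (1 + T)) + B * (1 * C), fun t ht η => ?_⟩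
        refine (norm_sub_le _ _).trans (add_le_add ?_ ?_)
        · rw [norm_mul, norm_neg, norm_one, one_mul, norm_mul, Complex.norm_real,
            Real.norm_of_nonneg (mul_nonneg (sq_nonneg _) (smoothing_pos η).le)]
          exact mul_le_mul (freq_sq_mul_smoothing_le η)
            ((H.norm_le ht.1 η).trans (H.locally_bounded ht)) (norm_nonneg _) (by positivity)
        · rw [norm_mul, norm_mul, Complex.norm_real, Complex.norm_real,
            Real.norm_of_nonneg (smoothing_pos η).le]
          have hs : smoothing η * ‖p' t η‖ ≤ 1 * C :=
            mul_le_mul (smoothing_le_one η) (H.bound' t ht.1 η) (norm_nonneg _) zero_le_one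
          exact mul_le_mul (hB t ht) hs (mul_nonneg (smoothing_pos η).le (norm_nonneg _))
            ((norm_nonneg _).trans (hB t ht))) f ht
  rw [← fMul_sub (hm3 t ht) (hm4 t ht), ← fMul_smul (hm2 t ht), ← fMul_smul (hm t ht),
    ← fMul_fMul memLp_smoothing (H.memLp' ht), ← fMul_fMul memLp_freq_sq_smoothing (H.memLp ht),
    neg_one_smul] at key
  refine key.congr (fun s hs => ?_) ?_
  · exact fMul_fMul memLp_smoothing (H.memLp' hs) f
  · exact fMul_fMul memLp_smoothing (H.memLp' ht) f

end IsSymbolMode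

/-- The equation of `IsSolution`, in terms of multipliers. -/
theorem equation_of_smoothing {b : ℝ → ℝ} {u v : ℝ → L2 n} {t : ℝ}
    (h : HasDerivWithinAt (fun t => fMul (fun η => (smoothing η : ℂ)) (v t))
      (-(fMul (fun η => ((freq η ^ 2 * smoothing η : ℝ) : ℂ)) (u t))
        - (b t : ℂ) • fMul (fun η => (smoothing η : ℂ)) (v t)) (Set.Ici 0) t)
    (φ : 𝓢(EuclideanSpace ℝ (Fin n), ℂ)) :
    HasDerivWithinAt (fun s : ℝ => (v s : 𝓢'(EuclideanSpace ℝ (Fin n), ℂ)) φ)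
      ((Δ (u t : 𝓢'(EuclideanSpace ℝ (Fin n), ℂ))) φ
        - (b t : ℂ) * (v t : 𝓢'(EuclideanSpace ℝ (Fin n), ℂ)) φ) (Set.Ici 0) t := by
  obtain ⟨θ, rfl⟩ := exists_eq_fourier_smoothing φ
  simp only [coe_apply_smoothing, laplacian_apply_smoothing]
  have h1 := ((pairing (𝓕 θ)).restrictScalars ℝ).hasFDerivAt.comp_hasDerivWithinAt t h
  refine h1.congr_deriv ?_
  simp

theorem isSolution_of_isSymbolMode {b : ℝ → ℝ} (hb : ContinuousOn b (Set.Ici 0))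
    {p₁ p₁' p₂ p₂' : ℝ → EuclideanSpace ℝ (Fin n) → ℂ} {C₁ C₂ : ℝ}
    (H₁ : IsSymbolMode b p₁ p₁' C₁) (H₂ : IsSymbolMode b p₂ p₂' C₂) (f g : L2 n) :
    IsSolution b (fMul (p₁ 0) f + fMul (p₂ 0) g)
      ((-Complex.I) • (fMul (p₁' 0) f + fMul (p₂' 0) g))
      (fun t => fMul (p₁ t) f + fMul (p₂ t) g) ∧
    ∀ t, 0 ≤ t → timeDeriv (fun t => fMul (p₁ t) f + fMul (p₂ t) g) t
      = fMul (p₁' t) f + fMul (p₂' t) g := by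
  have hd : ∀ t, 0 ≤ t → HasDerivWithinAt (fun t => fMul (p₁ t) f + fMul (p₂ t) g)
      (fMul (p₁' t) f + fMul (p₂' t) g) (Set.Ici 0) t := fun t ht =>
    (H₁.hasDerivWithinAt_fMul f ht).add (H₂.hasDerivWithinAt_fMul g ht)
  have htd := fun t (ht : 0 ≤ t) => hasDerivWithinAt_timeDeriv ht (hd t ht)
  refine ⟨⟨?_, ?_, fun φ t ht => ?_, rfl, ?_⟩, htd⟩
  · rw [contDiffOn_one_iff_derivWithin (uniqueDiffOn_Ici 0)]
    exact ⟨fun t ht => (hd t ht).differentiableWithinAt,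
      ((H₁.continuousOn_fMul' f).add (H₂.continuousOn_fMul' g)).congr htd⟩
  · exact ⟨_, (H₁.continuousOn_fMul_bracket f).add (H₂.continuousOn_fMul_bracket g),
      fun t ht => (H₁.isMultiplier_bracket f ht).add (H₂.isMultiplier_bracket g ht)⟩
  · have h1 := equation_of_smoothing (b := b) (u := fun t => fMul (p₁ t) f + fMul (p₂ t) g)
      (v := fun t => fMul (p₁' t) f + fMul (p₂' t) g) (t := t) (by
        simp only [map_add]
        refine ((H₁.hasDerivWithinAt_smoothing hb f ht).add
          (H₂.hasDerivWithinAt_smoothing hb g ht)).congr_deriv ?_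
        module) φ
    rw [htd t ht]
    refine h1.congr (fun s hs => by rw [htd s hs]) (by rw [htd t ht])
  · rw [Dt, htd 0 le_rfl]

/-! ### Uniqueness -/

theorem IsSolution.hasDerivWithinAt {b : ℝ → ℝ} {u₁ u₂ : L2 n} {u : ℝ → L2 n}
    (h : IsSolution b u₁ u₂ u) {t : ℝ} (ht : 0 ≤ t) :
    HasDerivWithinAt u (timeDeriv u t) (Set.Ici 0) t :=
  ((h.contDiffOn.differentiableOn one_ne_zero) t ht).hasDerivWithinAt

theorem eq_of_hasDerivWithinAt_zero {V : Type*} [NormedAddCommGroup V] [NormedSpace ℝ V]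
    {f : ℝ → V} (h : ∀ t, 0 ≤ t → HasDerivWithinAt f 0 (Set.Ici 0) t) {t : ℝ} (ht : 0 ≤ t) :
    f t = f 0 := by
  have h1 := Convex.norm_image_sub_le_of_norm_hasDerivWithin_le (f := f) (f' := fun _ => 0)
    (s := Set.Ici 0) (C := 0) (fun x hx => h x hx) (fun x _ => by simp) (convex_Ici 0)
    (x := 0) (y := t) Set.self_mem_Ici ht
  rw [zero_mul, norm_le_zero_iff, sub_eq_zero] at h1
  exact h1

/-- Passage from weak to norm differentiability: the expected derivative is continuous in `L²`,
hence has a primitive. Tested against any Schwartz function, the smoothed velocity and this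
primitive have the same derivative, so they differ by a constant. -/
theorem IsSolution.hasDerivWithinAt_smoothing {b : ℝ → ℝ} (hb : ContinuousOn b (Set.Ici 0))
    {u₁ u₂ : L2 n} {u : ℝ → L2 n} (h : IsSolution b u₁ u₂ u) {t : ℝ} (ht : 0 ≤ t) :
    HasDerivWithinAt (fun t => fMul (fun η => (smoothing η : ℂ)) (timeDeriv u t))
      (-(fMul (fun η => ((freq η ^ 2 * smoothing η : ℝ) : ℂ)) (u t))
        - (b t : ℂ) • fMul (fun η => (smoothing η : ℂ)) (timeDeriv u t)) (Set.Ici 0) t := by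
  set S := fMul (n := n) (fun η => (smoothing η : ℂ))
  set K := fMul (n := n) (fun η => ((freq η ^ 2 * smoothing η : ℝ) : ℂ))
  set R : ℝ → L2 n := fun t => -(K (u t)) - (b t : ℂ) • S (timeDeriv u t) with hR
  have hc' : ContinuousOn (timeDeriv u) (Set.Ici 0) :=
    ((contDiffOn_one_iff_derivWithin (uniqueDiffOn_Ici 0)).1 h.contDiffOn).2
  have hRc : ContinuousOn R (Set.Ici 0) :=
    (K.continuous.comp_continuousOn h.contDiffOn.continuousOn).neg.sub
      ((Complex.continuous_ofReal.comp_continuousOn hb).smul (S.continuous.comp_continuousOn hc'))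
  have hRc' : Continuous fun t => R (max t 0) :=
    hRc.comp_continuous (by fun_prop) fun t => le_max_right t 0
  have hI : ∀ t, 0 ≤ t → HasDerivWithinAt (fun t => ∫ s in (0 : ℝ)..t, R (max s 0)) (R t)
      (Set.Ici 0) t := fun t ht => by
    have h1 := (intervalIntegral.integral_hasDerivAt_right (hRc'.intervalIntegrable 0 t)
      (hRc'.stronglyMeasurableAtFilter _ _) hRc'.continuousAt).hasDerivWithinAt (s := Set.Ici 0)
    rwa [max_eq_left ht] at h1
  have hG : ∀ t, 0 ≤ t → S (timeDeriv u t) - S (timeDeriv u 0) - ∫ s in (0 : ℝ)..t, R (max s 0)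
      = 0 := by
    intro t ht
    refine eq_zero_of_pairing fun φ => ?_
    have hφ : φ = 𝓕 (𝓕⁻ φ) := (FourierTransform.fourier_fourierInv_eq φ).symm
    rw [hφ]
    set θ := 𝓕⁻ φ
    have h1 : ∀ t, 0 ≤ t → HasDerivWithinAt (fun t => pairing (𝓕 θ)
        (S (timeDeriv u t) - S (timeDeriv u 0) - ∫ s in (0 : ℝ)..t, R (max s 0))) 0
        (Set.Ici 0) t := by
      intro t ht
      have e1 := h.equation (𝓕 (SchwartzMap.smulLeftCLM ℂ (fun η => (smoothing η : ℂ)) θ)) t ht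
      simp only [coe_apply_smoothing, laplacian_apply_smoothing] at e1
      have e2 := ((pairing (𝓕 θ)).restrictScalars ℝ).hasFDerivAt.comp_hasDerivWithinAt t (hI t ht)
      have e3 := (e1.sub_const (pairing (𝓕 θ) (S (timeDeriv u 0)))).sub e2
      simp only [map_sub]
      refine e3.congr_deriv ?_
      simp [hR, S, K]
    rw [eq_of_hasDerivWithinAt_zero h1 ht]
    simp
  have h2 : ∀ t ∈ Set.Ici (0 : ℝ), S (timeDeriv u t)
      = S (timeDeriv u 0) + ∫ s in (0 : ℝ)..t, R (max s 0) := fun t ht => by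
    have := hG t ht
    rw [sub_sub, sub_eq_zero] at this
    exact this
  exact ((hI t ht).const_add (S (timeDeriv u 0))).congr h2 (h2 t ht)

theorem memLp_freq_smoothing :
    MemLp (fun η : EuclideanSpace ℝ (Fin n) => ((freq η * smoothing η : ℝ) : ℂ)) ∞ volume :=
  memLp_ofReal (C := 2 * Real.pi) (continuous_freq.mul continuous_smoothing).measurable fun η => by
    rw [abs_of_nonneg (mul_nonneg (freq_nonneg _) (smoothing_pos η).le), freq_eq, smoothing,
      ← div_eq_mul_inv, div_le_iff₀ (by positivity)]
    refine mul_le_mul_of_nonneg_left ?_ (by positivity)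
    nlinarith [sq_nonneg (‖η‖ - 1)]

/-- Energy method for the difference `w` of two solutions, with the smoothed energy `‖S w'‖² + ‖R
w‖²`. Its symbols are chosen so that `S* K = R* R`; the cross terms then cancel and the derivative
is `-2 b ‖S w'‖²`. -/
theorem IsSolution.unique {b : ℝ → ℝ} (hb : ContinuousOn b (Set.Ici 0))
    (hb0 : ∀ t, 0 ≤ t → 0 ≤ b t) {u₁ u₂ : L2 n} {u v : ℝ → L2 n}
    (hu : IsSolution b u₁ u₂ u) (hv : IsSolution b u₁ u₂ v) {t : ℝ} (ht : 0 ≤ t) :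
    u t = v t ∧ timeDeriv u t = timeDeriv v t := by
  set S := fMul (n := n) (fun η => (smoothing η : ℂ)) with hS
  set K := fMul (n := n) (fun η => ((freq η ^ 2 * smoothing η : ℝ) : ℂ)) with hK
  set R := fMul (n := n) (fun η => ((freq η * smoothing η : ℝ) : ℂ)) with hR
  set w : ℝ → L2 n := fun t => u t - v t with hw
  set w' : ℝ → L2 n := fun t => timeDeriv u t - timeDeriv v t with hw'
  have hwd : ∀ t, 0 ≤ t → HasDerivWithinAt w (w' t) (Set.Ici 0) t := fun t ht =>
    (hu.hasDerivWithinAt ht).sub (hv.hasDerivWithinAt ht)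
  have hSd : ∀ t, 0 ≤ t → HasDerivWithinAt (fun t => S (w' t))
      (-(K (w t)) - (b t : ℂ) • S (w' t)) (Set.Ici 0) t := fun t ht => by
    have := (hu.hasDerivWithinAt_smoothing hb ht).sub (hv.hasDerivWithinAt_smoothing hb ht)
    simp only [hw', hw, map_sub]
    refine this.congr_deriv ?_
    module
  have hRd : ∀ t, 0 ≤ t → HasDerivWithinAt (fun t => R (w t)) (R (w' t)) (Set.Ici 0) t :=
    fun t ht => (R.restrictScalars ℝ).hasFDerivAt.comp_hasDerivWithinAt t (hwd t ht)
  have hcross : ∀ x y : L2 n, inner ℂ (S x) (K y) = inner ℂ (R x) (R y) := by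
    intro x y
    rw [hS, hK, hR, inner_fMul memLp_smoothing, inner_fMul memLp_freq_smoothing]
    simp only [RCLike.star_def, Complex.conj_ofReal]
    rw [fMul_fMul memLp_smoothing memLp_freq_sq_smoothing,
      fMul_fMul memLp_freq_smoothing memLp_freq_smoothing]
    congr 1
    refine fMul_congr (Eventually.of_forall fun η => ?_) y
    push_cast
    ring
  have hcross' : ∀ x y : L2 n, inner ℂ (K y) (S x) = inner ℂ (R y) (R x) := fun x y => by
    rw [← inner_conj_symm, hcross, inner_conj_symm]
  have hanti : AntitoneOn (fun t => ‖S (w' t)‖ ^ 2 + ‖R (w t)‖ ^ 2) (Set.Ici 0) := by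
    refine antitoneOn_Ici_of_hasDerivWithinAt (f' := fun t => -(2 * b t * ‖S (w' t)‖ ^ 2))
      (fun t ht => ?_) fun t ht => ?_
    · have h1 := ((hSd t ht).inner ℂ (hSd t ht)).add ((hRd t ht).inner ℂ (hRd t ht))
      have h2 := Complex.reCLM.hasFDerivAt.comp_hasDerivWithinAt t h1
      have h3 : (Complex.reCLM ∘ fun t => inner ℂ (S (w' t)) (S (w' t)) +
          inner ℂ (R (w t)) (R (w t))) = fun t => ‖S (w' t)‖ ^ 2 + ‖R (w t)‖ ^ 2 := by
        ext t
        rw [← inner_self_eq_norm_sq (𝕜 := ℂ), ← inner_self_eq_norm_sq (𝕜 := ℂ)]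
        simp
      have h4 : HasDerivWithinAt (Complex.reCLM ∘ fun t => inner ℂ (S (w' t)) (S (w' t)) +
          inner ℂ (R (w t)) (R (w t))) _ (Set.Ici 0) t := h2
      rw [h3] at h4
      refine h4.congr_deriv ?_
      have e : ∀ x : L2 n, (inner ℂ x x : ℂ) = ((‖x‖ ^ 2 : ℝ) : ℂ) := fun x => by
        rw [inner_self_eq_norm_sq_to_K]
        norm_cast
      simp only [inner_sub_right, inner_sub_left, inner_neg_right, inner_neg_left, hcross,
        hcross', inner_smul_left, inner_smul_right, e, Complex.conj_ofReal, Complex.reCLM_apply]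
      have e2 : ((b t : ℂ) * ((‖S (w' t)‖ ^ 2 : ℝ) : ℂ)).re = b t * ‖S (w' t)‖ ^ 2 := by
        rw [← Complex.ofReal_mul, Complex.ofReal_re]
      simp only [Complex.add_re, Complex.sub_re, Complex.neg_re, e2]
      ring
    · have := mul_nonneg (hb0 t ht) (sq_nonneg ‖S (w' t)‖)
      linarith
  have hI : timeDeriv u 0 = timeDeriv v 0 := by
    have h1 := hu.initial_velocity.trans hv.initial_velocity.symm
    exact smul_right_injective _ (neg_ne_zero.2 Complex.I_ne_zero) h1
  have hw0 : w 0 = 0 := by simp only [hw, hu.initial_value, hv.initial_value, sub_self]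
  have hw'0 : w' 0 = 0 := by simp only [hw', hI, sub_self]
  -- Only the velocity is read off from the energy, by injectivity of `S`; `w` is then constant in
  -- time, and zero initially.
  have hzero : ∀ t, 0 ≤ t → w' t = 0 := by
    intro t ht
    have h1 : ‖S (w' t)‖ ^ 2 + ‖R (w t)‖ ^ 2 ≤ ‖S (w' 0)‖ ^ 2 + ‖R (w 0)‖ ^ 2 :=
      hanti Set.self_mem_Ici ht ht
    rw [hw0, hw'0, map_zero, map_zero] at h1
    have h2 : S (w' t) = 0 := by
      rw [← norm_eq_zero, ← sq_eq_zero_iff]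
      have := sq_nonneg ‖S (w' t)‖
      have := sq_nonneg ‖R (w t)‖
      simp only [norm_zero] at h1
      linarith
    refine fMul_injective memLp_smoothing (Eventually.of_forall fun η => ?_)
      (h2.trans (map_zero S).symm)
    exact_mod_cast (smoothing_pos η).ne'
  have h1 := eq_of_hasDerivWithinAt_zero (f := w)
    (fun t ht => by simpa only [hzero t ht] using hwd t ht) ht
  rw [hw0] at h1
  exact ⟨sub_eq_zero.1 h1, sub_eq_zero.1 (hzero t ht)⟩

end

section

variable {n : ℕ}

/-! ### Matrices of Fourier multipliers -/

theorem L2Pair.ext {f g : L2Pair n} (h₁ : f.fst = g.fst) (h₂ : f.snd = g.snd) : f = g :=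
  WithLp.ofLp_injective 2 (Prod.ext h₁ h₂)

/-- The Fourier multiplier with a matrix valued symbol. -/
def symMat (a b c d : EuclideanSpace ℝ (Fin n) → ℂ) : L2Pair n →L[ℂ] L2Pair n :=
  ((WithLp.prodContinuousLinearEquiv 2 ℂ (L2 n) (L2 n)).symm :
    L2 n × L2 n →L[ℂ] WithLp 2 (L2 n × L2 n)) ∘L
  ((fMul a ∘L WithLp.fstL 2 ℂ (L2 n) (L2 n) + fMul b ∘L WithLp.sndL 2 ℂ (L2 n) (L2 n)).prod
    (fMul c ∘L WithLp.fstL 2 ℂ (L2 n) (L2 n) + fMul d ∘L WithLp.sndL 2 ℂ (L2 n) (L2 n)))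

theorem symMat_fst (a b c d : EuclideanSpace ℝ (Fin n) → ℂ) (f : L2Pair n) :
    (symMat a b c d f).fst = fMul a f.fst + fMul b f.snd := rfl

theorem symMat_snd (a b c d : EuclideanSpace ℝ (Fin n) → ℂ) (f : L2Pair n) :
    (symMat a b c d f).snd = fMul c f.fst + fMul d f.snd := rfl

section Algebra

variable {a b c d a' b' c' d' : EuclideanSpace ℝ (Fin n) → ℂ}

theorem symMat_congr (ha : a =ᵐ[volume] a') (hb : b =ᵐ[volume] b') (hc : c =ᵐ[volume] c')
    (hd : d =ᵐ[volume] d') (f : L2Pair n) : symMat a b c d f = symMat a' b' c' d' f := by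
  refine L2Pair.ext ?_ ?_
  · rw [symMat_fst, symMat_fst, fMul_congr ha, fMul_congr hb]
  · rw [symMat_snd, symMat_snd, fMul_congr hc, fMul_congr hd]

theorem symMat_one (f : L2Pair n) :
    symMat (fun _ => 1) (fun _ => 0) (fun _ => 0) (fun _ => 1) f = f := by
  refine L2Pair.ext ?_ ?_
  · rw [symMat_fst, fMul_one, fMul_zero, add_zero]
  · rw [symMat_snd, fMul_one, fMul_zero, zero_add]

theorem symMat_symMat (ha : MemLp a ∞ volume) (hb : MemLp b ∞ volume) (hc : MemLp c ∞ volume)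
    (hd : MemLp d ∞ volume) (ha' : MemLp a' ∞ volume) (hb' : MemLp b' ∞ volume)
    (hc' : MemLp c' ∞ volume) (hd' : MemLp d' ∞ volume) (f : L2Pair n) :
    symMat a b c d (symMat a' b' c' d' f) =
      symMat (fun η => a η * a' η + b η * c' η) (fun η => a η * b' η + b η * d' η)
        (fun η => c η * a' η + d η * c' η) (fun η => c η * b' η + d η * d' η) f := by
  refine L2Pair.ext ?_ ?_
  · simp only [symMat_fst, symMat_snd, map_add]
    rw [← fMul_add (memLp_top_mul ha ha') (memLp_top_mul hb hc'),
      ← fMul_add (memLp_top_mul ha hb') (memLp_top_mul hb hd'), ← fMul_fMul ha ha',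
      ← fMul_fMul hb hc', ← fMul_fMul ha hb', ← fMul_fMul hb hd']
    abel
  · simp only [symMat_fst, symMat_snd, map_add]
    rw [← fMul_add (memLp_top_mul hc ha') (memLp_top_mul hd hc'),
      ← fMul_add (memLp_top_mul hc hb') (memLp_top_mul hd hd'), ← fMul_fMul hc ha',
      ← fMul_fMul hd hc', ← fMul_fMul hc hb', ← fMul_fMul hd hd']
    abel

theorem symMat_smul (ha : MemLp a ∞ volume) (hb : MemLp b ∞ volume) (hc : MemLp c ∞ volume)
    (hd : MemLp d ∞ volume) (z : ℂ) (f : L2Pair n) :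
    z • symMat a b c d f = symMat (fun η => z * a η) (fun η => z * b η) (fun η => z * c η)
      (fun η => z * d η) f := by
  refine L2Pair.ext ?_ ?_
  · rw [WithLp.smul_fst, symMat_fst, symMat_fst, smul_add, fMul_smul ha, fMul_smul hb]
  · rw [WithLp.smul_snd, symMat_snd, symMat_snd, smul_add, fMul_smul hc, fMul_smul hd]

theorem inner_symMat (ha : MemLp a ∞ volume) (hb : MemLp b ∞ volume) (hc : MemLp c ∞ volume)
    (hd : MemLp d ∞ volume) (f g : L2Pair n) :
    inner ℂ (symMat a b c d f) g = inner ℂ f (symMat (fun η => star (a η)) (fun η => star (c η))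
      (fun η => star (b η)) (fun η => star (d η)) g) := by
  simp only [WithLp.prod_inner_apply]
  change inner ℂ (symMat a b c d f).fst g.fst + inner ℂ (symMat a b c d f).snd g.snd =
    inner ℂ f.fst (symMat _ _ _ _ g).fst + inner ℂ f.snd (symMat _ _ _ _ g).snd
  simp only [symMat_fst, symMat_snd, inner_add_left, inner_add_right, inner_fMul ha,
    inner_fMul hb, inner_fMul hc, inner_fMul hd]
  ring

theorem tendsto_symMat {ι : Type*} {l : Filter ι} [l.IsCountablyGenerated]
    {a b c d : ι → EuclideanSpace ℝ (Fin n) → ℂ} {a' b' c' d' : EuclideanSpace ℝ (Fin n) → ℂ}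
    (ha : ∀ g : L2 n, Tendsto (fun i => fMul (a i) g) l (𝓝 (fMul a' g)))
    (hb : ∀ g : L2 n, Tendsto (fun i => fMul (b i) g) l (𝓝 (fMul b' g)))
    (hc : ∀ g : L2 n, Tendsto (fun i => fMul (c i) g) l (𝓝 (fMul c' g)))
    (hd : ∀ g : L2 n, Tendsto (fun i => fMul (d i) g) l (𝓝 (fMul d' g))) (f : L2Pair n) :
    Tendsto (fun i => symMat (a i) (b i) (c i) (d i) f) l (𝓝 (symMat a' b' c' d' f)) :=
  ((WithLp.prod_continuous_toLp 2 (L2 n) (L2 n)).tendsto _).comp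
    ((((ha f.fst).add (hb f.snd))).prodMk_nhds ((hc f.fst).add (hd f.snd)))

theorem symMat_diagonal_injective {m : EuclideanSpace ℝ (Fin n) → ℂ} (h : MemLp m ∞ volume)
    (hm : ∀ᵐ η, m η ≠ 0) :
    Function.Injective (symMat m (fun _ => 0) (fun _ => 0) m : L2Pair n → L2Pair n) := by
  intro f g hfg
  have h1 := congrArg WithLp.fst hfg
  have h2 := congrArg WithLp.snd hfg
  simp only [symMat_fst, symMat_snd, fMul_zero, add_zero, zero_add] at h1 h2
  exact L2Pair.ext (fMul_injective h hm h1) (fMul_injective h hm h2)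

theorem symMat_diagonal_denseRange {m m' : EuclideanSpace ℝ (Fin n) → ℂ} (h : MemLp m ∞ volume)
    (hm : ∀ᵐ η, m η ≠ 0) (h' : MemLp m' ∞ volume) (hm' : ∀ᵐ η, m' η ≠ 0) :
    DenseRange (symMat m (fun _ => 0) (fun _ => 0) m' : L2Pair n → L2Pair n) := by
  have h1 : DenseRange fun x : L2 n × L2 n =>
      WithLp.toLp 2 (Prod.map (fMul m) (fMul m') x) :=
    ((WithLp.toLp_surjective 2).denseRange).comp
      ((fMul_denseRange h hm).prodMap (fMul_denseRange h' hm'))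
      (WithLp.prod_continuous_toLp 2 (L2 n) (L2 n))
  refine h1.mono ?_
  rintro _ ⟨x, rfl⟩
  refine ⟨WithLp.toLp 2 x, L2Pair.ext ?_ ?_⟩
  · rw [symMat_fst, fMul_zero, add_zero]
    rfl
  · rw [symMat_snd, fMul_zero, zero_add]
    rfl

/-- Multiplying from the left by the adjugate matrix gives the determinant times the identity, an
injective diagonal multiplier. -/
theorem symMat_injective (ha : MemLp a ∞ volume) (hb : MemLp b ∞ volume) (hc : MemLp c ∞ volume)
    (hd : MemLp d ∞ volume) (h : ∀ᵐ η, a η * d η - b η * c η ≠ 0) :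
    Function.Injective (symMat a b c d) := by
  have hdet : MemLp (fun η => a η * d η - b η * c η) ∞ volume :=
    (memLp_top_mul ha hd).sub (memLp_top_mul hb hc)
  have hb' : MemLp (fun η => -b η) ∞ volume := hb.neg
  have hc' : MemLp (fun η => -c η) ∞ volume := hc.neg
  refine Function.Injective.of_comp (f := symMat d (fun η => -b η) (fun η => -c η) a) ?_
  convert symMat_diagonal_injective hdet h using 1
  ext1 f
  rw [Function.comp_apply, symMat_symMat hd hb' hc' ha ha hb hc hd]
  refine symMat_congr ?_ ?_ ?_ ?_ f <;> refine Eventually.of_forall fun η => ?_ <;>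
    dsimp only <;> ring

/-- With the adjugate on the right instead, the range contains that of the determinant times the
identity, which is dense. -/
theorem symMat_denseRange (ha : MemLp a ∞ volume) (hb : MemLp b ∞ volume) (hc : MemLp c ∞ volume)
    (hd : MemLp d ∞ volume) (h : ∀ᵐ η, a η * d η - b η * c η ≠ 0) :
    DenseRange (symMat a b c d) := by
  have hdet : MemLp (fun η => a η * d η - b η * c η) ∞ volume :=
    (memLp_top_mul ha hd).sub (memLp_top_mul hb hc)
  have hb' : MemLp (fun η => -b η) ∞ volume := hb.neg
  have hc' : MemLp (fun η => -c η) ∞ volume := hc.neg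
  refine (symMat_diagonal_denseRange hdet h hdet h).mono ?_
  rintro _ ⟨f, rfl⟩
  refine ⟨symMat d (fun η => -b η) (fun η => -c η) a f, ?_⟩
  rw [symMat_symMat ha hb hc hd hd hb' hc' ha]
  refine symMat_congr ?_ ?_ ?_ ?_ f <;> refine Eventually.of_forall fun η => ?_ <;>
    dsimp only <;> ring

theorem symMat_translatePair (ha : MemLp a ∞ volume) (hb : MemLp b ∞ volume)
    (hc : MemLp c ∞ volume) (hd : MemLp d ∞ volume) (x : EuclideanSpace ℝ (Fin n))
    (f : L2Pair n) :
    symMat a b c d (translatePair x f) = translatePair x (symMat a b c d f) := by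
  refine L2Pair.ext ?_ ?_
  · change fMul a (translate x f.fst) + fMul b (translate x f.snd)
      = translate x (fMul a f.fst + fMul b f.snd)
    rw [translate_add, translate_fMul ha, translate_fMul hb]
  · change fMul c (translate x f.fst) + fMul d (translate x f.snd)
      = translate x (fMul c f.fst + fMul d f.snd)
    rw [translate_add, translate_fMul hc, translate_fMul hd]

end Algebra

/-- The pointwise limit of a bounded family of symbols gives the strong limit of the multipliers. -/
theorem exists_symbol_limit {q : ℝ≥0 → EuclideanSpace ℝ (Fin n) → ℂ} {C : ℝ}
    (hq : ∀ t, AEStronglyMeasurable (q t) volume) (hC : ∀ t η, ‖q t η‖ ≤ C)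
    (hl : ∀ᵐ η, ∃ z, Tendsto (fun t => q t η) atTop (𝓝 z)) :
    ∃ q₀ : EuclideanSpace ℝ (Fin n) → ℂ, MemLp q₀ ∞ volume ∧
      (∀ᵐ η, Tendsto (fun t => q t η) atTop (𝓝 (q₀ η))) ∧
      ∀ f : L2 n, Tendsto (fun t => fMul (q t) f) atTop (𝓝 (fMul q₀ f)) := by
  set q₀ : EuclideanSpace ℝ (Fin n) → ℂ := fun η => limUnder atTop fun t => q t η
  have h1 : ∀ᵐ η, Tendsto (fun t => q t η) atTop (𝓝 (q₀ η)) := by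
    filter_upwards [hl] with η h using tendsto_nhds_limUnder h
  have h2 : MemLp q₀ ∞ volume := by
    refine memLp_top_of_bound (aestronglyMeasurable_of_tendsto_ae atTop hq h1) C ?_
    filter_upwards [h1] with η h
    exact le_of_tendsto h.norm (Eventually.of_forall fun t => hC t η)
  exact ⟨q₀, h2, h1, tendsto_fMul (Eventually.of_forall fun t =>
    memLp_top_of_bound (hq t) C (Eventually.of_forall (hC t))) h2 C
    (Eventually.of_forall fun t => Eventually.of_forall (hC t)) h1⟩

theorem ae_freq_pos (hn : 1 ≤ n) : ∀ᵐ η : EuclideanSpace ℝ (Fin n), 0 < freq η := by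
  have : Nonempty (Fin n) := ⟨⟨0, hn⟩⟩
  filter_upwards [compl_mem_ae_iff.2
    (measure_singleton (μ := (volume : Measure (EuclideanSpace ℝ (Fin n)))) 0)] with η hη
  rw [freq_eq]
  have : 0 < ‖η‖ := norm_pos_iff.2 hη
  positivity

/-! ### The symbols of the fundamental solutions -/

theorem isSymbolMode_of_isModeSolution {b : ℝ → ℝ} {y y' : ℝ → ℝ → ℝ}
    (h : ∀ r, IsModeSolution b r (y r) (y' r)) (hm : ∀ t, 0 ≤ t → Measurable fun r => y r t)
    (hm' : ∀ t, 0 ≤ t → Measurable fun r => y' r t) {c : EuclideanSpace ℝ (Fin n) → ℂ}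
    (hc : AEStronglyMeasurable c volume) {C : ℝ}
    (hb : ∀ t, 0 ≤ t → ∀ η, ‖c η‖ * |y (freq η) t| * bracket η ≤ C * (1 + t))
    (hb' : ∀ t, 0 ≤ t → ∀ η, ‖c η‖ * |y' (freq η) t| ≤ C) :
    IsSymbolMode b (fun t η => c η * (y (freq η) t : ℂ)) (fun t η => c η * (y' (freq η) t : ℂ)) C
    where
  meas t ht := hc.mul (Complex.measurable_ofReal.comp
    ((hm t ht).comp continuous_freq.measurable)).aestronglyMeasurable
  meas' t ht := hc.mul (Complex.measurable_ofReal.comp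
    ((hm' t ht).comp continuous_freq.measurable)).aestronglyMeasurable
  hasDeriv η t ht := ((h (freq η)).hasDeriv t ht).ofReal_comp.const_mul (c η)
  hasDeriv' η t ht := by
    refine (((h (freq η)).hasDeriv' t ht).ofReal_comp.const_mul (c η)).congr_deriv ?_
    push_cast
    ring
  bound t ht η := by
    rw [norm_mul, Complex.norm_real]
    exact hb t ht η
  bound' t ht η := by
    rw [norm_mul, Complex.norm_real]
    exact hb' t ht η

/-- The symbol `y / ⟨ξ⟩`. -/
def symbolOne (y : ℝ → ℝ → ℝ) (t : ℝ) (η : EuclideanSpace ℝ (Fin n)) : ℂ :=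
  ((bracket η)⁻¹ : ℝ) * (y (freq η) t : ℂ)

/-- The symbol `i y`. -/
def symbolTwo (y : ℝ → ℝ → ℝ) (t : ℝ) (η : EuclideanSpace ℝ (Fin n)) : ℂ :=
  Complex.I * (y (freq η) t : ℂ)

namespace IsFundamental

variable {b : ℝ → ℝ} {y₁ y₁' y₂ y₂' : ℝ → ℝ → ℝ}

theorem abs_deriv_one_le (F : IsFundamental b y₁ y₁' y₂ y₂') (hb : ∀ t, 0 ≤ t → 0 ≤ b t)
    {r t : ℝ} (hr : 0 ≤ r) (ht : 0 ≤ t) : |y₁' r t| ≤ r := by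
  have h1 := (F.sol₁ r).energy_le hb ht
  rw [F.init₁, F.init₁'] at h1
  refine abs_le_of_sq_le_sq ?_ hr
  nlinarith [mul_nonneg (sq_nonneg r) (sq_nonneg (y₁ r t))]

theorem abs_one_le (F : IsFundamental b y₁ y₁' y₂ y₂') (hb : ∀ t, 0 ≤ t → 0 ≤ b t)
    {r t : ℝ} (hr : 0 ≤ r) (ht : 0 ≤ t) : |y₁ r t| ≤ 1 := by
  rcases hr.eq_or_lt with rfl | hr
  -- At `r = 0` the energy does not control `y₁`; there `|y₁'| ≤ r` forces it to be constant.
  · have h0 : ∀ t, 0 ≤ t → y₁' 0 t = 0 := fun t ht =>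
      abs_nonpos_iff.1 (F.abs_deriv_one_le hb le_rfl ht)
    have h1 := eq_of_hasDerivWithinAt_zero (f := y₁ 0)
      (fun t ht => by simpa only [h0 t ht] using (F.sol₁ 0).hasDeriv t ht) ht
    rw [h1, F.init₁, abs_one]
  · have h1 := (F.sol₁ r).energy_le hb ht
    rw [F.init₁, F.init₁'] at h1
    refine abs_le_of_sq_le_sq ?_ zero_le_one
    refine le_of_mul_le_mul_left ?_ (by positivity : 0 < r ^ 2)
    nlinarith [sq_nonneg (y₁' r t)]

theorem abs_deriv_two_le (F : IsFundamental b y₁ y₁' y₂ y₂') (hb : ∀ t, 0 ≤ t → 0 ≤ b t)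
    {r t : ℝ} (ht : 0 ≤ t) : |y₂' r t| ≤ 1 := by
  have h1 := (F.sol₂ r).energy_le hb ht
  rw [F.init₂, F.init₂'] at h1
  refine abs_le_of_sq_le_sq ?_ zero_le_one
  nlinarith [mul_nonneg (sq_nonneg r) (sq_nonneg (y₂ r t))]

theorem abs_two_le (F : IsFundamental b y₁ y₁' y₂ y₂') (hb : ∀ t, 0 ≤ t → 0 ≤ b t)
    {r t : ℝ} (ht : 0 ≤ t) : |y₂ r t| ≤ t := by
  have h1 := Convex.norm_image_sub_le_of_norm_hasDerivWithin_le (f := y₂ r) (f' := y₂' r)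
    (s := Set.Ici 0) (C := 1) (fun x hx => (F.sol₂ r).hasDeriv x hx)
    (fun x hx => F.abs_deriv_two_le hb hx) (convex_Ici 0) (x := 0) (y := t) Set.self_mem_Ici ht
  rw [F.init₂, sub_zero, sub_zero, one_mul, Real.norm_eq_abs, Real.norm_of_nonneg ht] at h1
  exact h1

theorem mul_abs_two_le (F : IsFundamental b y₁ y₁' y₂ y₂') (hb : ∀ t, 0 ≤ t → 0 ≤ b t)
    {r t : ℝ} (hr : 0 ≤ r) (ht : 0 ≤ t) : r * |y₂ r t| ≤ 1 := by
  have h1 := (F.sol₂ r).energy_le hb ht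
  rw [F.init₂, F.init₂'] at h1
  rw [← abs_of_nonneg hr, ← abs_mul, abs_of_nonneg hr]
  refine abs_le_of_sq_le_sq ?_ zero_le_one
  nlinarith [sq_nonneg (y₂' r t)]

theorem isSymbolMode_one (F : IsFundamental b y₁ y₁' y₂ y₂') (hb : ∀ t, 0 ≤ t → 0 ≤ b t) :
    IsSymbolMode b (symbolOne (n := n) y₁) (symbolOne y₁') 1 := by
  have hnorm : ∀ η : EuclideanSpace ℝ (Fin n), ‖(((bracket η)⁻¹ : ℝ) : ℂ)‖ = (bracket η)⁻¹ :=
    fun η => by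
      rw [Complex.norm_real, Real.norm_of_nonneg (inv_nonneg.2 (bracket_pos η).le)]
  refine isSymbolMode_of_isModeSolution F.sol₁ F.meas₁ F.meas₁' ?_ (fun t ht η => ?_)
    fun t ht η => ?_
  · exact (Complex.continuous_ofReal.comp
      (continuous_bracket.inv₀ fun η => (bracket_pos η).ne')).aestronglyMeasurable
  · have h1 := F.abs_one_le hb (freq_nonneg η) ht
    have h2 := (bracket_pos η).ne'
    rw [hnorm]
    field_simp
    linarith
  · rw [hnorm, inv_mul_le_iff₀ (bracket_pos η), mul_one]
    exact (F.abs_deriv_one_le hb (freq_nonneg η) ht).trans (freq_le_bracket η)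

/-- For small frequencies only `|y₂| ≤ t` is available, for large ones `r |y₂| ≤ 1`; with `⟨ξ⟩ ≤ 1 +
r` they add up to `1 + t`. -/
theorem isSymbolMode_two (F : IsFundamental b y₁ y₁' y₂ y₂') (hb : ∀ t, 0 ≤ t → 0 ≤ b t) :
    IsSymbolMode b (symbolTwo (n := n) y₂) (symbolTwo y₂') 1 := by
  refine isSymbolMode_of_isModeSolution (c := fun _ => Complex.I) F.sol₂ F.meas₂ F.meas₂'
    aestronglyMeasurable_const (fun t ht η => ?_) fun t ht η => ?_
  · rw [Complex.norm_I, one_mul, one_mul]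
    have h1 := F.abs_two_le hb (r := freq η) ht
    have h2 := F.mul_abs_two_le hb (freq_nonneg η) ht
    have h3 := mul_le_mul_of_nonneg_left (bracket_le η) (abs_nonneg (y₂ (freq η) t))
    linarith
  · rw [Complex.norm_I, one_mul]
    exact F.abs_deriv_two_le hb ht

end IsFundamental

/-! ### The solution operator -/

theorem eq_fMul_of_isMultiplier_bracket {u h : L2 n} (hu : IsMultiplier bracketSymbol u h) :
    u = fMul (fun η => (((bracket η)⁻¹ : ℝ) : ℂ)) h := by
  refine eq_fMul_of_fourier (memLp_ofReal (C := 1) ?_ fun η => ?_) ?_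
  · exact (continuous_bracket.inv₀ fun η => (bracket_pos η).ne').measurable
  · rw [abs_of_pos (inv_pos.2 (bracket_pos η))]
    exact inv_le_one_of_one_le₀ (one_le_bracket η)
  · filter_upwards [hu] with η hη
    have h1 : (bracketSymbol ((2 * Real.pi) • η) : ℂ) = (bracket η : ℂ) := rfl
    have h2 : (bracket η : ℂ) ≠ 0 := by exact_mod_cast (bracket_pos η).ne'
    rw [hη, h1, Complex.ofReal_inv, inv_mul_cancel_left₀ h2]

theorem isMultiplier_bracket_inv (h : L2 n) :
    IsMultiplier bracketSymbol (fMul (fun η => (((bracket η)⁻¹ : ℝ) : ℂ)) h) h := by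
  have hm : MemLp (fun η : EuclideanSpace ℝ (Fin n) => (((bracket η)⁻¹ : ℝ) : ℂ)) ∞ volume := by
    refine memLp_ofReal (C := 1) ?_ fun η => ?_
    · exact (continuous_bracket.inv₀ fun η => (bracket_pos η).ne').measurable
    · rw [abs_of_pos (inv_pos.2 (bracket_pos η))]
      exact inv_le_one_of_one_le₀ (one_le_bracket η)
  unfold IsMultiplier
  filter_upwards [fourier_fMul hm h] with η hη
  have h1 : (bracketSymbol ((2 * Real.pi) • η) : ℂ) = (bracket η : ℂ) := rfl
  have h2 : (bracket η : ℂ) ≠ 0 := by exact_mod_cast (bracket_pos η).ne'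
  rw [hη, h1, Complex.ofReal_inv, mul_inv_cancel_left₀ h2]

/-- The operator `(⟨D⟩ u₁, u₂) ↦ (|D| u(t), Dₜ u(t))`, in terms of fundamental solutions. -/
def energyOp (n : ℕ) (y₁ y₁' y₂ y₂' : ℝ → ℝ → ℝ) (t : ℝ) : L2Pair n →L[ℂ] L2Pair n :=
  symMat (fun η => (freq η : ℂ) * symbolOne y₁ t η) (fun η => (freq η : ℂ) * symbolTwo y₂ t η)
    (fun η => -Complex.I * symbolOne y₁' t η) (fun η => -Complex.I * symbolTwo y₂' t η)

/-- The data are `⟨D⟩ u₁` and `u₂ = -i ∂ₜ u(0)`, hence the symbols `y₁ / ⟨ξ⟩` and `i y₂`. They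
provide one solution, and uniqueness carries the formula over to every solution. -/
theorem IsFundamental.energyOp_spec {b : ℝ → ℝ} {y₁ y₁' y₂ y₂' : ℝ → ℝ → ℝ}
    (F : IsFundamental b y₁ y₁' y₂ y₂') (hc : ContinuousOn b (Set.Ici 0))
    (hb : ∀ t, 0 ≤ t → 0 ≤ b t) {u₁ u₂ : L2 n} {d : L2Pair n}
    (hu₁ : IsMultiplier bracketSymbol u₁ d.fst) (hu₂ : d.snd = u₂) :
    (∃ u : ℝ → L2 n, IsSolution b u₁ u₂ u) ∧
    ∀ u : ℝ → L2 n, IsSolution b u₁ u₂ u → ∀ t : ℝ, 0 ≤ t →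
      IsEnergyState u t (energyOp n y₁ y₁' y₂ y₂' t d) := by
  have H₁ := F.isSymbolMode_one (n := n) hb
  have H₂ := F.isSymbolMode_two (n := n) hb
  obtain ⟨hs, htd⟩ := isSolution_of_isSymbolMode hc H₁ H₂ d.fst d.snd
  have e1 : fMul (symbolOne y₁ 0) d.fst + fMul (symbolTwo y₂ 0) d.snd = u₁ := by
    rw [eq_fMul_of_isMultiplier_bracket hu₁,
      fMul_congr (m₂ := fun _ => 0) (Eventually.of_forall fun η => by
        simp [symbolTwo, F.init₂]) d.snd, fMul_zero, add_zero]
    exact fMul_congr (Eventually.of_forall fun η => by simp [symbolOne, F.init₁]) _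
  have e2 : (-Complex.I) • (fMul (symbolOne y₁' 0) d.fst + fMul (symbolTwo y₂' 0) d.snd) = u₂ := by
    rw [fMul_congr (m₂ := fun _ => 0) (Eventually.of_forall fun η => by
      simp [symbolOne, F.init₁']) d.fst, fMul_zero, zero_add, fMul_smul (H₂.memLp' le_rfl),
      fMul_congr (m₂ := fun _ => 1) (Eventually.of_forall fun η => by
      simp [symbolTwo, F.init₂']) d.snd, fMul_one, hu₂]
  rw [e1, e2] at hs
  refine ⟨⟨_, hs⟩, fun u hu t ht => ?_⟩
  obtain ⟨h1, h2⟩ := hu.unique hc hb hs ht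
  refine ⟨?_, ?_⟩
  · rw [h1]
    exact (H₁.isMultiplier_abs d.fst ht).add (H₂.isMultiplier_abs d.snd ht)
  · rw [Dt, h2, htd t ht, smul_add, fMul_smul (H₁.memLp' ht), fMul_smul (H₂.memLp' ht)]
    rfl

theorem isEnergyState_unique {u : ℝ → L2 n} {t : ℝ} {e e' : L2Pair n}
    (h : IsEnergyState u t e) (h' : IsEnergyState u t e') : e = e' :=
  L2Pair.ext (isMultiplier_unique h.1 h'.1) (h.2.symm.trans h'.2)

theorem IsEnergyOperator.unique {b : ℝ → ℝ} {E E' : ℝ≥0 → (L2Pair n →L[ℂ] L2Pair n)}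
    (hE : IsEnergyOperator b E) (hE' : IsEnergyOperator b E') : E = E' := by
  funext t
  ext1 d
  have hd := isMultiplier_bracket_inv d.fst
  obtain ⟨u, hu⟩ := (hE _ _ d hd rfl).1
  exact isEnergyState_unique ((hE _ _ d hd rfl).2 u hu t) ((hE' _ _ d hd rfl).2 u hu t)

end

section

variable {n : ℕ}

theorem IsFundamental.isEnergyOperator {b : ℝ → ℝ} {y₁ y₁' y₂ y₂' : ℝ → ℝ → ℝ}
    (F : IsFundamental b y₁ y₁' y₂ y₂') (hc : ContinuousOn b (Set.Ici 0))
    (hb : ∀ t, 0 ≤ t → 0 ≤ b t) :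
    IsEnergyOperator b fun t : ℝ≥0 => energyOp n y₁ y₁' y₂ y₂' t := fun _ _ _ h₁ h₂ =>
  ⟨(F.energyOp_spec hc hb h₁ h₂).1, fun u hu t => (F.energyOp_spec hc hb h₁ h₂).2 u hu t t.2⟩

/-! ### Free waves -/

/-- The symbol `cos (t |ξ|)`. -/
def cosSymbol (t : ℝ) (η : EuclideanSpace ℝ (Fin n)) : ℂ := (Real.cos (freq η * t) : ℂ)

/-- The symbol `i sin (t |ξ|)`. -/
def sinSymbol (t : ℝ) (η : EuclideanSpace ℝ (Fin n)) : ℂ :=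
  Complex.I * (Real.sin (freq η * t) : ℂ)

theorem memLp_cosSymbol (t : ℝ) : MemLp (cosSymbol (n := n) t) ∞ volume :=
  memLp_ofReal (C := 1) (by have := continuous_freq (n := n); fun_prop) fun η =>
    Real.abs_cos_le_one _

theorem memLp_sinSymbol (t : ℝ) : MemLp (sinSymbol (n := n) t) ∞ volume :=
  (memLp_ofReal (C := 1) (by have := continuous_freq (n := n); fun_prop) fun η =>
    Real.abs_sin_le_one _).const_mul _

theorem memLp_neg_sinSymbol (t : ℝ) :
    MemLp (fun η : EuclideanSpace ℝ (Fin n) => -sinSymbol t η) ∞ volume :=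
  (memLp_sinSymbol t).neg

theorem cosSymbol_sq_sub (t : ℝ) (η : EuclideanSpace ℝ (Fin n)) :
    cosSymbol t η * cosSymbol t η - sinSymbol t η * sinSymbol t η = 1 := by
  have h : ((Real.cos (freq η * t) : ℂ)) ^ 2 + ((Real.sin (freq η * t) : ℂ)) ^ 2 = 1 := by
    exact_mod_cast Real.cos_sq_add_sin_sq (freq η * t)
  simp only [cosSymbol, sinSymbol]
  linear_combination h - (Real.sin (freq η * t) : ℂ) ^ 2 * Complex.I_sq

theorem freeOp_left_inv (t : ℝ) (f : L2Pair n) :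
    symMat (cosSymbol t) (fun η => -sinSymbol t η) (fun η => -sinSymbol t η) (cosSymbol t)
      (symMat (cosSymbol t) (sinSymbol t) (sinSymbol t) (cosSymbol t) f) = f := by
  rw [symMat_symMat (memLp_cosSymbol t) (memLp_neg_sinSymbol t) (memLp_neg_sinSymbol t)
    (memLp_cosSymbol t) (memLp_cosSymbol t) (memLp_sinSymbol t) (memLp_sinSymbol t)
    (memLp_cosSymbol t)]
  conv_rhs => rw [← symMat_one f]
  refine symMat_congr ?_ ?_ ?_ ?_ f <;> refine Eventually.of_forall fun η => ?_ <;> dsimp only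
  · linear_combination cosSymbol_sq_sub t η
  · ring
  · ring
  · linear_combination cosSymbol_sq_sub t η

theorem freeOp_right_inv (t : ℝ) (f : L2Pair n) :
    symMat (cosSymbol t) (sinSymbol t) (sinSymbol t) (cosSymbol t)
      (symMat (cosSymbol t) (fun η => -sinSymbol t η) (fun η => -sinSymbol t η) (cosSymbol t) f)
      = f := by
  rw [symMat_symMat (memLp_cosSymbol t) (memLp_sinSymbol t) (memLp_sinSymbol t)
    (memLp_cosSymbol t) (memLp_cosSymbol t) (memLp_neg_sinSymbol t) (memLp_neg_sinSymbol t)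
    (memLp_cosSymbol t)]
  conv_rhs => rw [← symMat_one f]
  refine symMat_congr ?_ ?_ ?_ ?_ f <;> refine Eventually.of_forall fun η => ?_ <;> dsimp only
  · linear_combination cosSymbol_sq_sub t η
  · ring
  · ring
  · linear_combination cosSymbol_sq_sub t η

/-- The unitary propagator of free waves. -/
def freeOp (n : ℕ) (t : ℝ) : L2Pair n ≃ₗᵢ[ℂ] L2Pair n where
  toLinearEquiv := (ContinuousLinearEquiv.equivOfInverse
    (symMat (cosSymbol t) (sinSymbol t) (sinSymbol t) (cosSymbol t))
    (symMat (cosSymbol t) (fun η => -sinSymbol t η) (fun η => -sinSymbol t η) (cosSymbol t))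
    (freeOp_left_inv t) (freeOp_right_inv t)).toLinearEquiv
  norm_map' f := by
    change ‖symMat (cosSymbol t) (sinSymbol t) (sinSymbol t) (cosSymbol t) f‖ = ‖f‖
    -- The conjugate of `i sin` is `-i sin`, so the adjoint matrix is the inverse one.
    have h1 : inner ℂ (symMat (cosSymbol t) (sinSymbol t) (sinSymbol t) (cosSymbol t) f)
        (symMat (cosSymbol t) (sinSymbol t) (sinSymbol t) (cosSymbol t) f) = inner ℂ f f := by
      rw [inner_symMat (memLp_cosSymbol t) (memLp_sinSymbol t) (memLp_sinSymbol t)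
        (memLp_cosSymbol t)]
      congr 1
      conv_rhs => rw [← freeOp_left_inv t f]
      refine symMat_congr ?_ ?_ ?_ ?_ _ <;> refine Eventually.of_forall fun η => ?_ <;>
        simp [cosSymbol, sinSymbol, -Complex.ofReal_cos, -Complex.ofReal_sin]
    rw [inner_self_eq_norm_sq_to_K, inner_self_eq_norm_sq_to_K] at h1
    have h2 : ‖symMat (cosSymbol t) (sinSymbol t) (sinSymbol t) (cosSymbol t) f‖ ^ 2 = ‖f‖ ^ 2 := by
      exact_mod_cast h1
    exact (sq_eq_sq₀ (norm_nonneg _) (norm_nonneg _)).1 h2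

theorem freeOp_apply (t : ℝ) (f : L2Pair n) :
    freeOp n t f = symMat (cosSymbol t) (sinSymbol t) (sinSymbol t) (cosSymbol t) f := rfl

theorem freeOp_symm_apply (t : ℝ) (f : L2Pair n) : (freeOp n t).symm f =
    symMat (cosSymbol t) (fun η => -sinSymbol t η) (fun η => -sinSymbol t η) (cosSymbol t) f := rfl

/-- The symbol `|ξ| / ⟨ξ⟩`. -/
def freqRatio (η : EuclideanSpace ℝ (Fin n)) : ℂ := ((freq η * (bracket η)⁻¹ : ℝ) : ℂ)

theorem memLp_freqRatio : MemLp (freqRatio (n := n)) ∞ volume := by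
  refine memLp_ofReal (C := 1) ?_ fun η => ?_
  · exact (continuous_freq.mul
      (continuous_bracket.inv₀ fun η => (bracket_pos η).ne')).measurable
  · rw [abs_of_nonneg (mul_nonneg (freq_nonneg η) (inv_pos.2 (bracket_pos η)).le),
      ← div_eq_mul_inv, div_le_one (bracket_pos η)]
    exact freq_le_bracket η

theorem ae_freqRatio_ne_zero (hn : 1 ≤ n) :
    ∀ᵐ η : EuclideanSpace ℝ (Fin n), freqRatio η ≠ 0 := by
  filter_upwards [ae_freq_pos hn] with η hη
  have := bracket_pos η
  have h : freq η * (bracket η)⁻¹ ≠ 0 := by positivity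
  exact Complex.ofReal_ne_zero.2 h

/-- In terms of `h = ⟨D⟩ u₁` the initial energy state is `(|D| ⟨D⟩⁻¹ h, u₂)`. For the explicit free
modes, the energy operator factors as the rotation `freeOp` applied to this state. -/
theorem freeWave_spec {u₁ u₂ h : L2 n} (hu : IsMultiplier bracketSymbol u₁ h) :
    (∃ u : ℝ → L2 n, IsSolution (fun _ => 0) u₁ u₂ u) ∧
    ∀ u : ℝ → L2 n, IsSolution (fun _ => 0) u₁ u₂ u →
      IsEnergyState u 0 (WithLp.toLp 2 (fMul freqRatio h, u₂)) ∧
      ∀ t : ℝ, 0 ≤ t →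
        IsEnergyState u t (freeOp n t (WithLp.toLp 2 (fMul freqRatio h, u₂))) := by
  have hs := isFundamental_free.energyOp_spec continuousOn_const (fun _ _ => le_rfl)
    (d := WithLp.toLp 2 (h, u₂)) hu rfl
  have key : ∀ u : ℝ → L2 n, IsSolution (fun _ => 0) u₁ u₂ u → ∀ t : ℝ, 0 ≤ t →
      IsEnergyState u t (freeOp n t (WithLp.toLp 2 (fMul freqRatio h, u₂))) := by
    intro u hsol t ht
    convert hs.2 u hsol t ht using 1
    rw [freeOp_apply]
    refine L2Pair.ext ?_ ?_
    · rw [energyOp, symMat_fst, symMat_fst]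
      change fMul _ (fMul freqRatio h) + fMul _ u₂ = fMul _ h + fMul _ u₂
      rw [fMul_fMul (memLp_cosSymbol t) memLp_freqRatio]
      congr 1
      · refine fMul_congr (Eventually.of_forall fun η => ?_) h
        simp only [cosSymbol, freqRatio, symbolOne]
        push_cast
        ring
      · refine fMul_congr (Eventually.of_forall fun η => ?_) u₂
        simp only [sinSymbol, symbolTwo]
        -- At frequency zero both symbols vanish, whatever value `y₂` has there.
        split_ifs with h0
        · simp [h0]
        · have : (freq η : ℂ) ≠ 0 := by exact_mod_cast h0
          push_cast
          field_simp
    · rw [energyOp, symMat_snd, symMat_snd]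
      change fMul _ (fMul freqRatio h) + fMul _ u₂ = fMul _ h + fMul _ u₂
      rw [fMul_fMul (memLp_sinSymbol t) memLp_freqRatio]
      congr 1
      · refine fMul_congr (Eventually.of_forall fun η => ?_) h
        simp only [sinSymbol, freqRatio, symbolOne]
        push_cast
        ring
      · refine fMul_congr (Eventually.of_forall fun η => ?_) u₂
        simp only [cosSymbol, symbolTwo]
        linear_combination (Real.cos (freq η * t) : ℂ) * Complex.I_sq
  refine ⟨hs.1, fun u hsol => ⟨?_, key u hsol⟩⟩
  have h0 := key u hsol 0 le_rfl
  have h1 : freeOp n 0 (WithLp.toLp 2 (fMul freqRatio h, u₂))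
      = WithLp.toLp 2 (fMul freqRatio h, u₂) := by
    rw [freeOp_apply]
    conv_rhs => rw [← symMat_one (WithLp.toLp 2 (fMul freqRatio h, u₂))]
    refine symMat_congr ?_ ?_ ?_ ?_ _ <;> refine Eventually.of_forall fun η => ?_ <;>
      simp [cosSymbol, sinSymbol]
  rwa [h1] at h0

theorem isFreePropagator_freeOp : IsFreePropagator fun t : ℝ≥0 => freeOp n t := by
  intro u₁ u₂ h hu
  refine ⟨(freeWave_spec hu).1, fun u hs t d e hd he => ?_⟩
  obtain ⟨h0, ht⟩ := (freeWave_spec hu).2 u hs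
  rw [isEnergyState_unique hd h0]
  exact isEnergyState_unique (ht t t.2) he

/-- The defining property fixes the propagator only on states `(|D| u₁, u₂)` of finite energy data.
They form the range of the diagonal multiplier `(|ξ| / ⟨ξ⟩, 1)`, which is dense because the origin
is a null set for `n ≥ 1`. -/
theorem IsFreePropagator.unique (hn : 1 ≤ n) {E₀ E₀' : ℝ≥0 → (L2Pair n ≃ₗᵢ[ℂ] L2Pair n)}
    (hE : IsFreePropagator E₀) (hE' : IsFreePropagator E₀') : E₀ = E₀' := by
  funext t
  refine LinearIsometryEquiv.ext fun d => ?_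
  have hone : MemLp (fun _ : EuclideanSpace ℝ (Fin n) => (1 : ℂ)) ∞ volume := memLp_top_const 1
  refine congrFun (DenseRange.equalizer (symMat_diagonal_denseRange memLp_freqRatio
    (ae_freqRatio_ne_zero hn) hone (Eventually.of_forall fun _ => one_ne_zero))
    (E₀ t).continuous (E₀' t).continuous (funext fun f => ?_)) d
  have hf := isMultiplier_bracket_inv f.fst
  obtain ⟨⟨u, hu⟩, hs⟩ := freeWave_spec (u₂ := f.snd) hf
  obtain ⟨h0, ht⟩ := hs u hu
  have hd : symMat freqRatio (fun _ => 0) (fun _ => 0) (fun _ => 1) f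
      = WithLp.toLp 2 (fMul freqRatio f.fst, f.snd) := by
    refine L2Pair.ext ?_ ?_
    · rw [symMat_fst, fMul_zero, add_zero]
      rfl
    · rw [symMat_snd, fMul_zero, zero_add, fMul_one]
      rfl
  simp only [Function.comp_apply, hd]
  rw [(hE _ _ _ hf).2 u hu t _ _ h0 (ht t t.2), (hE' _ _ _ hf).2 u hu t _ _ h0 (ht t t.2)]

/-! ### The wave operator -/

/-- The first row of the symbol of `λ(t) E₀(t)⁻¹ E(t)`, for a mode `p` with derivative `p'`. -/
def rowOne (b : ℝ → ℝ) (p p' : ℝ → EuclideanSpace ℝ (Fin n) → ℂ) (t : ℝ)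
    (η : EuclideanSpace ℝ (Fin n)) : ℂ :=
  dampingFactor b t * (cosSymbol t η * (freq η * p t η) + -sinSymbol t η * (-Complex.I * p' t η))

/-- The second row of the symbol of `λ(t) E₀(t)⁻¹ E(t)`, for a mode `p` with derivative `p'`. -/
def rowTwo (b : ℝ → ℝ) (p p' : ℝ → EuclideanSpace ℝ (Fin n) → ℂ) (t : ℝ)
    (η : EuclideanSpace ℝ (Fin n)) : ℂ :=
  dampingFactor b t * (-sinSymbol t η * (freq η * p t η) + cosSymbol t η * (-Complex.I * p' t η))

theorem memLp_neg_I_mul {b : ℝ → ℝ} {p p' : ℝ → EuclideanSpace ℝ (Fin n) → ℂ} {C : ℝ}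
    (H : IsSymbolMode b p p' C) {t : ℝ} (ht : 0 ≤ t) :
    MemLp (fun η => -Complex.I * p' t η) ∞ volume :=
  (H.memLp' ht).const_mul _

/-- The limit of the rows for the mode `c y`. -/
theorem DampingBounds.exists_row_limit {b b₁ h : ℝ → ℝ} {B Q K : ℝ}
    (H : DampingBounds b b₁ h B Q K) (hn : 1 ≤ n) {y y' : ℝ → ℝ → ℝ}
    (hy : ∀ r, IsModeSolution b r (y r) (y' r)) {c : EuclideanSpace ℝ (Fin n) → ℂ} {C : ℝ}
    (Hp : IsSymbolMode b (fun t η => c η * (y (freq η) t : ℂ))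
      (fun t η => c η * (y' (freq η) t : ℂ)) C)
    (hc : ∀ η, ‖c η‖ ^ 2 * ((1 + freq η ^ 2) * y (freq η) 0 ^ 2 + y' (freq η) 0 ^ 2) ≤ 1) :
    (∃ q₀ : EuclideanSpace ℝ (Fin n) → ℂ, MemLp q₀ ∞ volume ∧
      (∀ᵐ η, Tendsto (fun t : ℝ≥0 => rowOne b (fun t η => c η * (y (freq η) t : ℂ))
        (fun t η => c η * (y' (freq η) t : ℂ)) t η) atTop (𝓝 (q₀ η))) ∧
      ∀ f : L2 n, Tendsto (fun t : ℝ≥0 => fMul (rowOne b (fun t η => c η * (y (freq η) t : ℂ))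
        (fun t η => c η * (y' (freq η) t : ℂ)) t) f) atTop (𝓝 (fMul q₀ f))) ∧
    ∃ q₀ : EuclideanSpace ℝ (Fin n) → ℂ, MemLp q₀ ∞ volume ∧
      (∀ᵐ η, Tendsto (fun t : ℝ≥0 => rowTwo b (fun t η => c η * (y (freq η) t : ℂ))
        (fun t η => c η * (y' (freq η) t : ℂ)) t η) atTop (𝓝 (q₀ η))) ∧
      ∀ f : L2 n, Tendsto (fun t : ℝ≥0 => fMul (rowTwo b (fun t η => c η * (y (freq η) t : ℂ))
        (fun t η => c η * (y' (freq η) t : ℂ)) t) f) atTop (𝓝 (fMul q₀ f)) := by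
  set M := (2 + B ^ 2) ^ 2 * Real.exp Q * ((2 * K ^ 2 + 1) * Real.exp K) * 3 with hM
  have hM0 : 0 ≤ M := by positivity
  set l := dampingFactor b with hl
  -- The normalisation `hc` of the data cancels the right-hand side of `mode_le`, so the bound
  -- depends neither on `t` nor on `η`.
  have hbound : ∀ t : ℝ, 0 ≤ t → ∀ η : EuclideanSpace ℝ (Fin n),
      ‖c η‖ * |l t * (freq η * y (freq η) t)| ≤ √M ∧ ‖c η‖ * |l t * y' (freq η) t| ≤ √M := by
    intro t ht η
    have h1 := H.mode_le (hy (freq η)) (freq_nonneg η) ht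
    have h2 := mul_le_mul_of_nonneg_left h1 (sq_nonneg ‖c η‖)
    have h3 := mul_le_mul_of_nonneg_left (hc η) hM0
    have h4 := sq_nonneg (‖c η‖ * (l t * (freq η * y (freq η) t)))
    have h5 := sq_nonneg (‖c η‖ * (l t * y' (freq η) t))
    have h6 : (‖c η‖ * (l t * (freq η * y (freq η) t))) ^ 2 + (‖c η‖ * (l t * y' (freq η) t)) ^ 2
        ≤ M := by
      calc _ = ‖c η‖ ^ 2 * (l t ^ 2 * (freq η ^ 2 * y (freq η) t ^ 2 + y' (freq η) t ^ 2)) := by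
            ring
        _ ≤ _ := h2
        _ = M * (‖c η‖ ^ 2 *
            ((1 + freq η ^ 2) * y (freq η) 0 ^ 2 + y' (freq η) 0 ^ 2)) := by rw [hM]; ring
        _ ≤ M * 1 := h3
        _ = M := mul_one M
    constructor
    · have := Real.abs_le_sqrt (h6.trans' (le_add_of_nonneg_right h5))
      rwa [abs_mul, abs_of_nonneg (norm_nonneg (c η))] at this
    · have := Real.abs_le_sqrt (h6.trans' (le_add_of_nonneg_left h4))
      rwa [abs_mul, abs_of_nonneg (norm_nonneg (c η))] at this
  have hcomb : ∀ t : ℝ, 0 ≤ t → ∀ (η : EuclideanSpace ℝ (Fin n)) (x z : ℝ), |x| ≤ 1 → |z| ≤ 1 →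
      ‖c η * ((l t * (x * (freq η * y (freq η) t) + z * y' (freq η) t) : ℝ) : ℂ)‖ ≤ 2 * √M := by
    intro t ht η x z hx hz
    obtain ⟨h1, h2⟩ := hbound t ht η
    rw [norm_mul, Complex.norm_real, Real.norm_eq_abs]
    have h3 : |l t * (x * (freq η * y (freq η) t) + z * y' (freq η) t)|
        ≤ |l t * (freq η * y (freq η) t)| + |l t * y' (freq η) t| := by
      calc _ = |x * (l t * (freq η * y (freq η) t)) + z * (l t * y' (freq η) t)| := by
            congr 1; ring
        _ ≤ |x| * |l t * (freq η * y (freq η) t)| + |z| * |l t * y' (freq η) t| := by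
            rw [← abs_mul, ← abs_mul]; exact abs_add_le _ _
        _ ≤ _ := add_le_add (mul_le_of_le_one_left (abs_nonneg _) hx)
            (mul_le_of_le_one_left (abs_nonneg _) hz)
    have h4 := mul_le_mul_of_nonneg_left h3 (norm_nonneg (c η))
    linarith
  have e1 : ∀ t η, rowOne b (fun t η => c η * (y (freq η) t : ℂ))
      (fun t η => c η * (y' (freq η) t : ℂ)) t η = c η * ((l t * (Real.cos (freq η * t) *
        (freq η * y (freq η) t) + -Real.sin (freq η * t) * y' (freq η) t) : ℝ) : ℂ) := by
    intro t η
    simp only [rowOne, cosSymbol, sinSymbol]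
    push_cast
    linear_combination (l t : ℂ) * Complex.sin (freq η * t) * c η * (y' (freq η) t : ℂ)
      * Complex.I_sq
  have e2 : ∀ t η, rowTwo b (fun t η => c η * (y (freq η) t : ℂ))
      (fun t η => c η * (y' (freq η) t : ℂ)) t η = -Complex.I * (c η * ((l t *
        (Real.sin (freq η * t) * (freq η * y (freq η) t)
          + Real.cos (freq η * t) * y' (freq η) t) : ℝ) : ℂ)) := by
    intro t η
    simp only [rowTwo, cosSymbol, sinSymbol]
    push_cast
    ring
  constructor
  · refine exists_symbol_limit (C := 2 * √M) (fun t => ?_) (fun t η => ?_) ?_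
    · exact ((memLp_top_mul (memLp_cosSymbol t) (Hp.memLp_freq t.2)).add
        (memLp_top_mul (memLp_neg_sinSymbol t) (memLp_neg_I_mul Hp t.2))).1.const_mul _
    · rw [e1]
      exact hcomb t t.2 η _ _ (Real.abs_cos_le_one _) (by
        rw [abs_neg]; exact Real.abs_sin_le_one _)
    · filter_upwards [ae_freq_pos hn] with η hη
      obtain ⟨a, ha⟩ := (H.exists_tendsto (hy (freq η)) hη).1
      refine ⟨c η * (a : ℂ), ?_⟩
      simp only [e1]
      refine ((Complex.continuous_ofReal.tendsto a).comp
        ((ha.comp (NNReal.tendsto_coe_atTop.2 tendsto_id)).congr fun t => ?_)).const_mul (c η)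
      simp only [Function.comp_apply, id_eq, hl]
      ring
  · refine exists_symbol_limit (C := 2 * √M) (fun t => ?_) (fun t η => ?_) ?_
    · exact ((memLp_top_mul (memLp_neg_sinSymbol t) (Hp.memLp_freq t.2)).add
        (memLp_top_mul (memLp_cosSymbol t) (memLp_neg_I_mul Hp t.2))).1.const_mul _
    · rw [e2, norm_mul, norm_neg, Complex.norm_I, one_mul]
      exact hcomb t t.2 η _ _ (Real.abs_sin_le_one _) (Real.abs_cos_le_one _)
    · filter_upwards [ae_freq_pos hn] with η hη
      obtain ⟨a, ha⟩ := (H.exists_tendsto (hy (freq η)) hη).2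
      refine ⟨-Complex.I * (c η * (a : ℂ)), ?_⟩
      simp only [e2]
      exact ((((Complex.continuous_ofReal.tendsto a).comp
        (ha.comp (NNReal.tendsto_coe_atTop.2 tendsto_id))).const_mul (c η))).const_mul _

theorem memLp_top_mul_add_mul {m₁ m₂ m₃ m₄ : EuclideanSpace ℝ (Fin n) → ℂ}
    (h₁ : MemLp m₁ ∞ volume) (h₂ : MemLp m₂ ∞ volume) (h₃ : MemLp m₃ ∞ volume)
    (h₄ : MemLp m₄ ∞ volume) : MemLp (fun η => m₁ η * m₂ η + m₃ η * m₄ η) ∞ volume :=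
  (memLp_top_mul h₁ h₂).add (memLp_top_mul h₃ h₄)

theorem smul_freeOp_symm_energyOp {b : ℝ → ℝ} {y₁ y₁' y₂ y₂' : ℝ → ℝ → ℝ}
    (F : IsFundamental b y₁ y₁' y₂ y₂') (hb : ∀ t, 0 ≤ t → 0 ≤ b t) {t : ℝ} (ht : 0 ≤ t)
    (f : L2Pair n) :
    (dampingFactor b t : ℂ) • (freeOp n t).symm (energyOp n y₁ y₁' y₂ y₂' t f) =
      symMat (rowOne b (symbolOne y₁) (symbolOne y₁') t) (rowOne b (symbolTwo y₂) (symbolTwo y₂') t)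
        (rowTwo b (symbolOne y₁) (symbolOne y₁') t) (rowTwo b (symbolTwo y₂) (symbolTwo y₂') t)
        f := by
  have H₁ := F.isSymbolMode_one (n := n) hb
  have H₂ := F.isSymbolMode_two (n := n) hb
  have hc := memLp_cosSymbol (n := n) t
  have hs := memLp_neg_sinSymbol (n := n) t
  have f₁ := H₁.memLp_freq ht
  have f₂ := H₂.memLp_freq ht
  have i₁ := memLp_neg_I_mul H₁ ht
  have i₂ := memLp_neg_I_mul H₂ ht
  rw [freeOp_symm_apply, energyOp, symMat_symMat hc hs hs hc f₁ f₂ i₁ i₂,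
    symMat_smul (memLp_top_mul_add_mul hc f₁ hs i₁) (memLp_top_mul_add_mul hc f₂ hs i₂)
      (memLp_top_mul_add_mul hs f₁ hc i₁) (memLp_top_mul_add_mul hs f₂ hc i₂)]
  rfl

/-- The free propagator has determinant `cos² + sin² = 1`, and the two factors `λ` supply exactly
the `λ²` that makes the Wronskian constant. The value is independent of `t` and hence survives the
limit. -/
theorem row_det {b b₁ h : ℝ → ℝ} {B Q K : ℝ} (H : DampingBounds b b₁ h B Q K)
    {y₁ y₁' y₂ y₂' : ℝ → ℝ → ℝ} (F : IsFundamental b y₁ y₁' y₂ y₂') {t : ℝ} (ht : 0 ≤ t)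
    (η : EuclideanSpace ℝ (Fin n)) :
    rowOne b (symbolOne y₁) (symbolOne y₁') t η * rowTwo b (symbolTwo y₂) (symbolTwo y₂') t η
      - rowOne b (symbolTwo y₂) (symbolTwo y₂') t η * rowTwo b (symbolOne y₁) (symbolOne y₁') t η
      = freqRatio η := by
  have h1 := H.wronskian_eq (F.sol₁ (freq η)) (F.sol₂ (freq η)) ht
  rw [F.init₁, F.init₁', F.init₂, F.init₂'] at h1
  have h2 : (dampingFactor b t : ℂ) ^ 2 * ((y₁ (freq η) t : ℂ) * (y₂' (freq η) t : ℂ)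
      - (y₁' (freq η) t : ℂ) * (y₂ (freq η) t : ℂ)) = 1 := by
    have h3 : dampingFactor b t ^ 2 * (y₁ (freq η) t * y₂' (freq η) t
      - y₁' (freq η) t * y₂ (freq η) t) = 1 := by rw [h1]; ring
    exact_mod_cast h3
  have h4 : rowOne b (symbolOne y₁) (symbolOne y₁') t η
      * rowTwo b (symbolTwo y₂) (symbolTwo y₂') t η
      - rowOne b (symbolTwo y₂) (symbolTwo y₂') t η * rowTwo b (symbolOne y₁) (symbolOne y₁') t η
      = (cosSymbol t η * cosSymbol t η - sinSymbol t η * sinSymbol t η) *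
        ((dampingFactor b t : ℂ) ^ 2 * (freq η * -Complex.I) *
        (symbolOne y₁ t η * symbolTwo y₂' t η - symbolOne y₁' t η * symbolTwo y₂ t η)) := by
    simp only [rowOne, rowTwo]
    ring
  rw [h4, cosSymbol_sq_sub]
  simp only [symbolOne, symbolTwo, freqRatio]
  push_cast
  linear_combination ((freq η : ℂ) * (bracket η : ℂ)⁻¹) * h2 -
    ((freq η : ℂ) * (bracket η : ℂ)⁻¹) * ((dampingFactor b t : ℂ) ^ 2 *
      ((y₁ (freq η) t : ℂ) * (y₂' (freq η) t : ℂ)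
      - (y₁' (freq η) t : ℂ) * (y₂ (freq η) t : ℂ))) * Complex.I_sq

end

end DampedWave

end

/-! ### The main theorem. -/

theorem mainTheorem3 (n : ℕ) (hn : 1 ≤ n) (b : ℝ → ℝ)
    (hb_smooth : ContDiffOn ℝ ∞ b (Set.Ici 0))
    (hb_nonneg : ∀ t : ℝ, 0 ≤ t → 0 ≤ b t)
    (hb_monotone : MonotoneOn b (Set.Ici 0) ∨ AntitoneOn b (Set.Ici 0))
    (hb_deriv : ∀ k : ℕ, 1 ≤ k → ∃ C : ℝ, ∀ t : ℝ, 0 ≤ t →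
      |iteratedDerivWithin k b (Set.Ici 0) t| ≤ C * b t * (1 / (1 + t)) ^ k)
    (hb_nonEffective : Filter.limsup (fun t : ℝ => ((t * b t : ℝ) : EReal)) Filter.atTop < 1) :
    (∃! E : ℝ≥0 → (DampedWave.L2Pair n →L[ℂ] DampedWave.L2Pair n),
      DampedWave.IsEnergyOperator b E) ∧
    (∃! E₀ : ℝ≥0 → (DampedWave.L2Pair n ≃ₗᵢ[ℂ] DampedWave.L2Pair n),
      DampedWave.IsFreePropagator E₀) ∧
    ∀ (E : ℝ≥0 → (DampedWave.L2Pair n →L[ℂ] DampedWave.L2Pair n))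
      (E₀ : ℝ≥0 → (DampedWave.L2Pair n ≃ₗᵢ[ℂ] DampedWave.L2Pair n)),
      DampedWave.IsEnergyOperator b E → DampedWave.IsFreePropagator E₀ →
      ∃ W : DampedWave.L2Pair n →L[ℂ] DampedWave.L2Pair n,
        (∀ f : DampedWave.L2Pair n,
          Filter.Tendsto
            (fun t : ℝ≥0 => (DampedWave.dampingFactor b t : ℂ) • (E₀ t).symm (E t f))
            Filter.atTop (nhds (W f))) ∧
        Function.Injective W ∧
        DenseRange W ∧
        ∀ (a : EuclideanSpace ℝ (Fin n)) (f : DampedWave.L2Pair n),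
          W (DampedWave.translatePair a f) = DampedWave.translatePair a (W f) := by
  open DampedWave MeasureTheory Filter Topology in
  have hc : ContinuousOn b (Set.Ici 0) := hb_smooth.continuousOn
  obtain ⟨y₁, y₁', y₂, y₂', F⟩ := exists_isFundamental hc hb_nonneg
  obtain ⟨b₁, h, B, Q, K, H⟩ :=
    exists_dampingBounds hb_smooth hb_nonneg (hb_deriv 1 le_rfl) hb_nonEffective
  have hE := F.isEnergyOperator (n := n) hc hb_nonneg
  have hE₀ := isFreePropagator_freeOp (n := n)
  refine ⟨⟨_, hE, fun E' hE' => hE'.unique hE⟩, ⟨_, hE₀, fun E' hE' => hE'.unique hn hE₀⟩,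
    fun E E₀ hE' hE₀' => ?_⟩
  rw [hE'.unique hE, hE₀'.unique hn hE₀]
  -- By uniqueness the operators are now the explicit multipliers; the columns of the limit symbol
  -- come from the modes `y₁ / ⟨ξ⟩` and `i y₂`, whose prefactors normalise the data.
  obtain ⟨⟨w₁₁, m₁₁, l₁₁, t₁₁⟩, w₂₁, m₂₁, l₂₁, t₂₁⟩ := H.exists_row_limit hn F.sol₁
    (c := fun η : EuclideanSpace ℝ (Fin n) => (((bracket η)⁻¹ : ℝ) : ℂ))
    (F.isSymbolMode_one hb_nonneg) fun η => by
      rw [F.init₁, F.init₁', Complex.norm_real, Real.norm_of_nonneg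
        (inv_pos.2 (bracket_pos η)).le, ← bracket_sq]
      have := (bracket_pos η).ne'
      rw [one_pow, mul_one, zero_pow two_ne_zero, add_zero, ← mul_pow, inv_mul_cancel₀ this, one_pow]
  obtain ⟨⟨w₁₂, m₁₂, l₁₂, t₁₂⟩, w₂₂, m₂₂, l₂₂, t₂₂⟩ := H.exists_row_limit hn F.sol₂
    (c := fun η : EuclideanSpace ℝ (Fin n) => Complex.I)
    (F.isSymbolMode_two hb_nonneg) fun η => by
      rw [F.init₂, F.init₂', Complex.norm_I]
      norm_num
  -- The determinant of the limit is the limit of a constant, `|ξ| / ⟨ξ⟩`.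
  have hdet : ∀ᵐ η : EuclideanSpace ℝ (Fin n), w₁₁ η * w₂₂ η - w₁₂ η * w₂₁ η ≠ 0 := by
    filter_upwards [l₁₁, l₂₁, l₁₂, l₂₂, ae_freqRatio_ne_zero hn] with η h₁ h₂ h₃ h₄ h₅
    have h₆ := tendsto_nhds_unique ((h₁.mul h₄).sub (h₃.mul h₂))
      (tendsto_const_nhds.congr fun t : ℝ≥0 => (row_det H F t.2 η).symm)
    rwa [h₆]
  refine ⟨symMat w₁₁ w₁₂ w₂₁ w₂₂, fun f => ?_, symMat_injective m₁₁ m₁₂ m₂₁ m₂₂ hdet,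
    symMat_denseRange m₁₁ m₁₂ m₂₁ m₂₂ hdet,
    fun a f => symMat_translatePair m₁₁ m₁₂ m₂₁ m₂₂ a f⟩
  exact (tendsto_symMat t₁₁ t₁₂ t₂₁ t₂₂ f).congr fun t =>
    (smul_freeOp_symm_energyOp F hb_nonneg t.2 f).symm
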